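/- Notation. $\langle z\rangle=(1+|z|^2)^{1/2}$, $v_s(z)=\langle z\rangle^s$; $\hat f(\eta)=\int f(v)e^{-2\pi i\langle v,\eta\rangle}dv$; for $z=(x,\xi)$, $\pi(z)g(v)=e^{2\pi i\langle v,\xi\rangle}g(v-x)$; $\langle u,\varphi\rangle$ is the bracket on $\mathcal S'\times\mathcal S$, antilinear in $\varphi$, extending $\int u\bar\varphi$. For $m\in\mathbb R$, $\Gamma^m(\mathbb R^{2d})$ is the Fréchet space of smooth $a$ with $|\partial^\alpha a(z)|\le C_\alpha\langle z\rangle^{m-|\alpha|}$ for all $\alpha$. A function $a\in\Gamma^m(\mathbb R^{2d})$ is in $\Gamma^{m,\mathrm{cl}}(\mathbb R^{2d})$ with principal symbol $a_m$ if there are $a_{m-j}\in\Gamma^{m-j}(\mathbb R^{2d})$, $j\ge 0$, with $a_{m-j}(\lambda z)=\lambda^{m-j}a_{m-j}(z)$ for $|z|\ge1$, $\lambda\ge1$, and $a-\sum_{j<r}a_{m-j}\in\Gamma^{m-r}(\mathbb R^{2d})$ for all $r\ge1$. For a fixed window $\psi\in\mathcal S(\mathbb R^{2d})\setminus\{0\}$,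 $M^\infty_{1\otimes v_s}(\mathbb R^{2d})$ is the space of $\sigma\in\mathcal S'(\mathbb R^{2d})$ with $$\|\sigma\|_{M^\infty_{1\otimes v_s}}=\sup_{z,\zeta\in\mathbb R^{2d}}|\langle\sigma,\pi(z,\zeta)\psi\rangle|\,\langle\zeta\rangle^s<\infty .$$ A smooth $\Phi:\mathbb R^{2d}\to\mathbb R$ is a tame phase if $\partial^\alpha\Phi$ is bounded for every $|\alpha|\ge2$ and $|\det\partial^2_{x,\eta}\Phi|\ge c$ on $\mathbb R^{2d}$ for some $c>0$. The related tame canonical transformation is the unique $\chi:\mathbb R^{2d}\to\mathbb R^{2d}$ with $\chi(\nabla_\eta\Phi(x,\eta),\eta)=(x,\nabla_x\Phi(x,\eta))$ for all $x,\eta$. Theorem. Let $g\in\mathcal S(\mathbb R^d)$, $g\ne0$, $s\ge0$, $T>0$. Let $a\in\Gamma^{2,\mathrm{cl}}(\mathbb R^{2d})$ have real-valued principal symbol $a_2$, and let $\Phi\in C^\infty(]-T,T[,\Gamma^2(\mathbb R^{2d}))$ be such that $\Phi(t,\cdot)$ is a tame phase for each $t\in]-T,T[$ and $$2\pi\,\partial_t\Phi+a_2(x,\nabla_x\Phi)=0\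 \text{ on } ]-T,T[\times\mathbb R^{2d},\qquad \Phi(0,x,\eta)=\langle x,\eta\rangle .$$ Let $\chi_t$ be the tame canonical transformation related to $\Phi(t,\cdot)$. Let $I=I_t$, $t\in]-T,T[$, be any family (possibly constant) of continuous linear operators $\mathcal S(\mathbb R^d)\to\mathcal S'(\mathbb R^d)$. Then the following are equivalent. (i) There are $\sigma_t\in M^\infty_{1\otimes v_s}(\mathbb R^{2d})$ and a continuous function $H:]-T,T[\to\mathbb R$ with $\|\sigma_t\|_{M^\infty_{1\otimes v_s}}\le H(t)$ such that, for all $t\in]-T,T[$, $I_t$ is the type I Fourier integral operator $$I_tf(x)=I(\sigma_t,\Phi(t,\cdot))f(x)=\int_{\mathbb R^d}e^{2\pi i\Phi(t,x,\eta)}\sigma_t(x,\eta)\hat f(\eta)\,d\eta,\qquad f\in\mathcal S(\mathbb R^d),$$ understood in the sense of distributions: tested against $\varphi\in\mathcal S(\mathbb R^d)$ (bilinear pairing), $I_tf$ gives the value of $\sigma_t$ on the Schwartz function $(x,\eta)\mapsto e^{2\pi i\Phi(t,x,\eta)}\hat f(\eta)\varphi(x)$. (ii) $I_t\in FIO(\chi_t,s)$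 for all $t\in]-T,T[$, with a constant continuous in $t$: there is a continuous function $C:]-T,T[\to\mathbb R$ with $$|\langle I_t\pi(w)g,\pi(z)g\rangle|\le C(t)\,\langle z-\chi_t(w)\rangle^{-s}\qquad\text{for all } w,z\in\mathbb R^{2d},\ t\in]-T,T[ .$$ -/

import Mathlib

open scoped SchwartzMap FourierTransform ContDiff Topology ENNReal

namespace TypeOneFIO

noncomputable section

/-! ### Schwartz functions, time-frequency shifts, short-time Fourier transform -/

/-- A unimodular exponential `exp (2 π i Ψ)` has temperate growth as soon as the real function `Ψ`
has; this makes the multiplications below multiplications by an admissible function. -/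
theorem hasTemperateGrowth_exp {V : Type*} [NormedAddCommGroup V] [NormedSpace ℝ V] {Ψ : V → ℝ}
    (hΨ : Ψ.HasTemperateGrowth) :
    (fun v => Complex.exp (2 * Real.pi * Complex.I * (Ψ v : ℂ))).HasTemperateGrowth := by
  have key : (fun r : ℝ => Complex.exp (2 * Real.pi * Complex.I * (r : ℂ))).HasTemperateGrowth := by
    have hd : ∀ n : ℕ, iteratedDeriv n
        (fun r : ℝ => Complex.exp (2 * Real.pi * Complex.I * (r : ℂ))) =
        fun r : ℝ => (2 * Real.pi * Complex.I) ^ n *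
          Complex.exp (2 * Real.pi * Complex.I * (r : ℂ)) := by
      intro n
      induction n with
      | zero => simp
      | succ n ih =>
        rw [iteratedDeriv_succ, ih]
        funext r
        have h1 : HasDerivAt (fun r : ℝ => 2 * (Real.pi : ℂ) * Complex.I * (r : ℂ))
            (2 * Real.pi * Complex.I * 1) r :=
          (Complex.ofRealCLM.hasDerivAt (x := r)).const_mul _
        have h2 := (h1.cexp.const_mul ((2 * (Real.pi : ℂ) * Complex.I) ^ n)).deriv
        rw [h2]
        ring
    have hc : ContDiff ℝ ∞ (fun r : ℝ => Complex.exp (2 * Real.pi * Complex.I * (r : ℂ))) :=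
      (contDiff_const.mul Complex.ofRealCLM.contDiff).cexp
    refine ⟨hc, fun n => ⟨0, (2 * Real.pi) ^ n, fun r => ?_⟩⟩
    rw [norm_iteratedFDeriv_eq_norm_iteratedDeriv, hd n]
    have h3 : ‖Complex.exp (2 * Real.pi * Complex.I * (r : ℂ))‖ = 1 := by
      rw [Complex.norm_exp]
      simp
    simp only [norm_mul, norm_pow, h3]
    simp [abs_of_pos Real.pi_pos]
  exact key.comp hΨ

section Shift

variable {V : Type*} [NormedAddCommGroup V] [InnerProductSpace ℝ V]

/-- The time-frequency shift `M_ξ T_x g (v) = exp (2 π i ⟨v, ξ⟩) g (v - x)` on Schwartz functions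
(see `tfShift_apply`). -/
def tfShift (x ξ : V) (g : 𝓢(V, ℂ)) : 𝓢(V, ℂ) :=
  SchwartzMap.smulLeftCLM ℂ
    (fun v : V => Complex.exp (2 * Real.pi * Complex.I * ((inner ℝ v ξ : ℝ) : ℂ)))
    (SchwartzMap.compSubConstCLM ℂ x g)

theorem tfShift_apply (x ξ : V) (g : 𝓢(V, ℂ)) (v : V) :
    tfShift x ξ g v =
      Complex.exp (2 * Real.pi * Complex.I * ((inner ℝ v ξ : ℝ) : ℂ)) * g (v - x) := by
  have h : (fun v : V =>
      Complex.exp (2 * Real.pi * Complex.I * ((inner ℝ v ξ : ℝ) : ℂ))).HasTemperateGrowth :=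
    hasTemperateGrowth_exp (Function.hasTemperateGrowth_inner_left ξ)
  simp [tfShift, h]

/-- The complex conjugate of a Schwartz function. -/
def schwartzConj (φ : 𝓢(V, ℂ)) : 𝓢(V, ℂ) :=
  SchwartzMap.postcompCLM (𝕜 := ℝ) (Complex.conjCLE : ℂ →L[ℝ] ℂ) φ

theorem schwartzConj_apply (φ : 𝓢(V, ℂ)) (v : V) :
    schwartzConj φ v = (starRingEnd ℂ) (φ v) := rfl

/-- The sesquilinear bracket `⟨u, φ⟩`, antilinear in `φ`, extending `∫ u conj(φ)`. -/
def bracket (u : 𝓢'(V, ℂ)) (φ : 𝓢(V, ℂ)) : ℂ := u (schwartzConj φ)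

/-- The short-time Fourier transform `V_ψ u (x, ξ) = ⟨u, M_ξ T_x ψ⟩`. -/
def stft (ψ : 𝓢(V, ℂ)) (u : 𝓢'(V, ℂ)) (x ξ : V) : ℂ := bracket u (tfShift x ξ ψ)

end Shift

/-- The weight `v_s(z) = ⟨z⟩^s = (1 + |z|²)^(s/2)`. -/
def japaneseWeight {V : Type*} [NormedAddCommGroup V] (s : ℝ) (z : V) : ℝ :=
  (1 + ‖z‖ ^ 2) ^ (s / 2)

section Modulation

variable {V : Type*} [NormedAddCommGroup V] [InnerProductSpace ℝ V]

/-- The norm of `M^∞_{1 ⊗ v_s}` computed with the window `ψ`, with values in `[0, ∞]`: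
`sup_{x, ξ} |V_ψ u (x, ξ)| ⟨ξ⟩^s`. (The short-time Fourier transform is continuous, so the
supremum is the essential supremum.) -/
def modulationENorm (ψ : 𝓢(V, ℂ)) (s : ℝ) (u : 𝓢'(V, ℂ)) : ℝ≥0∞ :=
  ⨆ (x : V) (ξ : V), ENNReal.ofReal (‖stft ψ u x ξ‖ * japaneseWeight s ξ)

/-- `u ∈ M^∞_{1 ⊗ v_s}`. -/
def MemModulation (ψ : 𝓢(V, ℂ)) (s : ℝ) (u : 𝓢'(V, ℂ)) : Prop :=
  modulationENorm ψ s u < ⊤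

/-- The real-valued norm of `M^∞_{1 ⊗ v_s}`, meaningful for members of the space. -/
def modulationNorm (ψ : 𝓢(V, ℂ)) (s : ℝ) (u : 𝓢'(V, ℂ)) : ℝ :=
  (modulationENorm ψ s u).toReal

end Modulation

/-! ### Shubin classes -/

section Shubin

variable {V F : Type*} [NormedAddCommGroup V] [NormedSpace ℝ V]
  [NormedAddCommGroup F] [NormedSpace ℝ F]

/-- The seminorms `sup_z |D^n a(z)| ⟨z⟩^(n - m)` defining the Fréchet topology of `Γ^m`. -/
def shubinSeminorm (m : ℝ) (n : ℕ) (a : V → F) : ℝ≥0∞ :=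
  ⨆ z : V, ENNReal.ofReal (‖iteratedFDeriv ℝ n a z‖ * japaneseWeight (n - m) z)

/-- The Shubin class `Γ^m`: smooth functions with `|∂^α a(z)| ≤ C_α ⟨z⟩^(m - |α|)`. -/
def IsShubin (m : ℝ) (a : V → F) : Prop :=
  ContDiff ℝ ∞ a ∧ ∀ n : ℕ, ∃ C : ℝ, ∀ z : V,
    ‖iteratedFDeriv ℝ n a z‖ ≤ C * japaneseWeight (m - n) z

/-- `a` belongs to the class `Γ^{m,cl}` and has principal symbol `p`: there is an asymptotic
expansion `a ∼ ∑ b j` with `b 0 = p`, where `b j` is smooth and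
`b j (λ z) = λ^(m - j) b j z` for `|z| ≥ 1`, `λ ≥ 1`. -/
def IsClassicalShubin (m : ℝ) (a p : V → ℂ) : Prop :=
  IsShubin m a ∧ ∃ b : ℕ → V → ℂ, b 0 = p ∧
    (∀ j : ℕ, IsShubin (m - j) (b j) ∧
      ∀ (z : V) (l : ℝ), 1 ≤ ‖z‖ → 1 ≤ l → b j (l • z) = ((l ^ (m - j) : ℝ) : ℂ) * b j z) ∧
    ∀ r : ℕ, 1 ≤ r → IsShubin (m - r) (fun z => a z - ∑ j ∈ Finset.range r, b j z)

/-- `Φ ∈ C^∞(]-T, T[, Γ^m)`: infinitely differentiable as a curve in the Fréchet space `Γ^m`.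
`Ψ k` is the `k`-th derivative of the curve, difference quotients being taken in all seminorms. -/
def IsSmoothShubinCurve (m T : ℝ) (Φ : ℝ → V → F) : Prop :=
  ∃ Ψ : ℕ → ℝ → V → F, Ψ 0 = Φ ∧
    (∀ k : ℕ, ∀ t ∈ Set.Ioo (-T) T, IsShubin m (Ψ k t)) ∧
    ∀ k n : ℕ, ∀ t ∈ Set.Ioo (-T) T,
      Filter.Tendsto
        (fun h : ℝ => shubinSeminorm m n
          (fun z => h⁻¹ • (Ψ k (t + h) z - Ψ k t z) - Ψ (k + 1) t z))
        (𝓝[≠] 0) (𝓝 0)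

end Shubin

/-! ### Phase functions and canonical transformations -/

/-- `ℝ^d` with its Euclidean norm. -/
abbrev Space (d : ℕ) : Type := EuclideanSpace ℝ (Fin d)

/-- `ℝ^{2d} = ℝ^d × ℝ^d` with its Euclidean norm. -/
abbrev Phase (d : ℕ) : Type := WithLp 2 (Space d × Space d)

/-- The point `(x, η)` of phase space. -/
abbrev pt {d : ℕ} (x η : Space d) : Phase d := WithLp.toLp 2 (x, η)

/-- `∇_x Φ (x, η)`. -/
def gradX {d : ℕ} (Φ : Phase d → ℝ) (x η : Space d) : Space d :=
  gradient (fun x' : Space d => Φ (pt x' η)) x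

/-- `∇_η Φ (x, η)`. -/
def gradEta {d : ℕ} (Φ : Phase d → ℝ) (x η : Space d) : Space d :=
  gradient (fun η' : Space d => Φ (pt x η')) η

/-- `det ∂²_{x,η} Φ (x, η)`, the determinant of the derivative of `η ↦ ∇_x Φ (x, η)`. -/
def mixedHessianDet {d : ℕ} (Φ : Phase d → ℝ) (x η : Space d) : ℝ :=
  (fderiv ℝ (fun η' : Space d => gradX Φ x η') η).det

/-- Tame phase functions. -/
structure IsTamePhase {d : ℕ} (Φ : Phase d → ℝ) : Prop where
  smooth : ContDiff ℝ ∞ Φ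
  bounded : ∀ n : ℕ, 2 ≤ n → ∃ C : ℝ, ∀ z : Phase d, ‖iteratedFDeriv ℝ n Φ z‖ ≤ C
  nondegenerate : ∃ c : ℝ, 0 < c ∧ ∀ x η : Space d, c ≤ |mixedHessianDet Φ x η|

/-- `χ` is the canonical transformation related to the phase `Φ`:
`(x, ∇_x Φ (x, η)) = χ (∇_η Φ (x, η), η)`. For a tame phase, `(x, η) ↦ (∇_η Φ (x, η), η)` is a
bijection of phase space, so that there is exactly one such `χ`. -/
def IsCanonicalTransformationOf {d : ℕ} (χ : Phase d → Phase d) (Φ : Phase d → ℝ) : Prop :=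
  ∀ x η : Space d, χ (pt (gradEta Φ x η) η) = pt x (gradX Φ x η)

/-- `Φ` solves the eikonal equation `2π ∂_t Φ + a₂(x, ∇_x Φ) = 0`, `Φ(0, x, η) = x η`,
on `]-T, T[`. -/
def SolvesEikonal {d : ℕ} (a₂ : Phase d → ℝ) (T : ℝ) (Φ : ℝ → Phase d → ℝ) : Prop :=
  (∀ t ∈ Set.Ioo (-T) T, ∀ x η : Space d,
    2 * Real.pi * deriv (fun τ : ℝ => Φ τ (pt x η)) t + a₂ (pt x (gradX (Φ t) x η)) = 0) ∧
  ∀ x η : Space d, Φ 0 (pt x η) = inner ℝ x η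

/-! ### Fourier integral operators -/

/-- The Gabor matrix `⟨A π(w) g, π(z) g⟩`, where `π(x, ξ) = M_ξ T_x`. -/
def gaborMatrix {d : ℕ} (g : 𝓢(Space d, ℂ)) (A : 𝓢(Space d, ℂ) →L[ℂ] 𝓢'(Space d, ℂ))
    (w z : Phase d) : ℂ :=
  bracket (A (tfShift w.fst w.snd g)) (tfShift z.fst z.snd g)

/-- The Gabor matrix of `A` satisfies `|⟨A π(w) g, π(z) g⟩| ≤ C ⟨z - χ(w)⟩^(-s)` with the
constant `C`. -/
def HasGaborDecay {d : ℕ} (g : 𝓢(Space d, ℂ)) (χ : Phase d → Phase d) (s : ℝ)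
    (A : 𝓢(Space d, ℂ) →L[ℂ] 𝓢'(Space d, ℂ)) (C : ℝ) : Prop :=
  ∀ w z : Phase d, ‖gaborMatrix g A w z‖ ≤ C * japaneseWeight (-s) (z - χ w)

/-- The class `FIO(χ, s)`. It is considered for smooth bi-Lipschitz canonical transformations `χ`
all of whose derivatives of order at least one are bounded; canonical transformations related to
tame phases are of this kind. -/
def MemFIO {d : ℕ} (g : 𝓢(Space d, ℂ)) (χ : Phase d → Phase d) (s : ℝ)
    (A : 𝓢(Space d, ℂ) →L[ℂ] 𝓢'(Space d, ℂ)) : Prop :=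
  ∃ C : ℝ, HasGaborDecay g χ s A C

/-- `A = I(σ, Φ)` is the type I operator
`A f (x) = ∫ exp (2 π i Φ(x, η)) σ(x, η) f̂(η) dη`.
As `σ` is a tempered distribution, the integral is read in the sense of distributions: tested
against `φ`, it is the value of `σ` on the Schwartz function
`(x, η) ↦ exp (2 π i Φ(x, η)) f̂(η) φ(x)`, with `f̂(η) = ∫ f(v) exp (-2 π i ⟨v, η⟩) dv`. -/
def IsTypeOneFIO {d : ℕ} (σ : 𝓢'(Phase d, ℂ)) (Φ : Phase d → ℝ)
    (A : 𝓢(Space d, ℂ) →L[ℂ] 𝓢'(Space d, ℂ)) : Prop :=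
  ∀ f φ : 𝓢(Space d, ℂ), ∃ Θ : 𝓢(Phase d, ℂ),
    (∀ x η : Space d,
      Θ (pt x η) = Complex.exp (2 * Real.pi * Complex.I * (Φ (pt x η) : ℂ)) * (𝓕 f) η * φ x) ∧
    A f φ = σ Θ

end

end TypeOneFIO

open TypeOneFIO

/-!
The two conditions are compared through wave packets on phase space `ℝ^{2d}`. Write `K` for the
kernel of `I_t` in the variables `(x, η)`, that is, `⟨I_t f, φ⟩ = K (φ ⊗ f̂)` with the bilinear
pairing. Then `I_t` is of type I with symbol `σ` exactly if `K = σ · exp (2 π i Φ)`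
(`IsTypeOneFIO.apply_eq`, `isTypeOneFIO_of_apply_eq`), and the Gabor matrix of `I_t`
consists, up to unimodular factors, of the values of `K` on the wave packets with window `ḡ ⊗ ĝ`
(`norm_apply_fourierInv_tfShift`, `tfShift_tensor`).

Multiplication by `exp (2 π i Φ)` moves a wave packet at `(z, ζ)` to `(z, ζ + ∇Φ(z))` and multiplies
its window by `exp` of the nonlinear part of `Φ` at `z` (`expMul_tfShift`). As the derivatives of
`Φ` of order at least two are bounded, the new windows have Schwartz bounds that do not depend on
`z` (`decayBound_localWindow`). The inversion formula for the short-time Fourier transform, applied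
under a distribution (`apply_eq_integral_stft`), then turns a bound `⟨ζ⟩^(-s)` for the values
of `σ` on wave packets into a bound `⟨ζ + ∇Φ(z)⟩^(-s)` for those of `K`, and conversely
(`exists_bound_apply_expMul`, `exists_bound_apply_expMul_neg`). The condition on `I_t` is of the
second kind: with `z = (x, η)` and `ζ = (-ξ, -y)`, the vector `ζ + ∇Φ(z)` is the defect of
`((y, η), (x, ξ))` in the equations of the graph of `χ_t`, and its length is comparable with
`|(x, ξ) - χ_t(y, η)|` (`IsControlledPhase.norm_sub_comparable`). This rests on a global inversion
theorem: the mixed Hessian is bounded from below, so that `x ↦ ∇_η Φ (x, η)` is onto with Lipschitz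
inverse (`surjective_of_lowerBound`, `norm_sub_le_of_lowerBound`).

When `σ` has to be found, the existence of `K` is a kernel theorem for operators with a bounded
Gabor matrix, for which `K` is a superposition of wave packets with the Gabor matrix as coefficients
(`exists_kernel`); then `σ = K · exp (-2 π i Φ)`.

All constants depend only on bounds for finitely many derivatives of `Φ` of order at least two and
on a lower bound for the mixed Hessian. These are locally uniform in `t`
(`IsSmoothShubinCurve.exists_eventually_isControlledPhase`), so that a continuous majorant is
obtained by a partition of unity (`exists_continuousOn_forall_of_eventually`).
-/

namespace TypeOneFIO

noncomputable section

open MeasureTheory Filter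

/-! ### Japanese-bracket weights -/

section Weight

variable {V : Type*} [NormedAddCommGroup V]

theorem japaneseWeight_pos (s : ℝ) (z : V) : 0 < japaneseWeight s z := by
  unfold japaneseWeight; positivity

theorem japaneseWeight_mul_neg (s : ℝ) (z : V) :
    japaneseWeight s z * japaneseWeight (-s) z = 1 := by
  unfold japaneseWeight
  rw [← Real.rpow_add (by positivity)]
  simp [neg_div]

theorem japaneseWeight_neg_arg (s : ℝ) (z : V) : japaneseWeight s (-z) = japaneseWeight s z := by
  simp [japaneseWeight]

/-- Weights of negative order are monotone under linear comparison of the arguments. -/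
theorem japaneseWeight_neg_le_of_norm_le {W : Type*} [NormedAddCommGroup W] {s L : ℝ} (hs : 0 ≤ s)
    (hL : 1 ≤ L) {a : V} {b : W} (h : ‖b‖ ≤ L * ‖a‖) :
    japaneseWeight (-s) a ≤ L ^ s * japaneseWeight (-s) b := by
  unfold japaneseWeight
  have h1 : 1 + ‖b‖ ^ 2 ≤ L ^ 2 * (1 + ‖a‖ ^ 2) := by
    have := pow_le_pow_left₀ (norm_nonneg b) h 2
    nlinarith [sq_nonneg (‖a‖)]
  have h2 : (1 + ‖b‖ ^ 2) ^ (s / 2) ≤ L ^ s * (1 + ‖a‖ ^ 2) ^ (s / 2) := by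
    refine (Real.rpow_le_rpow (by positivity) h1 (by positivity)).trans (le_of_eq ?_)
    rw [Real.mul_rpow (by positivity) (by positivity), ← Real.rpow_natCast L 2,
      ← Real.rpow_mul (by positivity)]
    congr 2; push_cast; ring
  rw [neg_div, Real.rpow_neg (by positivity), Real.rpow_neg (by positivity),
    ← div_eq_mul_inv, le_div_iff₀ (by positivity), inv_mul_le_iff₀ (by positivity)]
  linarith

/-- Peetre's inequality. -/
theorem japaneseWeight_neg_le_peetre {s : ℝ} (hs : 0 ≤ s) (a b : V) :
    japaneseWeight (-s) a ≤ (2 * (1 + ‖a - b‖)) ^ s * japaneseWeight (-s) b := by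
  unfold japaneseWeight
  have hab : ‖b‖ ≤ ‖a‖ + ‖a - b‖ := by
    have := norm_sub_norm_le b a
    rw [norm_sub_rev] at this; linarith
  have h1 : 1 + ‖b‖ ^ 2 ≤ (2 * (1 + ‖a - b‖)) ^ 2 * (1 + ‖a‖ ^ 2) := by
    have := pow_le_pow_left₀ (norm_nonneg b) hab 2
    nlinarith [sq_nonneg (‖a‖ - ‖a - b‖), norm_nonneg (a - b), norm_nonneg a,
      mul_nonneg (norm_nonneg (a - b)) (sq_nonneg ‖a‖),
      mul_nonneg (sq_nonneg ‖a - b‖) (sq_nonneg ‖a‖)]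
  have h2 : (1 + ‖b‖ ^ 2) ^ (s / 2) ≤ (2 * (1 + ‖a - b‖)) ^ s * (1 + ‖a‖ ^ 2) ^ (s / 2) := by
    refine (Real.rpow_le_rpow (by positivity) h1 (by positivity)).trans (le_of_eq ?_)
    rw [Real.mul_rpow (by positivity) (by positivity), ← Real.rpow_natCast _ 2,
      ← Real.rpow_mul (by positivity)]
    congr 2; push_cast; ring
  rw [neg_div, Real.rpow_neg (by positivity), Real.rpow_neg (by positivity),
    ← div_eq_mul_inv, le_div_iff₀ (by positivity), inv_mul_le_iff₀ (by positivity)]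
  linarith

end Weight

/-! ### Quantitative Schwartz decay -/

section Decay

variable {V E : Type*} [NormedAddCommGroup V] [NormedSpace ℝ V]
  [NormedAddCommGroup E] [NormedSpace ℝ E]

/-- All derivatives of `F` up to the order `n` decay like `(1 + ‖v‖)^(-k)`, with the constant `P`.
This is the finite amount of Schwartz decay that is tracked quantitatively, so that the
estimates are uniform over families of Schwartz functions. -/
def DecayBound (k n : ℕ) (P : ℝ) (F : V → E) : Prop :=
  ∀ i ≤ n, ∀ v : V, (1 + ‖v‖) ^ k * ‖iteratedFDeriv ℝ i F v‖ ≤ P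

theorem DecayBound.nonneg {k n : ℕ} {P : ℝ} {F : V → E} (h : DecayBound k n P F) : 0 ≤ P :=
  le_trans (by positivity) (h 0 (Nat.zero_le _) 0)

theorem decayBound_of_seminorm (𝕜 : Type*) [NormedField 𝕜] [NormedSpace 𝕜 E]
    [SMulCommClass ℝ 𝕜 E] (k n : ℕ) (f : 𝓢(V, E)) :
    DecayBound k n
      (2 ^ k * ((Finset.Iic (k, n)).sup (schwartzSeminormFamily 𝕜 V E)) f) f := by
  intro i hi v
  exact SchwartzMap.one_add_le_sup_seminorm_apply (𝕜 := 𝕜) (m := (k, n)) le_rfl hi f v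

theorem exists_decayBound (k n : ℕ) (f : 𝓢(V, E)) : ∃ P, DecayBound k n P f :=
  ⟨_, decayBound_of_seminorm ℝ k n f⟩

theorem seminorm_le_of_decayBound {𝕜 : Type*} [NormedField 𝕜] [NormedSpace 𝕜 E]
    [SMulCommClass ℝ 𝕜 E] {k n : ℕ} {P : ℝ} {f : 𝓢(V, E)}
    (h : DecayBound k n P f) : SchwartzMap.seminorm 𝕜 k n f ≤ P := by
  refine SchwartzMap.seminorm_le_bound 𝕜 k n f h.nonneg fun v => le_trans ?_ (h n le_rfl v)
  gcongr
  linarith [norm_nonneg v]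

/-- A product of a function with polynomially bounded derivatives and of a decaying one. -/
theorem DecayBound.mul_of_growth {k m n : ℕ} {P Q : ℝ} {A F : V → ℂ} (hA : ContDiff ℝ ∞ A)
    (hF : ContDiff ℝ ∞ F) (hQ : ∀ i ≤ n, ∀ v, ‖iteratedFDeriv ℝ i A v‖ ≤ Q * (1 + ‖v‖) ^ m)
    (h : DecayBound (k + m) n P F) : DecayBound k n (2 ^ n * (Q * P)) (fun v => A v * F v) := by
  have hQ0 : 0 ≤ Q := by simpa using (norm_nonneg _).trans (hQ 0 (Nat.zero_le _) 0)
  intro i hi v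
  have h1 := norm_iteratedFDeriv_mul_le hA hF v (n := i) (by exact_mod_cast le_top)
  have h2 : ∀ j ∈ Finset.range (i + 1), (1 + ‖v‖) ^ k *
      ((i.choose j : ℝ) * ‖iteratedFDeriv ℝ j A v‖ * ‖iteratedFDeriv ℝ (i - j) F v‖) ≤
      (i.choose j : ℝ) * (Q * P) := by
    intro j hj
    have hj' : j ≤ i := Nat.lt_succ_iff.1 (Finset.mem_range.1 hj)
    have ha := hQ j (hj'.trans hi) v
    have hb := h (i - j) ((Nat.sub_le _ _).trans hi) v
    calc (1 + ‖v‖) ^ k *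
        ((i.choose j : ℝ) * ‖iteratedFDeriv ℝ j A v‖ * ‖iteratedFDeriv ℝ (i - j) F v‖)
        ≤ (1 + ‖v‖) ^ k *
        ((i.choose j : ℝ) * (Q * (1 + ‖v‖) ^ m) * ‖iteratedFDeriv ℝ (i - j) F v‖) := by gcongr
      _ = (i.choose j : ℝ) * (Q * ((1 + ‖v‖) ^ (k + m) * ‖iteratedFDeriv ℝ (i - j) F v‖)) := by
        rw [pow_add]; ring
      _ ≤ _ := by gcongr
  calc (1 + ‖v‖) ^ k * ‖iteratedFDeriv ℝ i (fun v => A v * F v) v‖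
      ≤ (1 + ‖v‖) ^ k * ∑ j ∈ Finset.range (i + 1),
        (i.choose j : ℝ) * ‖iteratedFDeriv ℝ j A v‖ * ‖iteratedFDeriv ℝ (i - j) F v‖ := by gcongr
    _ ≤ ∑ j ∈ Finset.range (i + 1), (i.choose j : ℝ) * (Q * P) := by
      rw [Finset.mul_sum]; exact Finset.sum_le_sum h2
    _ = 2 ^ i * (Q * P) := by
      rw [← Finset.sum_mul]
      congr 1
      exact_mod_cast Nat.sum_range_choose i
    _ ≤ 2 ^ n * (Q * P) := by
      have := h.nonneg
      gcongr
      norm_num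

/-- Derivatives of a unimodular exponential. -/
theorem norm_iteratedFDeriv_exp_le {Ψ : V → ℝ} (hΨ : ContDiff ℝ ∞ Ψ) {n : ℕ} {R : ℝ} {v : V}
    (h : ∀ i, 1 ≤ i → i ≤ n → ‖iteratedFDeriv ℝ i Ψ v‖ ≤ R ^ i) :
    ‖iteratedFDeriv ℝ n (fun v => Complex.exp (2 * Real.pi * Complex.I * (Ψ v : ℂ))) v‖ ≤
      n.factorial * (2 * Real.pi) ^ n * R ^ n := by
  have hd : ∀ n : ℕ, iteratedDeriv n
      (fun r : ℝ => Complex.exp (2 * Real.pi * Complex.I * (r : ℂ))) =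
      fun r : ℝ => (2 * Real.pi * Complex.I) ^ n *
        Complex.exp (2 * Real.pi * Complex.I * (r : ℂ)) := by
    intro n
    induction n with
    | zero => simp
    | succ n ih =>
      rw [iteratedDeriv_succ, ih]
      funext r
      have h1 : HasDerivAt (fun r : ℝ => 2 * (Real.pi : ℂ) * Complex.I * (r : ℂ))
          (2 * Real.pi * Complex.I * 1) r :=
        (Complex.ofRealCLM.hasDerivAt (x := r)).const_mul _
      have h2 := (h1.cexp.const_mul ((2 * (Real.pi : ℂ) * Complex.I) ^ n)).deriv
      rw [h2]
      ring
  have hc : ContDiff ℝ ∞ (fun r : ℝ => Complex.exp (2 * Real.pi * Complex.I * (r : ℂ))) :=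
    (contDiff_const.mul Complex.ofRealCLM.contDiff).cexp
  refine norm_iteratedFDeriv_comp_le hc hΨ (by exact_mod_cast le_top) v (fun i hi => ?_) h
  rw [norm_iteratedFDeriv_eq_norm_iteratedDeriv, hd i]
  have h3 : ‖Complex.exp (2 * Real.pi * Complex.I * (Ψ v : ℂ))‖ = 1 := by
    rw [Complex.norm_exp]
    simp
  simp only [norm_mul, norm_pow, h3]
  simp only [Complex.norm_ofNat, Complex.norm_real, Real.norm_eq_abs, abs_of_pos Real.pi_pos,
    Complex.norm_I, mul_one]
  exact pow_le_pow_right₀ (by linarith [Real.pi_gt_three]) hi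

end Decay

/-! ### Time-frequency shifts and their pairings -/

section Shifts

variable {V : Type*} [NormedAddCommGroup V] [InnerProductSpace ℝ V]

/-- The unimodular number `exp (2 π i r)`. -/
def phaseExp (r : ℝ) : ℂ := Complex.exp (2 * Real.pi * Complex.I * (r : ℂ))

@[simp] theorem norm_phaseExp (r : ℝ) : ‖phaseExp r‖ = 1 := by
  rw [phaseExp, Complex.norm_exp]; simp

theorem phaseExp_add (r r' : ℝ) : phaseExp (r + r') = phaseExp r * phaseExp r' := by
  rw [phaseExp, phaseExp, phaseExp, ← Complex.exp_add]; push_cast; ring_nf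

@[simp] theorem phaseExp_zero : phaseExp 0 = 1 := by simp [phaseExp]

theorem conj_phaseExp (r : ℝ) : (starRingEnd ℂ) (phaseExp r) = phaseExp (-r) := by
  rw [phaseExp, phaseExp, ← Complex.exp_conj]; simp [map_ofNat]

theorem fourierChar_eq_phaseExp (r : ℝ) : ((Real.fourierChar r : Circle) : ℂ) = phaseExp r := by
  rw [Real.fourierChar_apply, phaseExp]; push_cast; ring_nf

theorem tfShift_apply_phaseExp (x ξ : V) (g : 𝓢(V, ℂ)) (v : V) :
    tfShift x ξ g v = phaseExp (inner ℝ v ξ) * g (v - x) := tfShift_apply x ξ g v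

theorem contDiff_phaseExp_comp {Ψ : V → ℝ} (hΨ : ContDiff ℝ ∞ Ψ) :
    ContDiff ℝ ∞ (fun v => phaseExp (Ψ v)) :=
  (contDiff_const.mul (Complex.ofRealCLM.contDiff.comp hΨ)).cexp

theorem norm_iteratedFDeriv_inner_le (ξ v : V) {i : ℕ} (hi : 1 ≤ i) :
    ‖iteratedFDeriv ℝ i (fun v : V => (inner ℝ v ξ : ℝ)) v‖ ≤ (1 + ‖ξ‖) ^ i := by
  obtain ⟨j, rfl⟩ : ∃ j, i = j + 1 := ⟨i - 1, by omega⟩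
  have hf : fderiv ℝ (fun v : V => (inner ℝ v ξ : ℝ)) = fun _ => innerSL ℝ ξ := by
    funext v
    have : (fun v : V => (inner ℝ v ξ : ℝ)) = innerSL ℝ ξ := by
      funext v; simp [real_inner_comm]
    rw [this, ContinuousLinearMap.fderiv]
  rw [← norm_iteratedFDeriv_fderiv, hf]
  rcases Nat.eq_zero_or_pos j with rfl | hj
  · simp
  · rw [iteratedFDeriv_const_of_ne hj.ne']
    simp; positivity

/-- Shifted functions decay with constants that grow polynomially in the shift. -/
theorem decayBound_tfShift {k n : ℕ} {P : ℝ} {f : 𝓢(V, ℂ)} (h : DecayBound k n P f) (x ξ : V) :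
    DecayBound k n (2 ^ n * ((n.factorial * (2 * Real.pi) ^ n * (1 + ‖ξ‖) ^ n) *
      ((1 + ‖x‖) ^ k * P))) (tfShift x ξ f) := by
  have hcoe : (tfShift x ξ f : V → ℂ) = fun v => phaseExp (inner ℝ v ξ) * f (v - x) := by
    funext v; exact tfShift_apply_phaseExp x ξ f v
  rw [hcoe]
  refine DecayBound.mul_of_growth (m := 0) (A := fun v => phaseExp (inner ℝ v ξ))
    (F := fun v => f (v - x)) (contDiff_phaseExp_comp (contDiff_id.inner ℝ contDiff_const))
    ((f.smooth ⊤).comp (contDiff_id.sub contDiff_const)) (fun i hi v => ?_) ?_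
  · have h1 := norm_iteratedFDeriv_exp_le (Ψ := fun v : V => (inner ℝ v ξ : ℝ))
      (contDiff_id.inner ℝ contDiff_const) (n := i)
      (R := 1 + ‖ξ‖) (v := v) (fun j hj _ => norm_iteratedFDeriv_inner_le ξ v hj)
    refine h1.trans ?_
    have : (1 : ℝ) ≤ 2 * Real.pi := by linarith [Real.pi_gt_three]
    have h3 : (1 : ℝ) ≤ 1 + ‖ξ‖ := by linarith [norm_nonneg ξ]
    rw [pow_zero, mul_one]
    gcongr
  · intro i hi v
    rw [iteratedFDeriv_comp_sub, add_zero]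
    have h1 : (1 + ‖v‖) ≤ (1 + ‖x‖) * (1 + ‖v - x‖) := by
      have := norm_add_le x (v - x)
      rw [add_sub_cancel] at this
      nlinarith [norm_nonneg x, norm_nonneg (v - x)]
    calc (1 + ‖v‖) ^ k * ‖iteratedFDeriv ℝ i f (v - x)‖
        ≤ ((1 + ‖x‖) * (1 + ‖v - x‖)) ^ k * ‖iteratedFDeriv ℝ i f (v - x)‖ := by gcongr
      _ = (1 + ‖x‖) ^ k * ((1 + ‖v - x‖) ^ k * ‖iteratedFDeriv ℝ i f (v - x)‖) := by
        rw [mul_pow]; ring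
      _ ≤ _ := by gcongr; exact h i hi _

end Shifts

section Pairing

variable {V : Type*} [NormedAddCommGroup V] [InnerProductSpace ℝ V] [FiniteDimensional ℝ V]
  [MeasurableSpace V] [BorelSpace V]

/-- The `L²` pairing `∫ F conj(G)` of Schwartz functions. -/
def l2Pair (F G : 𝓢(V, ℂ)) : ℂ := ∫ v, F v * (starRingEnd ℂ) (G v)

variable (V) in
/-- The integral of `(1 + ‖v‖)^(-(dim V + 1))`. -/
def weightIntegral : ℝ := ∫ v : V, (1 + ‖v‖) ^ (-((Module.finrank ℝ V + 1 : ℕ) : ℝ))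

theorem integrable_weight {k : ℕ} (hk : Module.finrank ℝ V + 1 ≤ k) :
    Integrable (fun v : V => ((1 + ‖v‖) ^ k)⁻¹) := by
  have := integrable_one_add_norm (E := V) (μ := volume) (r := (k : ℝ))
    (by exact_mod_cast hk)
  refine this.congr (Filter.Eventually.of_forall fun v => ?_)
  have h0 : 0 ≤ 1 + ‖v‖ := by positivity
  simp only
  rw [Real.rpow_neg h0, Real.rpow_natCast]

/-- The Fourier transform of a function with decaying derivatives decays. -/
theorem norm_fourier_le_of_decayBound {N : ℕ} {P : ℝ} (F : 𝓢(V, ℂ))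
    (h : DecayBound (Module.finrank ℝ V + 1) N P F) (w : V) :
    (1 + ‖w‖) ^ N * ‖𝓕 (F : V → ℂ) w‖ ≤ 4 ^ N * ((N + 1) * (weightIntegral V * P)) := by
  have key : ∀ n ≤ N, ‖w‖ ^ n * ‖𝓕 (F : V → ℂ) w‖ ≤
      2 ^ N * ((N + 1) * (weightIntegral V * P)) := by
    intro n hn
    have h1 := Real.pow_mul_norm_iteratedFDeriv_fourier_le (f := F) (K := ⊤) (N := ⊤)
      (F.smooth ⊤) (fun k n _ _ => F.integrable_pow_mul_iteratedFDeriv volume k n)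
      (k := 0) (n := n) (by simp) (by simp) w
    simp only [norm_iteratedFDeriv_zero, pow_zero, one_mul] at h1
    refine h1.trans ?_
    have h2 : ∀ i ≤ N, ∫ v, ‖iteratedFDeriv ℝ i F v‖ ≤ weightIntegral V * P := by
      intro i hi
      rw [weightIntegral, ← integral_mul_const]
      refine integral_mono_of_nonneg (Filter.Eventually.of_forall fun v => norm_nonneg _) ?_
        (Filter.Eventually.of_forall fun v => ?_)
      · refine ((integrable_weight (V := V) le_rfl).mul_const P).congr
          (Filter.Eventually.of_forall fun v => ?_)
        have h0 : 0 ≤ 1 + ‖v‖ := by positivity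
        simp only
        rw [Real.rpow_neg h0, Real.rpow_natCast]
      · have h0 : 0 < 1 + ‖v‖ := by positivity
        simp only
        rw [Real.rpow_neg h0.le, Real.rpow_natCast, inv_mul_eq_div, le_div_iff₀ (by positivity),
          mul_comm]
        exact h i hi v
    have h3 : ∑ p ∈ Finset.range (0 + 1) ×ˢ Finset.range (n + 1),
        ∫ v, ‖v‖ ^ p.1 * ‖iteratedFDeriv ℝ p.2 F v‖ ≤ (N + 1) * (weightIntegral V * P) := by
      rw [Finset.sum_product]
      simp only [zero_add, Finset.sum_range_one, pow_zero, one_mul]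
      refine (Finset.sum_le_card_nsmul _ _ (weightIntegral V * P) fun i hi => h2 i ?_).trans ?_
      · exact (Nat.lt_succ_iff.1 (Finset.mem_range.1 hi)).trans hn
      · have h4 : 0 ≤ weightIntegral V * P :=
          (integral_nonneg fun v => norm_nonneg _).trans (h2 0 (Nat.zero_le _))
        rw [Finset.card_range, nsmul_eq_mul]
        gcongr
        exact_mod_cast Nat.succ_le_succ hn
    have h5 : (0:ℝ) ≤ ∑ p ∈ Finset.range (0 + 1) ×ˢ Finset.range (n + 1),
        ∫ v, ‖v‖ ^ p.1 * ‖iteratedFDeriv ℝ p.2 F v‖ :=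
      Finset.sum_nonneg fun _ _ => integral_nonneg fun _ => by positivity
    have h6 : (2 * ((0 : ℕ) : ℝ) + 2) ^ n ≤ 2 ^ N := by
      norm_num
      exact pow_le_pow_right₀ (by norm_num) hn
    exact mul_le_mul h6 h3 h5 (by positivity)
  have h7 : (1 + ‖w‖) ^ N ≤ 2 ^ N * max (1 : ℝ) (‖w‖ ^ N) := by
    rcases le_total ‖w‖ 1 with h | h
    · calc (1 + ‖w‖) ^ N ≤ (2 : ℝ) ^ N := by gcongr; linarith
        _ ≤ _ := le_mul_of_one_le_right (by positivity) (le_max_left _ _)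
    · calc (1 + ‖w‖) ^ N ≤ (2 * ‖w‖) ^ N := by gcongr; linarith
        _ = 2 ^ N * ‖w‖ ^ N := mul_pow _ _ _
        _ ≤ _ := by gcongr; exact le_max_right _ _
  have h8 : max (1 : ℝ) (‖w‖ ^ N) * ‖𝓕 (F : V → ℂ) w‖ ≤
      2 ^ N * ((N + 1) * (weightIntegral V * P)) := by
    rw [max_mul_of_nonneg _ _ (norm_nonneg _)]
    exact max_le (by simpa using key 0 (Nat.zero_le _)) (key N le_rfl)
  calc (1 + ‖w‖) ^ N * ‖𝓕 (F : V → ℂ) w‖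
      ≤ 2 ^ N * max (1 : ℝ) (‖w‖ ^ N) * ‖𝓕 (F : V → ℂ) w‖ := by gcongr
    _ ≤ 2 ^ N * (2 ^ N * ((N + 1) * (weightIntegral V * P))) := by
      rw [mul_assoc]; gcongr
    _ = _ := by rw [← mul_assoc, ← mul_pow]; norm_num

end Pairing

section Conj

variable {V : Type*} [NormedAddCommGroup V] [InnerProductSpace ℝ V]

/-- The product `F · conj (G(· - x))`. -/
def mulConjShift (x : V) (F G : 𝓢(V, ℂ)) : 𝓢(V, ℂ) :=
  SchwartzMap.smulLeftCLM ℂ (fun v => F v) (schwartzConj (SchwartzMap.compSubConstCLM ℂ x G))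

theorem mulConjShift_apply (x : V) (F G : 𝓢(V, ℂ)) (v : V) :
    mulConjShift x F G v = F v * (starRingEnd ℂ) (G (v - x)) := by
  rw [mulConjShift, SchwartzMap.smulLeftCLM_apply_apply F.hasTemperateGrowth]
  rfl

theorem decayBound_schwartzConj {k n : ℕ} {P : ℝ} {F : 𝓢(V, ℂ)} (h : DecayBound k n P F) :
    DecayBound k n P (schwartzConj F) := by
  intro i hi v
  have : (schwartzConj F : V → ℂ) = Complex.conjLIE ∘ F := rfl
  rw [this, LinearIsometryEquiv.norm_iteratedFDeriv_comp_left]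
  exact h i hi v

end Conj

section TimeFrequencyDecay

variable {V : Type*} [NormedAddCommGroup V] [InnerProductSpace ℝ V] [FiniteDimensional ℝ V]
  [MeasurableSpace V] [BorelSpace V]

/-- The pairing of shifted functions is, up to a unimodular factor, a value of a Fourier
transform. -/
theorem norm_l2Pair_tfShift (F G : 𝓢(V, ℂ)) (x ξ x' ξ' : V) :
    ‖l2Pair (tfShift x ξ F) (tfShift x' ξ' G)‖ =
      ‖𝓕 (mulConjShift (x' - x) F G : V → ℂ) (ξ' - ξ)‖ := by
  have h : l2Pair (tfShift x ξ F) (tfShift x' ξ' G) =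
      phaseExp (inner ℝ x (ξ - ξ')) * 𝓕 (mulConjShift (x' - x) F G : V → ℂ) (ξ' - ξ) := by
    rw [l2Pair, Real.fourier_eq, ← integral_const_mul, ← integral_add_right_eq_self _ x]
    congr 1
    funext v
    rw [tfShift_apply_phaseExp, tfShift_apply_phaseExp, mulConjShift_apply, Circle.smul_def,
      fourierChar_eq_phaseExp, map_mul, conj_phaseExp, smul_eq_mul]
    have e1 : v + x - x = v := by abel
    have e2 : v + x - x' = v - (x' - x) := by abel
    rw [e1, e2]
    have e3 : phaseExp (inner ℝ (v + x) ξ) * phaseExp (-inner ℝ (v + x) ξ') =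
        phaseExp (inner ℝ x (ξ - ξ')) * phaseExp (-inner ℝ v (ξ' - ξ)) := by
      rw [← phaseExp_add, ← phaseExp_add]
      congr 1
      simp only [inner_add_left, inner_sub_right]
      ring
    linear_combination (F v * (starRingEnd ℂ) (G (v - (x' - x)))) * e3
  rw [h, norm_mul, norm_phaseExp, one_mul]

variable (V) in
/-- The constant in the off-diagonal decay of pairings of time-frequency shifts. -/
def decayConst (N : ℕ) : ℝ := 4 ^ N * ((N + 1) * (weightIntegral V * 2 ^ N))

theorem decayConst_nonneg (N : ℕ) : 0 ≤ decayConst V N := by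
  have : 0 ≤ weightIntegral V := integral_nonneg fun v => by positivity
  unfold decayConst; positivity

/-- Pairings of time-frequency shifts of decaying functions have off-diagonal decay, with
constants controlled by finitely many derivatives. -/
theorem norm_l2Pair_tfShift_le {N : ℕ} {P Q : ℝ} {F G : 𝓢(V, ℂ)}
    (hF : DecayBound (Module.finrank ℝ V + 1 + N) N P F) (hG : DecayBound N N Q G)
    (x ξ x' ξ' : V) :
    ‖l2Pair (tfShift x ξ F) (tfShift x' ξ' G)‖ ≤
      decayConst V N * (P * Q) * (((1 + ‖x - x'‖) ^ N)⁻¹ * ((1 + ‖ξ - ξ'‖) ^ N)⁻¹) := by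
  rw [norm_l2Pair_tfShift]
  have hD : DecayBound (Module.finrank ℝ V + 1) N
      (2 ^ N * (P * (((1 + ‖x' - x‖) ^ N)⁻¹ * Q))) (mulConjShift (x' - x) F G) := by
    intro i hi v
    have hcoe : (mulConjShift (x' - x) F G : V → ℂ) =
        fun v => F v * schwartzConj G (v - (x' - x)) := by
      funext v; exact mulConjShift_apply _ _ _ _
    have hG' : ContDiff ℝ ∞ (fun v => schwartzConj G (v - (x' - x))) :=
      ((schwartzConj G).smooth ⊤).comp (contDiff_id.sub contDiff_const)
    rw [hcoe]
    set y := x' - x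
    have h1 := norm_iteratedFDeriv_mul_le (F.smooth ⊤) hG' v (n := i)
      (by exact_mod_cast le_top)
    have h2 : ∀ j ∈ Finset.range (i + 1), (1 + ‖v‖) ^ (Module.finrank ℝ V + 1) *
        ((i.choose j : ℝ) * ‖iteratedFDeriv ℝ j F v‖ *
          ‖iteratedFDeriv ℝ (i - j) (fun v => schwartzConj G (v - y)) v‖) ≤
        (i.choose j : ℝ) * (P * (((1 + ‖y‖) ^ N)⁻¹ * Q)) := by
      intro j hj
      have hj' : j ≤ i := Nat.lt_succ_iff.1 (Finset.mem_range.1 hj)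
      have ha := hF j (hj'.trans hi) v
      have hb := decayBound_schwartzConj hG (i - j) ((Nat.sub_le _ _).trans hi) (v - y)
      rw [iteratedFDeriv_comp_sub]
      set A := ‖iteratedFDeriv ℝ j F v‖
      set B := ‖iteratedFDeriv ℝ (i - j) (schwartzConj G) (v - y)‖
      have h3 : (1 + ‖y‖) ≤ (1 + ‖v‖) * (1 + ‖v - y‖) := by
        have := norm_sub_le v (v - y)
        rw [sub_sub_cancel] at this
        nlinarith [norm_nonneg v, norm_nonneg (v - y)]
      have hA : 0 ≤ A := norm_nonneg _
      have hB : 0 ≤ B := norm_nonneg _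
      have hy : 0 < (1 + ‖y‖) ^ N := by positivity
      have h4 : (1 + ‖y‖) ^ N * ((1 + ‖v‖) ^ (Module.finrank ℝ V + 1) * (A * B)) ≤ P * Q := by
        calc (1 + ‖y‖) ^ N * ((1 + ‖v‖) ^ (Module.finrank ℝ V + 1) * (A * B))
            ≤ ((1 + ‖v‖) * (1 + ‖v - y‖)) ^ N *
              ((1 + ‖v‖) ^ (Module.finrank ℝ V + 1) * (A * B)) := by gcongr
          _ = ((1 + ‖v‖) ^ (Module.finrank ℝ V + 1 + N) * A) * ((1 + ‖v - y‖) ^ N * B) := by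
            rw [mul_pow, pow_add]; ring
          _ ≤ P * Q := mul_le_mul ha hb (by positivity) hF.nonneg
      calc (1 + ‖v‖) ^ (Module.finrank ℝ V + 1) * ((i.choose j : ℝ) * A * B)
          = (i.choose j : ℝ) * (((1 + ‖y‖) ^ N)⁻¹ *
            ((1 + ‖y‖) ^ N * ((1 + ‖v‖) ^ (Module.finrank ℝ V + 1) * (A * B)))) := by
            rw [inv_mul_cancel_left₀ hy.ne']; ring
        _ ≤ (i.choose j : ℝ) * (((1 + ‖y‖) ^ N)⁻¹ * (P * Q)) := by gcongr
        _ = _ := by ring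
    have hP := hF.nonneg
    have hQ := hG.nonneg
    calc (1 + ‖v‖) ^ (Module.finrank ℝ V + 1) *
          ‖iteratedFDeriv ℝ i (fun v => F v * schwartzConj G (v - y)) v‖
        ≤ (1 + ‖v‖) ^ (Module.finrank ℝ V + 1) * ∑ j ∈ Finset.range (i + 1),
          (i.choose j : ℝ) * ‖iteratedFDeriv ℝ j F v‖ *
            ‖iteratedFDeriv ℝ (i - j) (fun v => schwartzConj G (v - y)) v‖ := by gcongr
      _ ≤ ∑ j ∈ Finset.range (i + 1), (i.choose j : ℝ) * (P * (((1 + ‖y‖) ^ N)⁻¹ * Q)) := by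
        rw [Finset.mul_sum]; exact Finset.sum_le_sum h2
      _ = 2 ^ i * (P * (((1 + ‖y‖) ^ N)⁻¹ * Q)) := by
        rw [← Finset.sum_mul]
        congr 1
        exact_mod_cast Nat.sum_range_choose i
      _ ≤ 2 ^ N * (P * (((1 + ‖y‖) ^ N)⁻¹ * Q)) := by
        gcongr
        norm_num
  have h := norm_fourier_le_of_decayBound _ hD (ξ' - ξ)
  rw [norm_sub_rev x x', norm_sub_rev ξ ξ']
  have h5 : 0 < (1 + ‖ξ' - ξ‖) ^ N := by positivity
  calc ‖𝓕 (mulConjShift (x' - x) F G : V → ℂ) (ξ' - ξ)‖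
      = ((1 + ‖ξ' - ξ‖) ^ N)⁻¹ *
        ((1 + ‖ξ' - ξ‖) ^ N * ‖𝓕 (mulConjShift (x' - x) F G : V → ℂ) (ξ' - ξ)‖) := by
        rw [inv_mul_cancel_left₀ h5.ne']
    _ ≤ ((1 + ‖ξ' - ξ‖) ^ N)⁻¹ * (4 ^ N * ((N + 1) * (weightIntegral V *
        (2 ^ N * (P * (((1 + ‖x' - x‖) ^ N)⁻¹ * Q)))))) := by gcongr
    _ = _ := by unfold decayConst; ring

end TimeFrequencyDecay

/-! ### Weak integrals of Schwartz functions -/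

section Factor

variable {X E : Type*} [AddCommGroup X] [Module ℂ X] [NormedAddCommGroup E] [NormedSpace ℂ E]

/-- A functional that is bounded through a linear map into a normed space extends to a continuous
functional on that space. -/
theorem exists_clm_factor (J : X →ₗ[ℂ] E) (L : X →ₗ[ℂ] ℂ) (C : ℝ) (h : ∀ x, ‖L x‖ ≤ C * ‖J x‖) :
    ∃ l : E →L[ℂ] ℂ, ∀ x, l (J x) = L x := by
  obtain ⟨R, hR⟩ := J.rangeRestrict.exists_rightInverse_of_surjective
    (LinearMap.range_eq_top.2 J.surjective_rangeRestrict)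
  have hR' : ∀ y : LinearMap.range J, J (R y) = y := fun y =>
    congrArg Subtype.val (LinearMap.congr_fun hR y)
  let l₀ : LinearMap.range J →L[ℂ] ℂ := (L.comp R).mkContinuous C fun y => by
    have := h (R y)
    rwa [hR'] at this
  obtain ⟨l, hl, -⟩ := exists_extension_norm_eq (LinearMap.range J) l₀
  refine ⟨l, fun x => ?_⟩
  have h1 : l (J x) = L (R ⟨J x, LinearMap.mem_range_self J x⟩) :=
    hl ⟨J x, LinearMap.mem_range_self J x⟩
  have h2 := h (R ⟨J x, LinearMap.mem_range_self J x⟩ - x)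
  rw [map_sub, map_sub, hR', sub_self, norm_zero, mul_zero, norm_le_zero_iff, sub_eq_zero] at h2
  rw [h1, h2]

end Factor

section IntegrableFamily

universe u

variable {V E : Type u} [NormedAddCommGroup V] [NormedSpace ℝ V]
  [NormedAddCommGroup E] [NormedSpace ℝ E]
  {W : Type*} [TopologicalSpace W] [MeasurableSpace W]

/-- A continuous family of Schwartz functions whose seminorms are dominated by integrable
functions. -/
structure IntegrableFamily (μ : Measure W) (Γ : W → 𝓢(V, E)) : Prop where
  cont : Continuous Γ
  bound : ∀ k n : ℕ, ∃ b : W → ℝ, Integrable b μ ∧ ∀ w, SchwartzMap.seminorm ℝ k n (Γ w) ≤ b w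

theorem continuous_schwartz_apply (v : V) : Continuous (fun f : 𝓢(V, E) => f v) :=
  (BoundedContinuousFunction.evalCLM ℝ v).continuous.comp
    (SchwartzMap.toBoundedContinuousFunctionCLM ℝ V E).continuous

variable {μ : Measure W} {Γ : W → 𝓢(V, E)}

theorem IntegrableFamily.fderiv (h : IntegrableFamily μ Γ) :
    IntegrableFamily μ (fun w => SchwartzMap.fderivCLM ℝ V E (Γ w)) where
  cont := (SchwartzMap.fderivCLM ℝ V E).continuous.comp h.cont
  bound k n := by
    obtain ⟨b, hb, hle⟩ := h.bound k (n + 1)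
    refine ⟨b, hb, fun w => (SchwartzMap.seminorm_le_bound ℝ k n _ (apply_nonneg _ _)
      fun v => ?_).trans (hle w)⟩
    have h1 : (SchwartzMap.fderivCLM ℝ V E (Γ w) : V → V →L[ℝ] E) = _root_.fderiv ℝ (Γ w) := by
      funext v; rfl
    rw [h1, norm_iteratedFDeriv_fderiv]
    exact SchwartzMap.le_seminorm ℝ k (n + 1) (Γ w) v

variable [SecondCountableTopology W] [OpensMeasurableSpace W]

theorem IntegrableFamily.integrable_apply (h : IntegrableFamily μ Γ) (v : V) :
    Integrable (fun w => Γ w v) μ := by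
  obtain ⟨b, hb, hle⟩ := h.bound 0 0
  exact hb.mono' ((continuous_schwartz_apply v).comp h.cont).aestronglyMeasurable
    (Filter.Eventually.of_forall fun w => (SchwartzMap.norm_le_seminorm ℝ (Γ w) v).trans (hle w))

theorem IntegrableFamily.hasFDerivAt_integral (h : IntegrableFamily μ Γ) {F : V → E}
    (hF : ∀ v, F v = ∫ w, Γ w v ∂μ) (v : V) :
    HasFDerivAt F (∫ w, SchwartzMap.fderivCLM ℝ V E (Γ w) v ∂μ) v := by
  have hF' : F = fun v => ∫ w, Γ w v ∂μ := funext hF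
  rw [hF']
  obtain ⟨b, hb, hle⟩ := h.fderiv.bound 0 0
  refine hasFDerivAt_integral_of_dominated_of_fderiv_le (s := Set.univ) (bound := b)
    (F := fun v w => Γ w v) (F' := fun v w => SchwartzMap.fderivCLM ℝ V E (Γ w) v)
    Filter.univ_mem
    (Filter.Eventually.of_forall fun v => (h.integrable_apply v).aestronglyMeasurable)
    (h.integrable_apply v)
    (h.fderiv.integrable_apply v).aestronglyMeasurable
    (Filter.Eventually.of_forall fun w v _ =>
      (SchwartzMap.norm_le_seminorm ℝ (SchwartzMap.fderivCLM ℝ V E (Γ w)) v).trans (hle w)) hb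
    (Filter.Eventually.of_forall fun w v _ => ?_)
  exact ((Γ w).smooth 1).differentiable one_ne_zero v |>.hasFDerivAt

end IntegrableFamily

section IteratedDerivative

universe u

variable {V : Type u} [NormedAddCommGroup V] [NormedSpace ℝ V]
  {W : Type*} [TopologicalSpace W] [SecondCountableTopology W] [MeasurableSpace W]
  [OpensMeasurableSpace W] {μ : Measure W}

theorem IntegrableFamily.iteratedFDeriv_eq_integral (n : ℕ) :
    ∀ {E : Type u} [NormedAddCommGroup E] [NormedSpace ℝ E] [CompleteSpace E]
      {Γ : W → 𝓢(V, E)}, IntegrableFamily μ Γ →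
      ∀ {F : V → E}, (∀ v, F v = ∫ w, Γ w v ∂μ) → ∀ v,
        iteratedFDeriv ℝ n F v = ∫ w, iteratedFDeriv ℝ n (Γ w) v ∂μ := by
  induction n with
  | zero =>
    intro E _ _ _ Γ h F hF v
    have h1 : ∀ f : V → E, iteratedFDeriv ℝ 0 f v =
        (continuousMultilinearCurryFin0 ℝ V E).symm (f v) := fun f => rfl
    simp only [h1, hF]
    exact ((continuousMultilinearCurryFin0 ℝ V E).symm.toContinuousLinearEquiv.integral_comp_comm
      (fun w => Γ w v)).symm
  | succ n ih =>
    intro E _ _ _ Γ h F hF v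
    simp only [iteratedFDeriv_succ_eq_comp_right, Function.comp_apply]
    have h1 : ∀ v, _root_.fderiv ℝ F v = ∫ w, SchwartzMap.fderivCLM ℝ V E (Γ w) v ∂μ :=
      fun v => (h.hasFDerivAt_integral hF v).fderiv
    rw [ih h.fderiv h1 v]
    exact (ContinuousLinearEquiv.integral_comp_comm (μ := μ) (𝕜 := ℝ) (E := V [×n]→L[ℝ] (V →L[ℝ] E))
      (F := V [×(n + 1)]→L[ℝ] E)
      (continuousMultilinearCurryRightEquiv' ℝ n V E).symm.toContinuousLinearEquiv _).symm

end IteratedDerivative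

section Jet

variable {V E : Type*} [NormedAddCommGroup V] [NormedSpace ℝ V] [NormedAddCommGroup E]
  [NormedSpace ℝ E]

variable (V E) in
/-- The values of `n`-th derivatives of functions `V → E`, with the structure of a complex normed
space that comes from `E`. -/
def JetValue (n : ℕ) : Type _ := V [×n]→L[ℝ] E

instance (n : ℕ) : NormedAddCommGroup (JetValue V E n) :=
  inferInstanceAs (NormedAddCommGroup (V [×n]→L[ℝ] E))

instance (n : ℕ) : NormedSpace ℝ (JetValue V E n) :=
  inferInstanceAs (NormedSpace ℝ (V [×n]→L[ℝ] E))

instance (n : ℕ) [NormedSpace ℂ E] [SMulCommClass ℝ ℂ E] : NormedSpace ℂ (JetValue V E n) :=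
  inferInstanceAs (NormedSpace ℂ (V [×n]→L[ℝ] E))

instance (n : ℕ) [CompleteSpace E] : CompleteSpace (JetValue V E n) :=
  inferInstanceAs (CompleteSpace (V [×n]→L[ℝ] E))

/-- The weighted derivative `‖v‖^k D^n f(v)`. -/
def weightedDeriv (k n : ℕ) (f : 𝓢(V, E)) (v : V) : JetValue V E n :=
  (‖v‖ ^ k : ℝ) • iteratedFDeriv ℝ n f v

theorem norm_weightedDeriv (k n : ℕ) (f : 𝓢(V, E)) (v : V) :
    ‖weightedDeriv k n f v‖ = ‖v‖ ^ k * ‖iteratedFDeriv ℝ n f v‖ := by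
  change ‖(‖v‖ ^ k : ℝ) • iteratedFDeriv ℝ n f v‖ = _
  rw [norm_smul, norm_pow, norm_norm]

theorem norm_weightedDeriv_le (k n : ℕ) (f : 𝓢(V, E)) (v : V) :
    ‖weightedDeriv k n f v‖ ≤ SchwartzMap.seminorm ℝ k n f := by
  rw [norm_weightedDeriv]
  exact SchwartzMap.le_seminorm ℝ k n f v

theorem continuous_weightedDeriv (k n : ℕ) (f : 𝓢(V, E)) : Continuous (weightedDeriv k n f) :=
  (continuous_norm.pow k).smul
    ((f.smooth ⊤).continuous_iteratedFDeriv (by exact_mod_cast le_top))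

variable [NormedSpace ℂ E] [SMulCommClass ℝ ℂ E]

/-- The weighted jet `v ↦ ‖v‖^k D^n f(v)` of a Schwartz function, as a bounded continuous
function. -/
def weightedJet (k n : ℕ) : 𝓢(V, E) →ₗ[ℂ] BoundedContinuousFunction V (JetValue V E n) where
  toFun f := BoundedContinuousFunction.ofNormedAddCommGroup (weightedDeriv k n f)
    (continuous_weightedDeriv k n f) (SchwartzMap.seminorm ℝ k n f) (norm_weightedDeriv_le k n f)
  map_add' f g := by
    ext1 v
    have : iteratedFDeriv ℝ n (f + g : 𝓢(V, E)) v =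
        iteratedFDeriv ℝ n f v + iteratedFDeriv ℝ n g v := by
      rw [FunLike.coe_add]
      exact iteratedFDeriv_add_apply (f.contDiffAt n) (g.contDiffAt n)
    change (‖v‖ ^ k : ℝ) • iteratedFDeriv ℝ n (f + g : 𝓢(V, E)) v = _
    rw [this, smul_add]
    rfl
  map_smul' c f := by
    ext1 v
    have : iteratedFDeriv ℝ n (c • f : 𝓢(V, E)) v = c • iteratedFDeriv ℝ n f v := by
      rw [FunLike.coe_smul]
      exact iteratedFDeriv_const_smul_apply (f.contDiffAt n)
    change (‖v‖ ^ k : ℝ) • iteratedFDeriv ℝ n (c • f : 𝓢(V, E)) v = _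
    rw [this, smul_comm]
    rfl

theorem weightedJet_apply (k n : ℕ) (f : 𝓢(V, E)) (v : V) :
    weightedJet k n f v = weightedDeriv k n f v := rfl

theorem norm_weightedJet (k n : ℕ) (f : 𝓢(V, E)) :
    ‖weightedJet k n f‖ = SchwartzMap.seminorm ℝ k n f := by
  apply le_antisymm
  · exact BoundedContinuousFunction.norm_ofNormedAddCommGroup_le _ (apply_nonneg _ _)
      (norm_weightedDeriv_le k n f)
  · refine SchwartzMap.seminorm_le_bound ℝ k n f (norm_nonneg (weightedJet k n f)) fun v => ?_
    have := (weightedJet k n f).norm_coe_le_norm v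
    rwa [weightedJet_apply, norm_weightedDeriv] at this

theorem continuous_weightedJet (k n : ℕ) : Continuous (weightedJet (V := V) (E := E) k n) := by
  have hs : ∃ (s : Finset (ℕ × ℕ)) (C : NNReal),
      (normSeminorm ℂ _).comp (weightedJet (V := V) (E := E) k n) ≤
        C • s.sup (schwartzSeminormFamily ℂ V E) := by
    refine ⟨{(k, n)}, 1, fun f => ?_⟩
    simp only [Finset.sup_singleton, one_smul]
    exact (norm_weightedJet k n f).le
  exact (schwartz_withSeminorms ℂ V E).continuous_normedSpace_rng _ (weightedJet k n) hs

end Jet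

section WeakIntegral

universe u

variable {V E : Type u} [NormedAddCommGroup V] [NormedSpace ℝ V] [NormedAddCommGroup E]
  [NormedSpace ℝ E] [NormedSpace ℂ E] [SMulCommClass ℝ ℂ E] [CompleteSpace E]
  {W : Type*} [TopologicalSpace W] [SecondCountableTopology W] [MeasurableSpace W]
  [OpensMeasurableSpace W] {μ : Measure W}

/-- Continuous functionals commute with integrals of Schwartz functions that are only known to
converge pointwise, provided the seminorms of the integrand are integrable. The functional is
transported to a finite product of spaces of bounded continuous functions, where the integral is a
Bochner integral. -/
theorem IntegrableFamily.apply_eq_integral {Γ : W → 𝓢(V, E)} (h : IntegrableFamily μ Γ)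
    {F : 𝓢(V, E)} (hF : ∀ v, F v = ∫ w, Γ w v ∂μ) (L : 𝓢(V, E) →L[ℂ] ℂ) :
    L F = ∫ w, L (Γ w) ∂μ := by
  obtain ⟨s, C, -, hC⟩ := Seminorm.bound_of_continuous (schwartz_withSeminorms ℂ V E)
    ((normSeminorm ℂ ℂ).comp (L : 𝓢(V, E) →ₗ[ℂ] ℂ)) (L.continuous.norm)
  let J : 𝓢(V, E) →ₗ[ℂ]
      ((i : s) → BoundedContinuousFunction V (JetValue V E i.1.2)) :=
    LinearMap.pi fun i => weightedJet i.1.1 i.1.2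
  have hJ : Continuous J := continuous_pi fun i => continuous_weightedJet i.1.1 i.1.2
  have hbound : ∀ f, ‖(L : 𝓢(V, E) →ₗ[ℂ] ℂ) f‖ ≤ C * ‖J f‖ := by
    intro f
    refine (hC f).trans ?_
    rw [smul_apply, NNReal.smul_def, smul_eq_mul]
    refine mul_le_mul_of_nonneg_left ?_ C.2
    refine Seminorm.finset_sup_apply_le (norm_nonneg _) fun i hi => ?_
    refine le_trans (le_of_eq ?_) (norm_le_pi_norm (J f) ⟨i, hi⟩)
    exact (norm_weightedJet i.1 i.2 f).symm
  obtain ⟨l, hl⟩ := exists_clm_factor J (L : 𝓢(V, E) →ₗ[ℂ] ℂ) C hbound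
  have hint : Integrable (fun w => J (Γ w)) μ := by
    choose b hb hle using h.bound
    refine (integrable_finsetSum s.attach (f := fun i w => b i.1.1 i.1.2 w)
      fun i _ => hb _ _).mono' (hJ.comp h.cont).aestronglyMeasurable
      (Filter.Eventually.of_forall fun w => ?_)
    have hb0 : ∀ k n, 0 ≤ b k n w := fun k n => (apply_nonneg _ _).trans (hle k n w)
    refine (pi_norm_le_iff_of_nonneg (Finset.sum_nonneg fun i _ => hb0 _ _)).2 fun i => ?_
    refine le_trans (norm_weightedJet i.1.1 i.1.2 (Γ w)).le ((hle _ _ w).trans ?_)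
    exact Finset.single_le_sum (f := fun i : s => b i.1.1 i.1.2 w)
      (fun i _ => hb0 _ _) (Finset.mem_attach s i)
  have hJF : J F = ∫ w, J (Γ w) ∂μ := by
    funext i
    ext1 v
    let ev : ((i : s) → BoundedContinuousFunction V (JetValue V E i.1.2)) →L[ℝ]
        (JetValue V E i.1.2) :=
      (BoundedContinuousFunction.evalCLM ℝ v).comp (ContinuousLinearMap.proj i)
    have h1 : ev (∫ w, J (Γ w) ∂μ) = ∫ w, ev (J (Γ w)) ∂μ :=
      (ev.integral_comp_comm hint).symm
    refine Eq.trans ?_ h1.symm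
    change (‖v‖ ^ i.1.1 : ℝ) • iteratedFDeriv ℝ i.1.2 F v =
      ∫ w, (‖v‖ ^ i.1.1 : ℝ) • iteratedFDeriv ℝ i.1.2 (Γ w) v ∂μ
    rw [h.iteratedFDeriv_eq_integral i.1.2 hF v]
    exact (integral_smul _ _).symm
  calc L F = l (J F) := (hl F).symm
    _ = ∫ w, l (J (Γ w)) ∂μ := by rw [hJF, l.integral_comp_comm hint]
    _ = _ := by simp only [hl]; rfl

end WeakIntegral

/-! ### Inversion of the short-time Fourier transform -/

section ShiftContinuity

variable {V : Type*} [NormedAddCommGroup V] [NormedSpace ℝ V]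

theorem tendsto_schwartz_of_decayBound {W : Type*} {l : Filter W} {Γ : W → 𝓢(V, ℂ)}
    {f : 𝓢(V, ℂ)} (h : ∀ k n : ℕ, ∃ c : W → ℝ, Tendsto c l (𝓝 0) ∧
      ∀ᶠ w in l, DecayBound k n (c w) (Γ w - f : 𝓢(V, ℂ))) : Tendsto Γ l (𝓝 f) := by
  rw [(schwartz_withSeminorms ℂ V ℂ).tendsto_nhds]
  rintro ⟨k, n⟩ ε hε
  obtain ⟨c, hc, hb⟩ := h k n
  filter_upwards [hb, hc.eventually (gt_mem_nhds hε)] with w hw hw'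
  exact (seminorm_le_of_decayBound (𝕜 := ℂ) hw).trans_lt hw'

theorem decayBound_translate_sub {k n : ℕ} {P : ℝ} {g : 𝓢(V, ℂ)}
    (hP : DecayBound k (n + 1) P g) {x₀ x : V} (hx : x ∈ Metric.closedBall x₀ 1) :
    DecayBound k n ((2 + ‖x₀‖) ^ k * P * ‖x - x₀‖)
      (SchwartzMap.compSubConstCLM ℂ x g - SchwartzMap.compSubConstCLM ℂ x₀ g : 𝓢(V, ℂ)) := by
  intro i hi v
  have hcoe : (SchwartzMap.compSubConstCLM ℂ x g - SchwartzMap.compSubConstCLM ℂ x₀ g : 𝓢(V, ℂ)) =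
      (fun v => g (v - x)) - (fun v => g (v - x₀)) := rfl
  have hs : ∀ y : V, ContDiff ℝ ∞ (fun v => g (v - y)) := fun y =>
    (g.smooth ⊤).comp (contDiff_id.sub contDiff_const)
  have h1 : iteratedFDeriv ℝ i (SchwartzMap.compSubConstCLM ℂ x g -
      SchwartzMap.compSubConstCLM ℂ x₀ g : 𝓢(V, ℂ)) v =
      iteratedFDeriv ℝ i g (v - x) - iteratedFDeriv ℝ i g (v - x₀) := by
    rw [hcoe, iteratedFDeriv_sub_apply ((hs x).contDiffAt.of_le (by exact_mod_cast le_top))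
      ((hs x₀).contDiffAt.of_le (by exact_mod_cast le_top)), iteratedFDeriv_comp_sub,
      iteratedFDeriv_comp_sub]
  have hv : 0 < (1 + ‖v‖) ^ k := by positivity
  have hd : Differentiable ℝ (iteratedFDeriv ℝ i g) :=
    (g.smooth ⊤).differentiable_iteratedFDeriv (by exact_mod_cast (WithTop.coe_lt_top i))
  have h2 : ‖iteratedFDeriv ℝ i g (v - x) - iteratedFDeriv ℝ i g (v - x₀)‖ ≤
      ((2 + ‖x₀‖) ^ k * P / (1 + ‖v‖) ^ k) * ‖x - x₀‖ := by
    refine Convex.norm_image_sub_le_of_norm_hasFDerivWithin_le (𝕜 := ℝ)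
      (f := fun y => iteratedFDeriv ℝ i g (v - y))
      (f' := fun y => (fderiv ℝ (iteratedFDeriv ℝ i g) (v - y)).comp
        (-ContinuousLinearMap.id ℝ V))
      (s := Metric.closedBall x₀ 1) (fun y _ => ?_) (fun y hy => ?_)
      (convex_closedBall x₀ 1) (Metric.mem_closedBall_self zero_le_one) hx
    · exact ((hd (v - y)).hasFDerivAt.comp y
        ((hasFDerivAt_id y).const_sub v)).hasFDerivWithinAt
    · have hn : ‖(fderiv ℝ (iteratedFDeriv ℝ i g) (v - y)).comp
          (-ContinuousLinearMap.id ℝ V)‖ ≤ ‖iteratedFDeriv ℝ (i + 1) g (v - y)‖ := by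
        rw [← norm_fderiv_iteratedFDeriv]
        refine (ContinuousLinearMap.opNorm_comp_le _ _).trans
          (mul_le_of_le_one_right (norm_nonneg _) ?_)
        rw [norm_neg]
        exact ContinuousLinearMap.norm_id_le
      refine hn.trans ?_
      rw [le_div_iff₀ hv]
      have h3 := hP (i + 1) (by omega) (v - y)
      have hy' : ‖y - x₀‖ ≤ 1 := by simpa [dist_eq_norm] using hy
      have h4 : ‖y‖ ≤ 1 + ‖x₀‖ := by
        have := norm_le_norm_add_norm_sub' y x₀; linarith
      have h5 : 1 + ‖v‖ ≤ (2 + ‖x₀‖) * (1 + ‖v - y‖) := by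
        have := norm_add_le (v - y) y
        rw [sub_add_cancel] at this
        nlinarith [norm_nonneg x₀, norm_nonneg (v - y)]
      calc ‖iteratedFDeriv ℝ (i + 1) g (v - y)‖ * (1 + ‖v‖) ^ k
          ≤ ‖iteratedFDeriv ℝ (i + 1) g (v - y)‖ * ((2 + ‖x₀‖) * (1 + ‖v - y‖)) ^ k := by gcongr
        _ = (2 + ‖x₀‖) ^ k * ((1 + ‖v - y‖) ^ k * ‖iteratedFDeriv ℝ (i + 1) g (v - y)‖) := by
          rw [mul_pow]; ring
        _ ≤ _ := by gcongr
  rw [h1]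
  calc _ ≤ (1 + ‖v‖) ^ k * (((2 + ‖x₀‖) ^ k * P / (1 + ‖v‖) ^ k) * ‖x - x₀‖) := by gcongr
    _ = _ := by field_simp

end ShiftContinuity

section Inversion

variable {V : Type} [NormedAddCommGroup V] [InnerProductSpace ℝ V]

theorem tfShift_add (x ξ : V) (f g : 𝓢(V, ℂ)) :
    tfShift x ξ (f + g) = tfShift x ξ f + tfShift x ξ g := by
  simp [tfShift]

theorem tfShift_zero_translate (x ξ : V) (g : 𝓢(V, ℂ)) :
    tfShift 0 ξ (SchwartzMap.compSubConstCLM ℂ x g) = tfShift x ξ g := by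
  ext v; simp [tfShift_apply]

theorem tfShift_zero_zero (f : 𝓢(V, ℂ)) : tfShift 0 0 f = f := by
  ext v; simp [tfShift_apply]

variable [FiniteDimensional ℝ V] [MeasurableSpace V] [BorelSpace V]

theorem fourier_modulation (ξ : V) (g : 𝓢(V, ℂ)) :
    𝓕 (tfShift 0 ξ g) = SchwartzMap.compSubConstCLM ℂ ξ (𝓕 g) := by
  ext η
  rw [SchwartzMap.compSubConstCLM_apply, SchwartzMap.fourier_coe, SchwartzMap.fourier_coe,
    Real.fourier_eq, Real.fourier_eq]
  congr 1
  funext v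
  rw [tfShift_apply_phaseExp, sub_zero, Circle.smul_def, Circle.smul_def, fourierChar_eq_phaseExp,
    fourierChar_eq_phaseExp, smul_eq_mul, smul_eq_mul, ← mul_assoc, ← phaseExp_add]
  congr 2
  rw [inner_sub_right]; ring

theorem continuous_modulation (g : 𝓢(V, ℂ)) : Continuous (fun ξ : V => tfShift 0 ξ g) := by
  have h1 : (fun ξ : V => tfShift 0 ξ g) =
      fun ξ => 𝓕⁻ (SchwartzMap.compSubConstCLM ℂ ξ (𝓕 g)) := by
    funext ξ
    rw [← fourier_modulation, FourierTransform.fourierInv_fourier_eq]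
  rw [h1]
  refine (FourierTransform.continuous_fourierInv (E := 𝓢(V, ℂ)) (F := 𝓢(V, ℂ))).comp ?_
  rw [continuous_iff_continuousAt]
  intro x₀
  refine tendsto_schwartz_of_decayBound fun k n => ?_
  obtain ⟨P, hP⟩ := exists_decayBound k (n + 1) (𝓕 g)
  refine ⟨fun x => (2 + ‖x₀‖) ^ k * P * ‖x - x₀‖, ?_, ?_⟩
  · have : Continuous fun x => (2 + ‖x₀‖) ^ k * P * ‖x - x₀‖ := by fun_prop
    simpa using this.tendsto x₀
  · filter_upwards [Metric.closedBall_mem_nhds x₀ one_pos] with x hx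
    exact decayBound_translate_sub hP hx

/-- Time-frequency shifts depend continuously on the shift in the Schwartz topology. -/
theorem continuous_tfShift (g : 𝓢(V, ℂ)) :
    Continuous (fun p : V × V => tfShift p.1 p.2 g) := by
  rw [continuous_iff_continuousAt]
  rintro ⟨x₀, ξ₀⟩
  have h1 : Tendsto (fun p : V × V => tfShift 0 p.2
      (SchwartzMap.compSubConstCLM ℂ p.1 g - SchwartzMap.compSubConstCLM ℂ x₀ g))
      (𝓝 (x₀, ξ₀)) (𝓝 0) := by
    refine tendsto_schwartz_of_decayBound fun k n => ?_
    obtain ⟨P, hP⟩ := exists_decayBound k (n + 1) g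
    refine ⟨fun p => 2 ^ n * ((n.factorial * (2 * Real.pi) ^ n * (1 + ‖p.2‖) ^ n) *
      ((1 + ‖(0 : V)‖) ^ k * ((2 + ‖x₀‖) ^ k * P * ‖p.1 - x₀‖))), ?_, ?_⟩
    · have : Continuous (fun p : V × V =>
          2 ^ n * ((n.factorial * (2 * Real.pi) ^ n * (1 + ‖p.2‖) ^ n) *
          ((1 + ‖(0 : V)‖) ^ k * ((2 + ‖x₀‖) ^ k * P * ‖p.1 - x₀‖)))) := by fun_prop
      simpa using this.tendsto (x₀, ξ₀)
    · have : ∀ᶠ p : V × V in 𝓝 (x₀, ξ₀), p.1 ∈ Metric.closedBall x₀ 1 :=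
        continuous_fst.continuousAt.eventually (Metric.closedBall_mem_nhds x₀ one_pos)
      filter_upwards [this] with p hp
      rw [sub_zero]
      exact decayBound_tfShift (decayBound_translate_sub hP hp) 0 p.2
  have h2 : Tendsto (fun p : V × V => tfShift 0 p.2 (SchwartzMap.compSubConstCLM ℂ x₀ g))
      (𝓝 (x₀, ξ₀)) (𝓝 (tfShift 0 ξ₀ (SchwartzMap.compSubConstCLM ℂ x₀ g))) :=
    ((continuous_modulation _).comp continuous_snd).tendsto (x₀, ξ₀)
  have h3 := h1.add h2
  rw [zero_add, tfShift_zero_translate] at h3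
  refine h3.congr fun p => ?_
  rw [← tfShift_add, sub_add_cancel, tfShift_zero_translate]

theorem continuous_l2Pair (f : 𝓢(V, ℂ)) : Continuous (fun G : 𝓢(V, ℂ) => l2Pair f G) := by
  have h : ∀ G : 𝓢(V, ℂ), l2Pair f G =
      (SchwartzMap.integralCLM ℂ volume) (SchwartzMap.smulLeftCLM ℂ (fun v => f v)
        (SchwartzMap.postcompCLM (𝕜 := ℝ) (Complex.conjCLE : ℂ →L[ℝ] ℂ) G)) := by
    intro G
    rw [SchwartzMap.integralCLM_apply, l2Pair]
    congr 1
    funext v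
    rw [SchwartzMap.smulLeftCLM_apply_apply f.hasTemperateGrowth]
    rfl
  simp only [h]
  exact (SchwartzMap.integralCLM ℂ volume).continuous.comp
    ((SchwartzMap.smulLeftCLM ℂ _).continuous.comp (SchwartzMap.postcompCLM _).continuous)

theorem l2Pair_tfShift_eq_fourier (f g : 𝓢(V, ℂ)) (x ξ : V) :
    l2Pair f (tfShift x ξ g) = 𝓕 (mulConjShift x f g : V → ℂ) ξ := by
  rw [l2Pair, Real.fourier_eq]
  congr 1
  funext v
  rw [tfShift_apply_phaseExp, mulConjShift_apply, Circle.smul_def, fourierChar_eq_phaseExp,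
    map_mul, conj_phaseExp, smul_eq_mul]
  ring

/-- The square of the `L²` norm. -/
def l2NormSq (g : 𝓢(V, ℂ)) : ℝ := ∫ v, ‖g v‖ ^ 2

theorem l2NormSq_pos {g : 𝓢(V, ℂ)} (hg : g ≠ 0) : 0 < l2NormSq g := by
  have hcont : Continuous (fun v => ‖g v‖ ^ 2) := (g.continuous.norm.pow 2)
  have hint : Integrable (fun v => ‖g v‖ ^ 2) := by
    have := (g.memLp 2 (μ := volume)).integrable_norm_pow (by norm_num)
    simpa using this
  rw [l2NormSq, integral_pos_iff_support_of_nonneg (fun v => by positivity) hint]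
  refine IsOpen.measure_pos _ hcont.isOpen_support ?_
  by_contra hne
  rw [Set.not_nonempty_iff_eq_empty, Function.support_eq_empty_iff] at hne
  refine hg (SchwartzMap.ext fun v => ?_)
  have := congrFun hne v
  simpa using this

theorem integrableFamily_stft (f g : 𝓢(V, ℂ)) :
    IntegrableFamily (volume.prod volume)
      (fun p : V × V => l2Pair f (tfShift p.1 p.2 g) • tfShift p.1 p.2 g) where
  cont := ((continuous_l2Pair f).comp (continuous_tfShift g)).smul (continuous_tfShift g)
  bound k n := by
    set D := Module.finrank ℝ V + 1 with hD
    set N := k + n + D with hN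
    obtain ⟨P, hP⟩ := exists_decayBound (D + N) N f
    obtain ⟨Q, hQ⟩ := exists_decayBound N N g
    obtain ⟨R, hR⟩ := exists_decayBound k n g
    have hP0 := hP.nonneg
    have hQ0 := hQ.nonneg
    have hR0 := hR.nonneg
    have hC := decayConst_nonneg (V := V) N
    refine ⟨fun p => decayConst V N * (P * Q) * (2 ^ n * (n.factorial * (2 * Real.pi) ^ n) * R) *
      (((1 + ‖p.1‖) ^ D)⁻¹ * ((1 + ‖p.2‖) ^ D)⁻¹), ?_, fun p => ?_⟩
    · exact ((integrable_weight le_rfl).mul_prod (integrable_weight le_rfl)).const_mul _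
    · have h1 := norm_l2Pair_tfShift_le hP hQ 0 0 p.1 p.2
      rw [tfShift_zero_zero, zero_sub, zero_sub, norm_neg, norm_neg] at h1
      have h2 := seminorm_le_of_decayBound (𝕜 := ℝ) (decayBound_tfShift hR p.1 p.2)
      have h3 : SchwartzMap.seminorm ℝ k n (l2Pair f (tfShift p.1 p.2 g) • tfShift p.1 p.2 g) =
          ‖l2Pair f (tfShift p.1 p.2 g)‖ * SchwartzMap.seminorm ℝ k n (tfShift p.1 p.2 g) :=
        map_smul_eq_mul (SchwartzMap.seminorm ℂ k n) _ _
      rw [h3]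
      refine (mul_le_mul h1 h2 (apply_nonneg _ _) (by positivity)).trans ?_
      have h4 : ∀ y : V, ∀ m ≤ k + n, ((1 + ‖y‖) ^ N)⁻¹ * (1 + ‖y‖) ^ m ≤ ((1 + ‖y‖) ^ D)⁻¹ := by
        intro y m hm
        have hy : 1 ≤ 1 + ‖y‖ := by linarith [norm_nonneg y]
        have hy' : 0 < 1 + ‖y‖ := by positivity
        rw [inv_mul_le_iff₀ (by positivity), ← div_eq_mul_inv, le_div_iff₀ (by positivity),
          ← pow_add]
        exact pow_le_pow_right₀ hy (by omega)
      have h5 := mul_le_mul (h4 p.1 k (by omega)) (h4 p.2 n (by omega)) (by positivity)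
        (by positivity)
      calc _ = decayConst V N * (P * Q) * (2 ^ n * (n.factorial * (2 * Real.pi) ^ n) * R) *
            (((1 + ‖p.1‖) ^ N)⁻¹ * (1 + ‖p.1‖) ^ k *
              (((1 + ‖p.2‖) ^ N)⁻¹ * (1 + ‖p.2‖) ^ n)) := by ring
        _ ≤ _ := mul_le_mul_of_nonneg_left h5 (by positivity)

/-- The inversion formula for the short-time Fourier transform, pointwise. -/
theorem integral_stft_smul (f g : 𝓢(V, ℂ)) (v : V) :
    ∫ p : V × V, (l2Pair f (tfShift p.1 p.2 g) • tfShift p.1 p.2 g) v ∂(volume.prod volume) =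
      (l2NormSq g : ℂ) * f v := by
  rw [integral_prod _ ((integrableFamily_stft f g).integrable_apply v)]
  have h1 : ∀ x : V, ∫ ξ : V, (l2Pair f (tfShift x ξ g) • tfShift x ξ g) v =
      f v * ((‖g (v - x)‖ ^ 2 : ℝ) : ℂ) := by
    intro x
    have h2 : 𝓕⁻ (𝓕 (mulConjShift x f g)) v = mulConjShift x f g v := by
      rw [FourierTransform.fourierInv_fourier_eq]
    rw [SchwartzMap.fourierInv_coe, Real.fourierInv_eq, mulConjShift_apply] at h2
    have h3 : ∀ ξ : V, (l2Pair f (tfShift x ξ g) • tfShift x ξ g) v =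
        (Real.fourierChar (inner ℝ ξ v) • (𝓕 (mulConjShift x f g)) ξ) * g (v - x) := by
      intro ξ
      rw [smul_apply, tfShift_apply_phaseExp, l2Pair_tfShift_eq_fourier, Circle.smul_def,
        fourierChar_eq_phaseExp, real_inner_comm, SchwartzMap.fourier_coe, smul_eq_mul, smul_eq_mul]
      ring
    simp only [h3]
    rw [integral_mul_const, h2, mul_assoc, ← Complex.normSq_eq_conj_mul_self,
      Complex.normSq_eq_norm_sq]
  simp only [h1]
  rw [integral_const_mul, mul_comm, l2NormSq]
  congr 1
  rw [integral_complex_ofReal, integral_sub_left_eq_self (fun v => ‖g v‖ ^ 2) volume v]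

end Inversion

section WeakInversion

variable {V : Type} [NormedAddCommGroup V] [InnerProductSpace ℝ V] [FiniteDimensional ℝ V]
  [MeasurableSpace V] [BorelSpace V]

/-- The inversion formula for the short-time Fourier transform, tested against a tempered
distribution: every distribution is determined by its values on the shifts of one window. -/
theorem apply_eq_integral_stft {g : 𝓢(V, ℂ)} (hg : g ≠ 0) (f : 𝓢(V, ℂ)) (L : 𝓢(V, ℂ) →L[ℂ] ℂ) :
    L f = ((l2NormSq g)⁻¹ : ℝ) * ∫ p : V × V,
      l2Pair f (tfShift p.1 p.2 g) * L (tfShift p.1 p.2 g) ∂(volume.prod volume) := by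
  have h := (integrableFamily_stft f g).apply_eq_integral (F := (l2NormSq g : ℂ) • f)
    (fun v => (integral_stft_smul f g v).symm) L
  simp only [map_smul, smul_eq_mul] at h
  rw [← h, ← mul_assoc, Complex.ofReal_inv, inv_mul_cancel₀, one_mul]
  exact_mod_cast (l2NormSq_pos hg).ne'

end WeakInversion

/-! ### Multiplication by `exp (2 π i Φ)` in phase space -/

section ShiftBounds

variable {V : Type} [NormedAddCommGroup V] [InnerProductSpace ℝ V] [FiniteDimensional ℝ V]
  [MeasurableSpace V] [BorelSpace V]

theorem integral_weight_sub (z : V) :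
    ∫ x : V, ((1 + ‖z - x‖) ^ (Module.finrank ℝ V + 1))⁻¹ = weightIntegral V := by
  rw [integral_sub_left_eq_self (fun v : V => ((1 + ‖v‖) ^ (Module.finrank ℝ V + 1))⁻¹) volume z,
    weightIntegral]
  congr 1
  funext v
  rw [Real.rpow_neg (by positivity), Real.rpow_natCast]

/-- Integrability over phase space of the decay around the point where `x = z` and
`ξ + b(x) = ζ`; the shear by `b` does not change the integral. -/
theorem integrable_weight_sheared {b : V → V} (hb : Continuous b) (z ζ : V) :
    Integrable (fun p : V × V => ((1 + ‖z - p.1‖) ^ (Module.finrank ℝ V + 1))⁻¹ *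
      ((1 + ‖ζ - (p.2 + b p.1)‖) ^ (Module.finrank ℝ V + 1))⁻¹) (volume.prod volume) ∧
    ∫ p : V × V, ((1 + ‖z - p.1‖) ^ (Module.finrank ℝ V + 1))⁻¹ *
      ((1 + ‖ζ - (p.2 + b p.1)‖) ^ (Module.finrank ℝ V + 1))⁻¹ ∂(volume.prod volume) =
      weightIntegral V ^ 2 := by
  have hcont : Continuous (fun p : V × V =>
      ((1 + ‖z - p.1‖) ^ (Module.finrank ℝ V + 1))⁻¹ *
      ((1 + ‖ζ - (p.2 + b p.1)‖) ^ (Module.finrank ℝ V + 1))⁻¹) := by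
    refine Continuous.mul (Continuous.inv₀ (by fun_prop) fun p => ?_)
      (Continuous.inv₀ (by fun_prop) fun p => ?_) <;> positivity
  have hin : ∀ x : V, ∫ ξ : V, ((1 + ‖ζ - (ξ + b x)‖) ^ (Module.finrank ℝ V + 1))⁻¹ =
      weightIntegral V := by
    intro x
    rw [← integral_weight_sub (ζ - b x)]
    congr 1
    funext ξ
    rw [sub_sub, add_comm ξ]
  have hint : ∀ y : V, Integrable
      (fun ξ : V => ((1 + ‖y - ξ‖) ^ (Module.finrank ℝ V + 1))⁻¹) := fun y =>
    (integrable_weight le_rfl).comp_sub_left y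
  have hI : Integrable (fun p : V × V => ((1 + ‖z - p.1‖) ^ (Module.finrank ℝ V + 1))⁻¹ *
      ((1 + ‖ζ - (p.2 + b p.1)‖) ^ (Module.finrank ℝ V + 1))⁻¹) (volume.prod volume) := by
    rw [integrable_prod_iff hcont.aestronglyMeasurable]
    refine ⟨Eventually.of_forall fun x => ?_, ?_⟩
    · have h : Integrable
          (fun ξ : V => ((1 + ‖ζ - (ξ + b x)‖) ^ (Module.finrank ℝ V + 1))⁻¹) := by
        refine (hint (ζ - b x)).congr (Eventually.of_forall fun ξ => ?_)
        simp only [sub_sub, add_comm ξ]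
      exact h.const_mul (((1 + ‖z - x‖) ^ (Module.finrank ℝ V + 1))⁻¹)
    · refine ((hint z).mul_const (weightIntegral V)).congr (Eventually.of_forall fun x => ?_)
      simp only [← hin x, ← integral_const_mul]
      refine integral_congr_ae (Eventually.of_forall fun ξ => ?_)
      exact (Real.norm_of_nonneg (by positivity)).symm
  refine ⟨hI, ?_⟩
  rw [integral_prod _ hI]
  simp only [integral_const_mul, hin]
  rw [integral_mul_const, integral_weight_sub, sq]

/-- If the values of a distribution on the shifts `π(x, ξ) γ` decay like `⟨ξ + b(x)⟩^(-s)`, and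
the short-time Fourier transform of `Ψ` is concentrated at `x = z`, `ξ + b(x) = ζ`, then the value
on `Ψ` is of size `⟨ζ⟩^(-s)`. -/
theorem norm_apply_le_of_shift_bounds {γ : 𝓢(V, ℂ)} (hγ : γ ≠ 0) {s : ℝ} (hs : 0 ≤ s) {N : ℕ}
    (hN : ⌈s⌉₊ + (Module.finrank ℝ V + 1) ≤ N) {L : 𝓢(V, ℂ) →L[ℂ] ℂ} {Ψ : 𝓢(V, ℂ)} {b : V → V}
    (hb : Continuous b) {H Q : ℝ} {z ζ : V}
    (hL : ∀ x ξ, ‖L (tfShift x ξ γ)‖ ≤ H * japaneseWeight (-s) (ξ + b x))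
    (hΨ : ∀ x ξ, ‖l2Pair Ψ (tfShift x ξ γ)‖ ≤
      Q * (((1 + ‖z - x‖) ^ N)⁻¹ * ((1 + ‖ζ - (ξ + b x)‖) ^ N)⁻¹)) :
    ‖L Ψ‖ ≤ (l2NormSq γ)⁻¹ * (2 ^ s * weightIntegral V ^ 2) * (Q * H) * japaneseWeight (-s) ζ := by
  have hH : 0 ≤ H := nonneg_of_mul_nonneg_left ((norm_nonneg _).trans (hL 0 0))
    (japaneseWeight_pos _ _)
  have hQ : 0 ≤ Q := nonneg_of_mul_nonneg_left ((norm_nonneg _).trans (hΨ 0 0)) (by positivity)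
  have hc := l2NormSq_pos hγ
  obtain ⟨hI, hIval⟩ := integrable_weight_sheared hb z ζ
  set D := Module.finrank ℝ V + 1 with hD
  rw [apply_eq_integral_stft hγ Ψ L, norm_mul, Complex.norm_real,
    Real.norm_of_nonneg (by positivity)]
  have hpt : ∀ p : V × V, ‖l2Pair Ψ (tfShift p.1 p.2 γ) * L (tfShift p.1 p.2 γ)‖ ≤
      (2 ^ s * (Q * H) * japaneseWeight (-s) ζ) * (((1 + ‖z - p.1‖) ^ D)⁻¹ *
      ((1 + ‖ζ - (p.2 + b p.1)‖) ^ D)⁻¹) := by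
    rintro ⟨x, ξ⟩
    simp only
    set r := ‖ζ - (ξ + b x)‖ with hr
    have hr0 : 0 ≤ r := norm_nonneg _
    have hw0 := (japaneseWeight_pos (-s) ζ).le
    have h1 : japaneseWeight (-s) (ξ + b x) ≤ 2 ^ s * (1 + r) ^ ⌈s⌉₊ * japaneseWeight (-s) ζ := by
      -- Peetre's inequality; the power lost is absorbed by the decay of order `N ≥ ⌈s⌉ + dim V + 1`
      refine (japaneseWeight_neg_le_peetre hs _ ζ).trans ?_
      rw [norm_sub_rev, ← hr, Real.mul_rpow (by norm_num) (by positivity), ← Real.rpow_natCast]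
      gcongr
      · linarith
      · exact Nat.le_ceil s
    have h2 : ((1 + r) ^ N)⁻¹ * (1 + r) ^ ⌈s⌉₊ ≤ ((1 + r) ^ D)⁻¹ := by
      rw [inv_mul_le_iff₀ (by positivity), ← div_eq_mul_inv, le_div_iff₀ (by positivity), ← pow_add]
      exact pow_le_pow_right₀ (by linarith) hN
    have h3 : ((1 + ‖z - x‖) ^ N)⁻¹ ≤ ((1 + ‖z - x‖) ^ D)⁻¹ := by
      gcongr
      · linarith [norm_nonneg (z - x)]
      · omega
    rw [norm_mul]
    calc ‖l2Pair Ψ (tfShift x ξ γ)‖ * ‖L (tfShift x ξ γ)‖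
        ≤ (Q * (((1 + ‖z - x‖) ^ N)⁻¹ * ((1 + r) ^ N)⁻¹)) *
          (H * (2 ^ s * (1 + r) ^ ⌈s⌉₊ * japaneseWeight (-s) ζ)) :=
          mul_le_mul (hΨ x ξ) ((hL x ξ).trans (by gcongr)) (norm_nonneg _) (by positivity)
      _ = (2 ^ s * (Q * H) * japaneseWeight (-s) ζ) *
          (((1 + ‖z - x‖) ^ N)⁻¹ * (((1 + r) ^ N)⁻¹ * (1 + r) ^ ⌈s⌉₊)) := by ring
      _ ≤ _ := by gcongr
  have h4 : ‖∫ p : V × V, l2Pair Ψ (tfShift p.1 p.2 γ) * L (tfShift p.1 p.2 γ)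
      ∂(volume.prod volume)‖ ≤
      (2 ^ s * (Q * H) * japaneseWeight (-s) ζ) * weightIntegral V ^ 2 := by
    refine (norm_integral_le_of_norm_le (hI.const_mul _) (Eventually.of_forall hpt)).trans ?_
    rw [integral_const_mul, hIval]
  calc _ ≤ (l2NormSq γ)⁻¹ *
        ((2 ^ s * (Q * H) * japaneseWeight (-s) ζ) * weightIntegral V ^ 2) := by gcongr
    _ = _ := by ring

end ShiftBounds

section LocalWindow

variable {V : Type*} [NormedAddCommGroup V] [InnerProductSpace ℝ V]

/-- Multiplication of Schwartz functions by `exp (2 π i Ψ)`. -/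
def expMul (Ψ : V → ℝ) : 𝓢(V, ℂ) →L[ℂ] 𝓢(V, ℂ) :=
  SchwartzMap.smulLeftCLM ℂ (fun v => phaseExp (Ψ v))

theorem expMul_apply {Ψ : V → ℝ} (hΨ : Ψ.HasTemperateGrowth) (f : 𝓢(V, ℂ)) (v : V) :
    expMul Ψ f v = phaseExp (Ψ v) * f v :=
  SchwartzMap.smulLeftCLM_apply_apply (hasTemperateGrowth_exp hΨ) f v

variable [CompleteSpace V]

/-- The phase `Φ` recentred at `z`, with its linear part removed. -/
def localPhase (Φ : V → ℝ) (z u : V) : ℝ := Φ (z + u) - inner ℝ u (gradient Φ z)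

theorem hasTemperateGrowth_localPhase {Φ : V → ℝ} (hΦ : Φ.HasTemperateGrowth) (z : V) :
    (localPhase Φ z).HasTemperateGrowth := by
  have h1 : (fun u : V => z + u).HasTemperateGrowth :=
    (Function.HasTemperateGrowth.const z).add Function.HasTemperateGrowth.id'
  exact (hΦ.comp h1).sub (Function.hasTemperateGrowth_inner_left _)

/-- The first derivative of the recentred phase grows linearly and the higher ones are bounded,
uniformly in the centre. -/
theorem norm_iteratedFDeriv_localPhase_le {Φ : V → ℝ} (hΦ : ContDiff ℝ ∞ Φ) {n : ℕ} {M : ℝ}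
    (hn : 2 ≤ n) (hM : ∀ i, 2 ≤ i → i ≤ n → ∀ v, ‖iteratedFDeriv ℝ i Φ v‖ ≤ M) (z u : V) {i : ℕ}
    (hi : 1 ≤ i) (hin : i ≤ n) :
    ‖iteratedFDeriv ℝ i (localPhase Φ z) u‖ ≤ ((1 + M) * (1 + ‖u‖)) ^ i := by
  have hM0 : 0 ≤ M := (norm_nonneg _).trans (hM 2 le_rfl hn 0)
  have hd : Differentiable ℝ Φ := hΦ.differentiable (by simp)
  have hf : fderiv ℝ (localPhase Φ z) = fun u => fderiv ℝ Φ (u + z) - fderiv ℝ Φ z := by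
    funext u
    have h1 : HasFDerivAt (fun u => Φ (z + u)) (fderiv ℝ Φ (u + z)) u := by
      rw [add_comm u z, ← fderiv_comp_add_left]
      exact ((hd (z + u)).comp u (by fun_prop)).hasFDerivAt
    have h2 : HasFDerivAt (fun u : V => (inner ℝ u (gradient Φ z) : ℝ)) (fderiv ℝ Φ z) u := by
      have : (fun u : V => (inner ℝ u (gradient Φ z) : ℝ)) = fderiv ℝ Φ z := by
        funext u; rw [real_inner_comm, inner_gradient_left]
      rw [this]; exact (fderiv ℝ Φ z).hasFDerivAt
    exact (h1.sub h2).fderiv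
  have hbase : 1 ≤ (1 + M) * (1 + ‖u‖) := by nlinarith [norm_nonneg u]
  obtain ⟨j, rfl⟩ : ∃ j, i = j + 1 := ⟨i - 1, by omega⟩
  rw [← norm_iteratedFDeriv_fderiv, hf]
  rcases Nat.eq_zero_or_pos j with rfl | hj
  · have h1 : ‖fderiv ℝ Φ (u + z) - fderiv ℝ Φ z‖ ≤ M * ‖u + z - z‖ := by
      refine Convex.norm_image_sub_le_of_norm_fderiv_le (𝕜 := ℝ) (s := Set.univ)
        (fun y _ => ((contDiff_infty_iff_fderiv.1 hΦ).2.differentiable (by simp)) y)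
        (fun y _ => ?_) convex_univ trivial trivial
      have := hM 2 le_rfl hn y
      rwa [← norm_iteratedFDeriv_fderiv, ← norm_iteratedFDeriv_fderiv,
        norm_iteratedFDeriv_zero] at this
    rw [add_sub_cancel_right] at h1
    simp only [norm_iteratedFDeriv_zero, zero_add, pow_one]
    nlinarith [norm_nonneg u]
  · have h1 : iteratedFDeriv ℝ j (fun u => fderiv ℝ Φ (u + z) - fderiv ℝ Φ z) u =
        iteratedFDeriv ℝ j (fderiv ℝ Φ) (u + z) := by
      have h2 : ContDiff ℝ j (fun u => fderiv ℝ Φ (u + z)) :=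
        (hΦ.fderiv_right (m := j) (by exact_mod_cast le_top)).comp
          (contDiff_id.add contDiff_const)
      have h3 := iteratedFDeriv_sub_apply (x := u) h2.contDiffAt
        (contDiff_const (c := fderiv ℝ Φ z) (n := j)).contDiffAt
      rw [iteratedFDeriv_const_of_ne hj.ne', iteratedFDeriv_comp_add_right] at h3
      exact h3.trans (sub_zero _)
    rw [h1, norm_iteratedFDeriv_fderiv]
    refine (hM (j + 1) (by omega) hin _).trans (le_trans ?_ (le_self_pow₀ hbase (by omega)))
    nlinarith [norm_nonneg u]

/-- The window `G` twisted by the nonlinear part of the phase at `z`. -/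
def localWindow (Φ : V → ℝ) (z : V) (G : 𝓢(V, ℂ)) : 𝓢(V, ℂ) := expMul (localPhase Φ z) G

theorem decayBound_localWindow {Φ : V → ℝ} (hΦ : Φ.HasTemperateGrowth) {k n : ℕ} {M P : ℝ}
    (hn : 2 ≤ n) (hM : ∀ i, 2 ≤ i → i ≤ n → ∀ v, ‖iteratedFDeriv ℝ i Φ v‖ ≤ M)
    {G : 𝓢(V, ℂ)} (hG : DecayBound (k + n) n P G) (z : V) :
    DecayBound k n (2 ^ n * ((n.factorial * (2 * Real.pi) ^ n * (1 + M) ^ n) * P))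
      (localWindow Φ z G) := by
  have hM0 : 0 ≤ M := (norm_nonneg _).trans (hM 2 le_rfl hn 0)
  have hl := hasTemperateGrowth_localPhase hΦ z
  have hcoe : (localWindow Φ z G : V → ℂ) = fun u => phaseExp (localPhase Φ z u) * G u := by
    funext u; exact expMul_apply hl G u
  rw [hcoe]
  refine DecayBound.mul_of_growth (contDiff_phaseExp_comp hl.1) (G.smooth ⊤) (fun i hi u => ?_) hG
  have h1 := norm_iteratedFDeriv_exp_le hl.1 (n := i) (R := (1 + M) * (1 + ‖u‖)) (v := u)
    (fun j hj hji => norm_iteratedFDeriv_localPhase_le hΦ.1 hn hM z u hj (hji.trans hi))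
  refine h1.trans ?_
  have h2 : (1 : ℝ) ≤ 2 * Real.pi := by linarith [Real.pi_gt_three]
  have h3 : (1 : ℝ) ≤ 1 + ‖u‖ := by linarith [norm_nonneg u]
  have h4 : (1 : ℝ) ≤ 1 + M := by linarith
  rw [mul_pow (1 + M), ← mul_assoc]
  have h5 : (1 + M) ^ i ≤ (1 + M) ^ n := pow_le_pow_right₀ h4 hi
  have h6 : (1 + ‖u‖) ^ i ≤ (1 + ‖u‖) ^ n := pow_le_pow_right₀ h3 hi
  have h7 : (2 * Real.pi) ^ i ≤ (2 * Real.pi) ^ n := pow_le_pow_right₀ h2 hi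
  have h8 : (i.factorial : ℝ) ≤ n.factorial := by exact_mod_cast Nat.factorial_le hi
  exact mul_le_mul (mul_le_mul (mul_le_mul h8 h7 (by positivity) (by positivity)) h5
    (by positivity) (by positivity)) h6 (by positivity) (by positivity)

/-- Multiplication by `exp (2 π i Φ)` acts on the wave packet at `(z, ζ)` by moving it to
`(z, ζ + ∇Φ(z))` and twisting its window. -/
theorem expMul_tfShift {Φ : V → ℝ} (hΦ : Φ.HasTemperateGrowth) (z ζ : V) (G : 𝓢(V, ℂ)) :
    expMul Φ (tfShift z ζ G) = phaseExp (-inner ℝ z (gradient Φ z)) •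
      tfShift z (ζ + gradient Φ z) (localWindow Φ z G) := by
  ext v
  rw [expMul_apply hΦ, smul_apply, tfShift_apply_phaseExp, tfShift_apply_phaseExp, localWindow,
    expMul_apply (hasTemperateGrowth_localPhase hΦ z), smul_eq_mul, ← mul_assoc, ← mul_assoc,
    ← mul_assoc, ← phaseExp_add, ← phaseExp_add, ← phaseExp_add, localPhase]
  congr 2
  rw [add_sub_cancel, inner_add_right, inner_sub_left]
  ring

end LocalWindow

section PhaseTransfer

variable {V : Type} [NormedAddCommGroup V] [InnerProductSpace ℝ V]

variable (V) in
/-- A number of derivatives of the phase that suffices for the estimates of order `s`: `⌈s⌉` of them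
pay for Peetre's inequality and `dim V + 1` for the integral over phase space; the last two
make the number at least three, as the geometry of the phase requires. -/
def derivOrder (s : ℝ) : ℕ := ⌈s⌉₊ + (Module.finrank ℝ V + 1) + 2

theorem three_le_derivOrder (s : ℝ) : 3 ≤ derivOrder V s := by unfold derivOrder; omega

variable [FiniteDimensional ℝ V] [MeasurableSpace V] [BorelSpace V]

/-- A distribution in `M^∞_{1 ⊗ v_s}`, multiplied by `exp (2 π i Φ)`, decays away from the graph
of `-∇Φ`. -/
theorem exists_bound_apply_expMul {γ : 𝓢(V, ℂ)} (hγ : γ ≠ 0) (G : 𝓢(V, ℂ)) {s : ℝ} (hs : 0 ≤ s)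
    (M : ℝ) : ∃ C, 0 ≤ C ∧ ∀ Φ : V → ℝ, Φ.HasTemperateGrowth →
      (∀ i, 2 ≤ i → i ≤ derivOrder V s → ∀ v, ‖iteratedFDeriv ℝ i Φ v‖ ≤ M) →
      ∀ (L : 𝓢(V, ℂ) →L[ℂ] ℂ) (H : ℝ),
        (∀ x ξ, ‖L (tfShift x ξ γ)‖ ≤ H * japaneseWeight (-s) ξ) →
        ∀ z ζ, ‖L (expMul Φ (tfShift z ζ G))‖ ≤
          C * H * japaneseWeight (-s) (ζ + gradient Φ z) := by
  set N := derivOrder V s with hN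
  set D := Module.finrank ℝ V + 1 with hD
  obtain ⟨P, hP⟩ := exists_decayBound (D + N + N) N G
  obtain ⟨R, hR⟩ := exists_decayBound N N γ
  set P' := 2 ^ N * ((N.factorial * (2 * Real.pi) ^ N * (1 + |M|) ^ N) * P) with hP'
  have hP0 := hP.nonneg
  have hR0 := hR.nonneg
  have hP'0 : 0 ≤ P' := by positivity
  have hC := decayConst_nonneg (V := V) N
  have hn := (l2NormSq_pos hγ).le
  refine ⟨(l2NormSq γ)⁻¹ * (2 ^ s * weightIntegral V ^ 2) * (decayConst V N * (P' * R)),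
    by positivity, fun Φ hΦ hM L H hL z ζ => ?_⟩
  have hM' : ∀ i, 2 ≤ i → i ≤ N → ∀ v, ‖iteratedFDeriv ℝ i Φ v‖ ≤ |M| := fun i h1 h2 v =>
    (hM i h1 h2 v).trans (le_abs_self M)
  have hW := decayBound_localWindow hΦ (k := D + N)
    (le_trans (by norm_num) (three_le_derivOrder s)) hM' hP z
  rw [expMul_tfShift hΦ, map_smul, norm_smul, norm_phaseExp, one_mul]
  refine (norm_apply_le_of_shift_bounds hγ hs (N := N) (by rw [hN, derivOrder]; omega)
    (b := fun _ => 0) continuous_const (Q := decayConst V N * (P' * R)) (H := H) (z := z)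
    (ζ := ζ + gradient Φ z) (by simpa using hL) fun x ξ => ?_).trans (le_of_eq (by ring))
  rw [add_zero]
  exact norm_l2Pair_tfShift_le hW hR _ _ _ _

theorem l2Pair_expMul_neg {Φ : V → ℝ} (hΦ : Φ.HasTemperateGrowth) (F G : 𝓢(V, ℂ)) :
    l2Pair (expMul (-Φ) F) G = l2Pair F (expMul Φ G) := by
  rw [l2Pair, l2Pair]
  congr 1
  funext v
  rw [expMul_apply hΦ.neg, expMul_apply hΦ, map_mul, conj_phaseExp, Pi.neg_apply]
  ring

theorem l2Pair_smul_right (c : ℂ) (F G : 𝓢(V, ℂ)) :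
    l2Pair F (c • G) = (starRingEnd ℂ) c * l2Pair F G := by
  rw [l2Pair, l2Pair, ← integral_const_mul]
  congr 1
  funext v
  rw [smul_apply, smul_eq_mul, map_mul]
  ring

/-- A distribution that decays away from the graph of `-∇Φ`, multiplied by `exp (-2 π i Φ)`, is in
`M^∞_{1 ⊗ v_s}`. -/
theorem exists_bound_apply_expMul_neg (γ : 𝓢(V, ℂ)) {G : 𝓢(V, ℂ)} (hG : G ≠ 0) {s : ℝ}
    (hs : 0 ≤ s) (M : ℝ) : ∃ C, 0 ≤ C ∧ ∀ Φ : V → ℝ, Φ.HasTemperateGrowth →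
      (∀ i, 2 ≤ i → i ≤ derivOrder V s → ∀ v, ‖iteratedFDeriv ℝ i Φ v‖ ≤ M) →
      ∀ (L : 𝓢(V, ℂ) →L[ℂ] ℂ) (H : ℝ),
        (∀ x ξ, ‖L (tfShift x ξ G)‖ ≤ H * japaneseWeight (-s) (ξ + gradient Φ x)) →
        ∀ z ζ, ‖L (expMul (-Φ) (tfShift z ζ γ))‖ ≤ C * H * japaneseWeight (-s) ζ := by
  set N := derivOrder V s with hN
  set D := Module.finrank ℝ V + 1 with hD
  obtain ⟨P, hP⟩ := exists_decayBound (N + N) N G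
  obtain ⟨R, hR⟩ := exists_decayBound (D + N) N γ
  set P' := 2 ^ N * ((N.factorial * (2 * Real.pi) ^ N * (1 + |M|) ^ N) * P) with hP'
  have hP0 := hP.nonneg
  have hR0 := hR.nonneg
  have hP'0 : 0 ≤ P' := by positivity
  have hC := decayConst_nonneg (V := V) N
  have hn := (l2NormSq_pos hG).le
  refine ⟨(l2NormSq G)⁻¹ * (2 ^ s * weightIntegral V ^ 2) * (decayConst V N * (R * P')),
    by positivity, fun Φ hΦ hM L H hL z ζ => ?_⟩
  have hM' : ∀ i, 2 ≤ i → i ≤ N → ∀ v, ‖iteratedFDeriv ℝ i Φ v‖ ≤ |M| := fun i h1 h2 v =>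
    (hM i h1 h2 v).trans (le_abs_self M)
  have hgrad : Continuous (gradient Φ) :=
    (InnerProductSpace.toDual ℝ V).symm.continuous.comp (hΦ.1.continuous_fderiv (by simp))
  refine (norm_apply_le_of_shift_bounds hG hs (N := N) (by rw [hN, derivOrder]; omega)
    hgrad (Q := decayConst V N * (R * P')) (H := H) (z := z)
    (ζ := ζ) hL fun x ξ => ?_).trans (le_of_eq (by ring))
  have hW := decayBound_localWindow hΦ (k := N)
    (le_trans (by norm_num) (three_le_derivOrder s)) hM' hP x
  rw [l2Pair_expMul_neg hΦ, expMul_tfShift hΦ, l2Pair_smul_right, norm_mul, RCLike.norm_conj,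
    norm_phaseExp, one_mul]
  exact norm_l2Pair_tfShift_le hR hW _ _ _ _

end PhaseTransfer

/-! ### Tensor products and the kernel of an operator -/

section Tensor

variable {X Y : Type} [NormedAddCommGroup X] [InnerProductSpace ℝ X]
  [NormedAddCommGroup Y] [InnerProductSpace ℝ Y]

theorem norm_iteratedFDeriv_comp_clm_le {U : Type*} [NormedAddCommGroup U] [NormedSpace ℝ U]
    (φ : 𝓢(X, ℂ)) {A : U →L[ℝ] X} (hA : ∀ u, ‖A u‖ ≤ ‖u‖) (i : ℕ) (u : U) :
    ‖iteratedFDeriv ℝ i (fun u => φ (A u)) u‖ ≤ ‖iteratedFDeriv ℝ i φ (A u)‖ := by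
  have h1 := A.iteratedFDeriv_comp_right (φ.smooth ⊤) u (i := i) (by exact_mod_cast le_top)
  have h2 : (fun u => φ (A u)) = φ ∘ A := rfl
  have hA1 : ‖A‖ ≤ 1 := A.opNorm_le_bound zero_le_one fun u => by simpa using hA u
  rw [h2, h1]
  refine (ContinuousMultilinearMap.norm_compContinuousLinearMap_le _ _).trans ?_
  refine mul_le_of_le_one_right (norm_nonneg _) ?_
  exact Finset.prod_le_one (fun _ _ => norm_nonneg _) fun _ _ => hA1

theorem decayBound_tensor {k n : ℕ} {P Q : ℝ} {φ : 𝓢(X, ℂ)} {h : 𝓢(Y, ℂ)}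
    (hφ : DecayBound k n P φ) (hh : DecayBound k n Q h) :
    DecayBound k n (2 ^ n * (P * Q)) (fun z : WithLp 2 (X × Y) => φ z.fst * h z.snd) := by
  intro i hi z
  have hs1 : ContDiff ℝ ∞ (fun z : WithLp 2 (X × Y) => φ z.fst) :=
    (φ.smooth ⊤).comp (WithLp.fstL 2 ℝ X Y).contDiff
  have hs2 : ContDiff ℝ ∞ (fun z : WithLp 2 (X × Y) => h z.snd) :=
    (h.smooth ⊤).comp (WithLp.sndL 2 ℝ X Y).contDiff
  have hP0 := hφ.nonneg
  have hQ0 := hh.nonneg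
  have h1 := norm_iteratedFDeriv_mul_le hs1 hs2 z (n := i) (by exact_mod_cast le_top)
  have h2 : ∀ j ∈ Finset.range (i + 1), (1 + ‖z‖) ^ k * ((i.choose j : ℝ) *
      ‖iteratedFDeriv ℝ j (fun z : WithLp 2 (X × Y) => φ z.fst) z‖ *
      ‖iteratedFDeriv ℝ (i - j) (fun z : WithLp 2 (X × Y) => h z.snd) z‖) ≤
      (i.choose j : ℝ) * (P * Q) := by
    intro j hj
    have hj' : j ≤ i := Nat.lt_succ_iff.1 (Finset.mem_range.1 hj)
    have ha := hφ j (hj'.trans hi) z.fst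
    have hb := hh (i - j) ((Nat.sub_le _ _).trans hi) z.snd
    have h3 : ‖iteratedFDeriv ℝ j (fun z : WithLp 2 (X × Y) => φ z.fst) z‖ ≤
        ‖iteratedFDeriv ℝ j φ z.fst‖ :=
      norm_iteratedFDeriv_comp_clm_le φ (A := WithLp.fstL 2 ℝ X Y)
        (fun z => WithLp.norm_fst_le _ z) j z
    have h4 : ‖iteratedFDeriv ℝ (i - j) (fun z : WithLp 2 (X × Y) => h z.snd) z‖ ≤
        ‖iteratedFDeriv ℝ (i - j) h z.snd‖ :=
      norm_iteratedFDeriv_comp_clm_le h (A := WithLp.sndL 2 ℝ X Y)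
        (fun z => WithLp.norm_snd_le _ z) _ z
    have h5 : 1 + ‖z‖ ≤ (1 + ‖z.fst‖) * (1 + ‖z.snd‖) := by
      have h6 : ‖z‖ ≤ ‖z.fst‖ + ‖z.snd‖ := by
        refine abs_le_of_sq_le_sq' ?_ (by positivity) |>.2
        rw [WithLp.prod_norm_sq_eq_of_L2]
        nlinarith [norm_nonneg z.fst, norm_nonneg z.snd]
      nlinarith [norm_nonneg z.fst, norm_nonneg z.snd]
    calc _ ≤ ((1 + ‖z.fst‖) * (1 + ‖z.snd‖)) ^ k * ((i.choose j : ℝ) *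
          ‖iteratedFDeriv ℝ j φ z.fst‖ * ‖iteratedFDeriv ℝ (i - j) h z.snd‖) := by gcongr
      _ = (i.choose j : ℝ) * (((1 + ‖z.fst‖) ^ k * ‖iteratedFDeriv ℝ j φ z.fst‖) *
          ((1 + ‖z.snd‖) ^ k * ‖iteratedFDeriv ℝ (i - j) h z.snd‖)) := by
        rw [mul_pow]; ring
      _ ≤ _ := by gcongr
  calc _ ≤ (1 + ‖z‖) ^ k * ∑ j ∈ Finset.range (i + 1), (i.choose j : ℝ) *
        ‖iteratedFDeriv ℝ j (fun z : WithLp 2 (X × Y) => φ z.fst) z‖ *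
        ‖iteratedFDeriv ℝ (i - j) (fun z : WithLp 2 (X × Y) => h z.snd) z‖ := by gcongr
    _ ≤ ∑ j ∈ Finset.range (i + 1), (i.choose j : ℝ) * (P * Q) := by
      rw [Finset.mul_sum]; exact Finset.sum_le_sum h2
    _ = 2 ^ i * (P * Q) := by
      rw [← Finset.sum_mul]
      congr 1
      exact_mod_cast Nat.sum_range_choose i
    _ ≤ 2 ^ n * (P * Q) := by
      gcongr
      norm_num

/-- The tensor product `(φ ⊗ h)(x, y) = φ(x) h(y)` of Schwartz functions. -/
def tensor (φ : 𝓢(X, ℂ)) (h : 𝓢(Y, ℂ)) : 𝓢(WithLp 2 (X × Y), ℂ) where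
  toFun z := φ z.fst * h z.snd
  smooth' := ((φ.smooth ⊤).comp (WithLp.fstL 2 ℝ X Y).contDiff).mul
    ((h.smooth ⊤).comp (WithLp.sndL 2 ℝ X Y).contDiff)
  decay' k n := by
    obtain ⟨P, hP⟩ := exists_decayBound k n φ
    obtain ⟨Q, hQ⟩ := exists_decayBound k n h
    refine ⟨_, fun z => le_trans ?_ (decayBound_tensor hP hQ n le_rfl z)⟩
    gcongr
    linarith [norm_nonneg z]

theorem tensor_apply (φ : 𝓢(X, ℂ)) (h : 𝓢(Y, ℂ)) (z : WithLp 2 (X × Y)) :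
    tensor φ h z = φ z.fst * h z.snd := rfl

theorem tensor_ne_zero {φ : 𝓢(X, ℂ)} {h : 𝓢(Y, ℂ)} (hφ : φ ≠ 0) (hh : h ≠ 0) :
    tensor φ h ≠ 0 := by
  obtain ⟨x, hx⟩ : ∃ x, φ x ≠ 0 := by
    by_contra! hne; exact hφ (SchwartzMap.ext hne)
  obtain ⟨y, hy⟩ : ∃ y, h y ≠ 0 := by
    by_contra! hne; exact hh (SchwartzMap.ext hne)
  intro h0
  have h1 : tensor φ h (WithLp.toLp 2 (x, y)) = 0 := by rw [h0]; rfl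
  exact mul_ne_zero hx hy h1

theorem tfShift_tensor (x ξ : X) (y η : Y) (φ : 𝓢(X, ℂ)) (h : 𝓢(Y, ℂ)) :
    tfShift (WithLp.toLp 2 (x, y)) (WithLp.toLp 2 (ξ, η)) (tensor φ h) =
      tensor (tfShift x ξ φ) (tfShift y η h) := by
  ext z
  rw [tfShift_apply_phaseExp, tensor_apply, tensor_apply, tfShift_apply_phaseExp,
    tfShift_apply_phaseExp, WithLp.prod_inner_apply, phaseExp_add]
  simp only [WithLp.sub_fst, WithLp.sub_snd]
  change phaseExp (inner ℝ z.fst ξ) * phaseExp (inner ℝ z.snd η) *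
    (φ (z.fst - x) * h (z.snd - y)) = _
  ring

variable [FiniteDimensional ℝ X] [MeasurableSpace X] [BorelSpace X]
  [FiniteDimensional ℝ Y] [MeasurableSpace Y] [BorelSpace Y]

theorem l2Pair_tensor (φ φ' : 𝓢(X, ℂ)) (h h' : 𝓢(Y, ℂ)) :
    l2Pair (tensor φ h) (tensor φ' h') = l2Pair φ φ' * l2Pair h h' := by
  rw [l2Pair, l2Pair, l2Pair, ← integral_prod_mul, ← Measure.volume_eq_prod,
    ← (WithLp.volume_preserving_toLp X Y).integral_comp
      (MeasurableEquiv.toLp 2 (X × Y)).measurableEmbedding]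
  congr 1
  funext p
  simp only [tensor_apply, map_mul]
  change φ p.1 * h p.2 * ((starRingEnd ℂ) (φ' p.1) * (starRingEnd ℂ) (h' p.2)) = _
  ring

end Tensor

section Kernel

variable {V : Type} [NormedAddCommGroup V] [InnerProductSpace ℝ V]

theorem schwartzConj_tfShift (x ξ : V) (g : 𝓢(V, ℂ)) :
    schwartzConj (tfShift x ξ g) = tfShift x (-ξ) (schwartzConj g) := by
  ext v
  rw [schwartzConj_apply, tfShift_apply_phaseExp, tfShift_apply_phaseExp, map_mul, conj_phaseExp,
    inner_neg_right, schwartzConj_apply]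

theorem schwartzConj_ne_zero {g : 𝓢(V, ℂ)} (hg : g ≠ 0) : schwartzConj g ≠ 0 := by
  intro h
  refine hg (SchwartzMap.ext fun v => ?_)
  have h1 : (starRingEnd ℂ) (g v) = 0 := by rw [← schwartzConj_apply, h]; rfl
  simpa using h1

variable [FiniteDimensional ℝ V] [MeasurableSpace V] [BorelSpace V]

theorem fourier_ne_zero {g : 𝓢(V, ℂ)} (hg : g ≠ 0) : 𝓕 g ≠ 0 := by
  intro h
  refine hg ?_
  rw [← FourierTransform.fourierInv_fourier_eq (E := 𝓢(V, ℂ)) (F := 𝓢(V, ℂ)) g, h]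
  exact (FourierTransform.fourierInvCLM ℂ 𝓢(V, ℂ)).map_zero

theorem fourier_tfShift (y η : V) (g : 𝓢(V, ℂ)) :
    𝓕 (tfShift y η g) = phaseExp (inner ℝ y η) • tfShift η (-y) (𝓕 g) := by
  ext ζ
  rw [smul_apply, tfShift_apply_phaseExp, SchwartzMap.fourier_coe, SchwartzMap.fourier_coe,
    Real.fourier_eq, Real.fourier_eq, smul_eq_mul, ← mul_assoc, ← integral_const_mul,
    ← integral_add_right_eq_self _ y]
  congr 1
  funext v
  rw [tfShift_apply_phaseExp, add_sub_cancel_right, Circle.smul_def, Circle.smul_def,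
    fourierChar_eq_phaseExp, fourierChar_eq_phaseExp, smul_eq_mul, smul_eq_mul, ← mul_assoc,
    ← mul_assoc, ← phaseExp_add, ← phaseExp_add, ← phaseExp_add]
  congr 2
  simp only [inner_add_left, inner_sub_right, inner_neg_right]
  rw [real_inner_comm y ζ]
  ring

theorem l2Pair_add_left (F F' H : 𝓢(V, ℂ)) : l2Pair (F + F') H = l2Pair F H + l2Pair F' H := by
  have h1 : ∀ F : 𝓢(V, ℂ), Integrable (fun v => F v * (starRingEnd ℂ) (H v)) := by
    intro F
    have := (mulConjShift 0 F H).integrable (μ := volume)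
    refine this.congr (Eventually.of_forall fun v => ?_)
    simp only [mulConjShift_apply, sub_zero]
  rw [l2Pair, l2Pair, l2Pair, ← integral_add (h1 F) (h1 F')]
  congr 1
  funext v
  rw [add_apply]; ring

theorem l2Pair_smul_left (c : ℂ) (F H : 𝓢(V, ℂ)) : l2Pair (c • F) H = c * l2Pair F H := by
  rw [l2Pair, l2Pair, ← integral_const_mul]
  congr 1
  funext v
  rw [smul_apply, smul_eq_mul]; ring

/-- The functional `F ↦ ∫ (V_G F) κ`, for a bounded measurable function `κ` of a parametrized
point of time-frequency space. -/
theorem exists_integral_stft_functional {W : Type*} [TopologicalSpace W]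
    [MeasurableSpace W] [OpensMeasurableSpace W] {μ : Measure W} (G : 𝓢(V, ℂ)) {a b : W → V}
    (ha : Continuous a) (hb : Continuous b) {N : ℕ}
    (hw : Integrable (fun p => ((1 + ‖a p‖) ^ N)⁻¹ * ((1 + ‖b p‖) ^ N)⁻¹) μ)
    {κ : W → ℂ} (hκ : Measurable κ) {B : ℝ} (hB : ∀ p, ‖κ p‖ ≤ B) :
    ∃ K : 𝓢(V, ℂ) →L[ℂ] ℂ, ∀ F,
      Integrable (fun p => l2Pair F (tfShift (a p) (b p) G) * κ p) μ ∧
      K F = ∫ p, l2Pair F (tfShift (a p) (b p) G) * κ p ∂μ := by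
  set m := Module.finrank ℝ V + 1 + N with hm
  obtain ⟨Q, hQ⟩ := exists_decayBound N N G
  have hQ0 := hQ.nonneg
  have hC := decayConst_nonneg (V := V) N
  have hbound : ∀ F p, ‖l2Pair F (tfShift (a p) (b p) G) * κ p‖ ≤
      (decayConst V N * 2 ^ m * Q * |B|) *
        ((Finset.Iic (m, N)).sup (schwartzSeminormFamily ℂ V ℂ)) F *
        (((1 + ‖a p‖) ^ N)⁻¹ * ((1 + ‖b p‖) ^ N)⁻¹) := by
    intro F p
    have hF := decayBound_of_seminorm ℂ m N F
    have hF0 := hF.nonneg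
    have h1 := norm_l2Pair_tfShift_le hF hQ 0 0 (a p) (b p)
    rw [tfShift_zero_zero, zero_sub, zero_sub, norm_neg, norm_neg] at h1
    rw [norm_mul]
    refine (mul_le_mul h1 ((hB p).trans (le_abs_self B)) (norm_nonneg _) (by positivity)).trans
      (le_of_eq (by ring))
  have hcont : ∀ F, Continuous (fun p => l2Pair F (tfShift (a p) (b p) G)) := fun F =>
    (continuous_l2Pair F).comp ((continuous_tfShift G).comp (ha.prodMk hb))
  have hint : ∀ F, Integrable (fun p => l2Pair F (tfShift (a p) (b p) G) * κ p) μ :=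
    fun F => (hw.const_mul _).mono' ((hcont F).measurable.mul hκ).aestronglyMeasurable
      (Eventually.of_forall (hbound F))
  refine ⟨SchwartzMap.mkCLMtoNormedSpace (𝕜 := ℂ) (σ := RingHom.id ℂ)
    (fun F => ∫ p, l2Pair F (tfShift (a p) (b p) G) * κ p ∂μ) (fun F F' => ?_) (fun c F => ?_)
    ⟨Finset.Iic (m, N), (decayConst V N * 2 ^ m * Q * |B|) *
      ∫ p, ((1 + ‖a p‖) ^ N)⁻¹ * ((1 + ‖b p‖) ^ N)⁻¹ ∂μ, ?_, fun F => ?_⟩,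
    fun F => ⟨hint F, rfl⟩⟩
  · rw [← integral_add (hint F) (hint F')]
    congr 1
    funext p
    rw [l2Pair_add_left, add_mul]
  · rw [RingHom.id_apply, smul_eq_mul, ← integral_const_mul]
    congr 1
    funext p
    rw [l2Pair_smul_left, mul_assoc]
  · have : 0 ≤ ∫ p, ((1 + ‖a p‖) ^ N)⁻¹ * ((1 + ‖b p‖) ^ N)⁻¹ ∂μ :=
      integral_nonneg fun p => by positivity
    positivity
  · refine (norm_integral_le_of_norm_le (hw.const_mul _)
      (Eventually.of_forall (hbound F))).trans (le_of_eq ?_)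
    rw [integral_const_mul]
    ring

/-- Integrability in the form needed for wave packets on a product, with the coordinates grouped as
`((η, ζ), (x, ξ))` for the position `(x, η)` and the frequency `(ξ, ζ)`. -/
theorem integrable_weight_phase : Integrable (fun p : (V × V) × (V × V) =>
    ((1 + ‖WithLp.toLp 2 (p.2.1, p.1.1)‖) ^
      (Module.finrank ℝ V + 1 + (Module.finrank ℝ V + 1)))⁻¹ *
    ((1 + ‖WithLp.toLp 2 (p.2.2, p.1.2)‖) ^
      (Module.finrank ℝ V + 1 + (Module.finrank ℝ V + 1)))⁻¹) := by
  set D := Module.finrank ℝ V + 1 with hD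
  have h1 : Integrable (fun p : V × V => ((1 + ‖p.1‖) ^ D)⁻¹ * ((1 + ‖p.2‖) ^ D)⁻¹) :=
    (integrable_weight le_rfl).mul_prod (integrable_weight le_rfl)
  have hsplit : ∀ a b : V, ((1 + ‖WithLp.toLp 2 (a, b)‖) ^ (D + D))⁻¹ ≤
      ((1 + ‖a‖) ^ D)⁻¹ * ((1 + ‖b‖) ^ D)⁻¹ := by
    intro a b
    rw [← mul_inv, pow_add]
    have h1 : ‖a‖ ≤ ‖WithLp.toLp 2 (a, b)‖ := WithLp.norm_fst_le _ (WithLp.toLp 2 (a, b))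
    have h2 : ‖b‖ ≤ ‖WithLp.toLp 2 (a, b)‖ := WithLp.norm_snd_le _ (WithLp.toLp 2 (a, b))
    gcongr
  have hcont : Continuous (fun p : (V × V) × (V × V) =>
      ((1 + ‖WithLp.toLp 2 (p.2.1, p.1.1)‖) ^ (D + D))⁻¹ *
      ((1 + ‖WithLp.toLp 2 (p.2.2, p.1.2)‖) ^ (D + D))⁻¹) := by
    refine Continuous.mul (Continuous.inv₀ (by fun_prop) fun p => ?_)
      (Continuous.inv₀ (by fun_prop) fun p => ?_) <;> positivity
  refine (h1.mul_prod h1).mono' hcont.aestronglyMeasurable (Eventually.of_forall fun p => ?_)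
  rw [Real.norm_of_nonneg (by positivity)]
  refine (mul_le_mul (hsplit _ _) (hsplit _ _) (by positivity) (by positivity)).trans
    (le_of_eq (by ring))

end Kernel

section KernelTheorem

variable {d : ℕ}

/-- The value `A f φ` as a continuous functional of `f`. -/
def applyLeft (A : 𝓢(Space d, ℂ) →L[ℂ] 𝓢'(Space d, ℂ)) (φ : 𝓢(Space d, ℂ)) :
    𝓢(Space d, ℂ) →L[ℂ] ℂ :=
  (PointwiseConvergenceCLM.evalCLM (RingHom.id ℂ) ℂ φ).comp A

/-- The inverse Fourier transform on Schwartz functions as a continuous linear map. -/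
abbrev fourierInvMap (d : ℕ) : 𝓢(Space d, ℂ) →L[ℂ] 𝓢(Space d, ℂ) :=
  FourierTransform.fourierInvCLM ℂ 𝓢(Space d, ℂ)

theorem fourierInvMap_fourier (f : 𝓢(Space d, ℂ)) : fourierInvMap d (𝓕 f) = f :=
  FourierTransform.fourierInv_fourier_eq (E := 𝓢(Space d, ℂ)) (F := 𝓢(Space d, ℂ)) f

theorem fourierInv_tfShift (η ζ : Space d) (g : 𝓢(Space d, ℂ)) :
    fourierInvMap d (tfShift η ζ (𝓕 g)) = phaseExp (inner ℝ ζ η) • tfShift (-ζ) η g := by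
  have h1 := fourier_tfShift (-ζ) η g
  rw [neg_neg, inner_neg_left] at h1
  have h2 : tfShift η ζ (𝓕 g) = 𝓕 (phaseExp (inner ℝ ζ η) • tfShift (-ζ) η g) := by
    rw [FourierTransform.fourier_smul, h1, smul_smul, ← phaseExp_add]
    simp
  rw [h2]
  exact fourierInvMap_fourier _

/-- The Gabor matrix of `A` in terms of the bilinear form of `A` on shifted windows, with the
first argument on the Fourier side. -/
theorem norm_apply_fourierInv_tfShift (g : 𝓢(Space d, ℂ))
    (A : 𝓢(Space d, ℂ) →L[ℂ] 𝓢'(Space d, ℂ)) (x ξ η ζ : Space d) :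
    ‖A (fourierInvMap d (tfShift η ζ (𝓕 g))) (tfShift x ξ (schwartzConj g))‖ =
      ‖gaborMatrix g A (pt (-ζ) η) (pt x (-ξ))‖ := by
  have h1 : schwartzConj (tfShift x (-ξ) g) = tfShift x ξ (schwartzConj g) := by
    rw [schwartzConj_tfShift, neg_neg]
  rw [fourierInv_tfShift, map_smul, ← h1]
  change ‖phaseExp (inner ℝ ζ η) • A (tfShift (-ζ) η g) (schwartzConj (tfShift x (-ξ) g))‖ = _
  rw [norm_smul, norm_phaseExp, one_mul]
  rfl

/-- The kernel theorem for operators with a bounded Gabor matrix. The kernel is the superposition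
of wave packets with the Gabor matrix as coefficients; it acts on functions of `(x, η)`, with
`η` the frequency variable of the argument of the operator. -/
theorem exists_kernel {g : 𝓢(Space d, ℂ)} (hg : g ≠ 0)
    (A : 𝓢(Space d, ℂ) →L[ℂ] 𝓢'(Space d, ℂ)) {B : ℝ} (hB : ∀ w z, ‖gaborMatrix g A w z‖ ≤ B) :
    ∃ K : 𝓢(Phase d, ℂ) →L[ℂ] ℂ, ∀ f φ, A f φ = K (tensor φ (𝓕 f)) := by
  set γ := schwartzConj g with hγ
  set h₀ := 𝓕 g with hh₀
  have hγ0 : γ ≠ 0 := schwartzConj_ne_zero hg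
  have hh0 : h₀ ≠ 0 := fourier_ne_zero hg
  let κ : (Space d × Space d) × (Space d × Space d) → ℂ := fun p =>
    A (fourierInvMap d (tfShift p.1.1 p.1.2 h₀)) (tfShift p.2.1 p.2.2 γ)
  have hκB : ∀ p, ‖κ p‖ ≤ B := fun p => by
    simp only [κ, hh₀, hγ, norm_apply_fourierInv_tfShift]
    exact hB _ _
  have hκ : Measurable κ := by
    refine measurable_uncurry_of_continuous_of_measurable
      (u := fun w z : Space d × Space d =>
        A (fourierInvMap d (tfShift w.1 w.2 h₀)) (tfShift z.1 z.2 γ)) (fun z => ?_) (fun w => ?_)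
    · exact (applyLeft A (tfShift z.1 z.2 γ)).continuous.comp
        ((fourierInvMap d).continuous.comp (continuous_tfShift h₀))
    · have h1 : Continuous (A (fourierInvMap d (tfShift w.1 w.2 h₀))) :=
        ContinuousLinearMap.continuous
          (A (fourierInvMap d (tfShift w.1 w.2 h₀)) : 𝓢(Space d, ℂ) →L[ℂ] ℂ)
      exact (h1.comp (continuous_tfShift γ)).measurable
  obtain ⟨K, hK⟩ := exists_integral_stft_functional (tensor γ h₀)
    (a := fun p : (Space d × Space d) × (Space d × Space d) => pt p.2.1 p.1.1)
    (b := fun p => pt p.2.2 p.1.2) (by fun_prop) (by fun_prop) integrable_weight_phase hκ hκB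
  refine ⟨((((l2NormSq h₀)⁻¹ : ℝ) : ℂ) * (((l2NormSq γ)⁻¹ : ℝ) : ℂ)) • K, fun f φ => ?_⟩
  have hF := (hK (tensor φ (𝓕 f))).2
  have hI := (hK (tensor φ (𝓕 f))).1
  simp only [tfShift_tensor, l2Pair_tensor] at hF hI
  rw [Measure.volume_eq_prod, integral_prod _ hI] at hF
  have h1 : A f φ = applyLeft A φ (fourierInvMap d (𝓕 f)) := by
    rw [fourierInvMap_fourier]; rfl
  have h2 := apply_eq_integral_stft hh0 (𝓕 f) ((applyLeft A φ).comp (fourierInvMap d))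
  have h3 : ∀ w : Space d × Space d,
      ((applyLeft A φ).comp (fourierInvMap d)) (tfShift w.1 w.2 h₀) =
      (((l2NormSq γ)⁻¹ : ℝ) : ℂ) * ∫ z : Space d × Space d,
        l2Pair φ (tfShift z.1 z.2 γ) * κ (w, z) := fun w =>
    apply_eq_integral_stft hγ0 φ (A (fourierInvMap d (tfShift w.1 w.2 h₀)) : 𝓢(Space d, ℂ) →L[ℂ] ℂ)
  simp only [h3] at h2
  rw [h1]
  refine h2.trans ?_
  rw [smul_apply, smul_eq_mul, hF, mul_assoc, ← integral_const_mul (((l2NormSq γ)⁻¹ : ℝ) : ℂ),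
    ← Measure.volume_eq_prod]
  congr 2
  funext w
  rw [mul_left_comm, ← integral_const_mul]
  congr 2
  funext z
  ring

end KernelTheorem

/-! ### Global inversion of maps with a derivative bounded from below -/

section GlobalInversion

variable {E : Type*} [NormedAddCommGroup E] [NormedSpace ℝ E] [FiniteDimensional ℝ E]

/-- An endomorphism of a finite-dimensional space that is bounded from below has a right inverse
with the reciprocal bound. -/
def rightInverseOfLowerBound (B : E →L[ℝ] E) {κ : ℝ} (hκ : 0 < κ) (hB : ∀ u, κ * ‖u‖ ≤ ‖B u‖) :
    B.NonlinearRightInverse :=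
  have hinj : Function.Injective (B : E →ₗ[ℝ] E) :=
    (injective_iff_map_eq_zero _).2 fun u hu => by
      have h1 := hB u
      have h2 : B u = 0 := hu
      rw [h2, norm_zero] at h1
      exact norm_le_zero_iff.1 (nonpos_of_mul_nonpos_right h1 hκ)
  let e := LinearEquiv.ofInjectiveEndo (B : E →ₗ[ℝ] E) hinj
  have he : ∀ y, B (e.symm y) = y := fun y => e.apply_symm_apply y
  { toFun := e.symm
    nnnorm := (Real.toNNReal κ)⁻¹
    bound' := fun y => by
      have h1 := hB (e.symm y)
      rw [he] at h1
      rw [NNReal.coe_inv, Real.coe_toNNReal _ hκ.le, inv_mul_eq_div, le_div_iff₀ hκ]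
      linarith
    right_inv' := he }

variable {F : E → E} {F' : E → E →L[ℝ] E} {κ M : ℝ}

/-- The quantitative open mapping property, with a radius independent of the point. -/
theorem exists_mem_closedBall_eq_of_lowerBound (hκ : 0 < κ) (hM : 0 ≤ M)
    (hF : ∀ x, HasFDerivAt F (F' x) x)
    (hlow : ∀ x u, κ * ‖u‖ ≤ ‖F' x u‖) (hlip : ∀ x y, ‖F' x - F' y‖ ≤ M * ‖x - y‖) {ε : ℝ}
    (hε0 : 0 ≤ ε) (hε : ε ≤ κ / (2 * (M + 1))) (x y : E) (hy : ‖y - F x‖ ≤ κ / 2 * ε) :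
    ∃ x', ‖x' - x‖ ≤ ε ∧ F x' = y := by
  have hMε : M * ε ≤ κ / 2 := by
    have h1 : (M + 1) * ε ≤ κ / 2 := by
      rw [le_div_iff₀ (by positivity)] at hε
      linarith
    linarith
  -- on the ball, `F'` varies by at most `κ / 2`, half of the lower bound of `F' x`
  have happ : ApproximatesLinearOn F (F' x) (Metric.closedBall x ε) (Real.toNNReal (κ / 2)) := by
    intro p hp q hq
    refine (convex_closedBall x ε).norm_image_sub_le_of_norm_hasFDerivWithin_le'
      (fun u _ => (hF u).hasFDerivWithinAt) (fun u hu => ?_) hq hp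
    rw [Real.coe_toNNReal _ (by positivity)]
    refine (hlip u x).trans (le_trans ?_ hMε)
    gcongr
    exact mem_closedBall_iff_norm.1 hu
  have h := happ.surjOn_closedBall_of_nonlinearRightInverse
    (rightInverseOfLowerBound (F' x) hκ (hlow x)) hε0 subset_rfl
  have hc : ((rightInverseOfLowerBound (F' x) hκ (hlow x)).nnnorm : ℝ)⁻¹ -
      (Real.toNNReal (κ / 2) : ℝ) = κ / 2 := by
    have : ((rightInverseOfLowerBound (F' x) hκ (hlow x)).nnnorm : ℝ) = κ⁻¹ := by
      change (((Real.toNNReal κ)⁻¹ : NNReal) : ℝ) = _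
      rw [NNReal.coe_inv, Real.coe_toNNReal _ hκ.le]
    rw [this, inv_inv, Real.coe_toNNReal _ (by positivity)]
    ring
  rw [hc] at h
  obtain ⟨x', hx', rfl⟩ := h (mem_closedBall_iff_norm.2 hy)
  exact ⟨x', mem_closedBall_iff_norm.1 hx', rfl⟩

/-- The range is open and closed, because the open mapping property is uniform. -/
theorem surjective_of_lowerBound (hκ : 0 < κ) (hM : 0 ≤ M)
    (hF : ∀ x, HasFDerivAt F (F' x) x)
    (hlow : ∀ x u, κ * ‖u‖ ≤ ‖F' x u‖) (hlip : ∀ x y, ‖F' x - F' y‖ ≤ M * ‖x - y‖) :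
    Function.Surjective F := by
  set r := κ / (2 * (M + 1)) with hr
  have hr0 : 0 < r := by positivity
  have hδ : 0 < κ / 2 * r := by positivity
  have key : ∀ x y, ‖y - F x‖ ≤ κ / 2 * r → y ∈ Set.range F := fun x y hy => by
    obtain ⟨x', -, h⟩ := exists_mem_closedBall_eq_of_lowerBound hκ hM hF hlow hlip hr0.le le_rfl
      x y hy
    exact ⟨x', h⟩
  have hclopen : IsClopen (Set.range F) := by
    constructor
    · refine isClosed_of_closure_subset fun y hy => ?_
      obtain ⟨_, ⟨x, rfl⟩, hx⟩ := Metric.mem_closure_iff.1 hy _ hδ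
      exact key x y (by rw [← dist_eq_norm]; exact hx.le)
    · refine Metric.isOpen_iff.2 ?_
      rintro _ ⟨x, rfl⟩
      exact ⟨_, hδ, fun y hy => key x y (mem_ball_iff_norm.1 hy).le⟩
  exact Set.range_eq_univ.1 (hclopen.eq_univ ⟨F 0, 0, rfl⟩)

/-- The inverse is Lipschitz at a uniform small scale, hence globally, by subdivision of
segments. -/
theorem norm_sub_le_of_lowerBound (hκ : 0 < κ) (hM : 0 ≤ M)
    (hF : ∀ x, HasFDerivAt F (F' x) x)
    (hlow : ∀ x u, κ * ‖u‖ ≤ ‖F' x u‖) (hlip : ∀ x y, ‖F' x - F' y‖ ≤ M * ‖x - y‖)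
    (hinj : Function.Injective F) (x x' : E) : ‖x - x'‖ ≤ 2 / κ * ‖F x - F x'‖ := by
  set r := κ / (2 * (M + 1)) with hr
  have hr0 : 0 < r := by positivity
  have hlocal : ∀ p q, ‖F p - F q‖ ≤ κ / 2 * r → ‖p - q‖ ≤ 2 / κ * ‖F p - F q‖ := by
    intro p q h
    obtain ⟨p', hp', hFp⟩ := exists_mem_closedBall_eq_of_lowerBound hκ hM hF hlow hlip
      (ε := 2 / κ * ‖F p - F q‖) (by positivity) (by
        calc 2 / κ * ‖F p - F q‖ ≤ 2 / κ * (κ / 2 * r) := by gcongr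
          _ = r := by field_simp) q (F p) (le_of_eq (by field_simp))
    rwa [hinj hFp] at hp'
  -- the segment from `F x` to `F x'` is cut into `n` pieces to which the local bound applies
  obtain ⟨n, hn⟩ := exists_nat_gt (‖F x - F x'‖ / (κ / 2 * r))
  have hδ : 0 < κ / 2 * r := by positivity
  have hn0 : (0 : ℝ) < n := lt_of_le_of_lt (by positivity) hn
  have hsurj := surjective_of_lowerBound hκ hM hF hlow hlip
  choose G hG using hsurj
  let y : ℕ → E := fun k => F x + ((k : ℝ) / n) • (F x' - F x)
  have hstep : ∀ k, ‖y k - y (k + 1)‖ = ‖F x - F x'‖ / n := by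
    intro k
    have : y k - y (k + 1) = ((1 : ℝ) / n) • (F x - F x') := by
      simp only [y]
      push_cast
      rw [add_sub_add_left_eq_sub, ← sub_smul, ← neg_sub (F x), smul_neg, ← neg_smul]
      congr 1
      field_simp
      ring
    rw [this, norm_smul, Real.norm_of_nonneg (by positivity)]
    ring
  have h0 : G (y 0) = x := hinj (by rw [hG]; simp [y])
  have h1 : G (y n) = x' := hinj (by rw [hG]; simp [y, hn0.ne'])
  have h2 := dist_le_range_sum_of_dist_le (f := fun k => G (y k)) n
    (d := fun _ => 2 / κ * (‖F x - F x'‖ / n)) fun {k} _ => by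
      rw [dist_eq_norm]
      have h3 : ‖F (G (y k)) - F (G (y (k + 1)))‖ = ‖F x - F x'‖ / n := by
        rw [hG, hG, hstep]
      rw [← h3]
      refine hlocal _ _ ?_
      rw [h3, div_le_iff₀ hn0]
      rw [div_lt_iff₀ hδ] at hn
      linarith
  simp only [h0, h1] at h2
  rw [dist_eq_norm, Finset.sum_const, Finset.card_range, nsmul_eq_mul] at h2
  refine h2.trans (le_of_eq ?_)
  field_simp

/-- Operators in a bounded set with determinant bounded away from zero are uniformly bounded from
below. -/
theorem exists_lowerBound_of_det {c M : ℝ} (hc : 0 < c) : ∃ κ : ℝ, 0 < κ ∧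
    ∀ B : E →L[ℝ] E, ‖B‖ ≤ M → c ≤ |B.det| → ∀ u, κ * ‖u‖ ≤ ‖B u‖ := by
  -- the minimum of `‖B u‖` over a compact set of operators `B` and unit vectors `u` is positive
  have hcl : IsClosed {B : E →L[ℝ] E | c ≤ |B.det|} :=
    isClosed_le continuous_const ContinuousLinearMap.continuous_det.abs
  have hK : IsCompact ((Metric.closedBall (0 : E →L[ℝ] E) M ∩ {B | c ≤ |B.det|}) ×ˢ
      Metric.sphere (0 : E) 1) :=
    ((isCompact_closedBall _ _).inter_right hcl).prod (isCompact_sphere _ _)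
  have hpos : ∀ p ∈ ((Metric.closedBall (0 : E →L[ℝ] E) M ∩ {B | c ≤ |B.det|}) ×ˢ
      Metric.sphere (0 : E) 1), 0 < ‖p.1 p.2‖ := by
    rintro ⟨B, u⟩ ⟨⟨-, hB⟩, hu⟩
    refine norm_pos_iff.2 fun h => ?_
    have hu' : u ≠ 0 := by
      rintro rfl
      simp at hu
    have h0 : LinearMap.det (B : E →ₗ[ℝ] E) = 0 := by
      rw [LinearMap.det_eq_zero_iff_ker_ne_bot]
      exact fun hb => hu' ((LinearMap.ker_eq_bot'.1 hb) u h)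
    have h1 : B.det = 0 := h0
    simp only [Set.mem_ofPred_eq, h1, abs_zero] at hB
    linarith
  have hcont : Continuous (fun p : (E →L[ℝ] E) × E => ‖p.1 p.2‖) := by fun_prop
  obtain ⟨κ, hκ, h⟩ := hK.exists_forall_le' hcont.continuousOn hpos
  refine ⟨κ, hκ, fun B hB hdet u => ?_⟩
  rcases eq_or_ne u 0 with rfl | hu
  · simp
  have hu0 : 0 < ‖u‖ := norm_pos_iff.2 hu
  have h1 := h (B, ‖u‖⁻¹ • u) ⟨⟨by simpa using hB, hdet⟩, by simp [norm_smul, hu0.ne']⟩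
  simp only [map_smul, norm_smul, norm_inv, norm_norm] at h1
  rw [inv_mul_eq_div, le_div_iff₀ hu0] at h1
  exact h1

end GlobalInversion

/-! ### Hessians and the geometry of tame phases -/

section Hessian

theorem norm_fderiv_fderiv_eq {V : Type*} [NormedAddCommGroup V] [NormedSpace ℝ V] {Φ : V → ℝ}
    (z : V) : ‖fderiv ℝ (fderiv ℝ Φ) z‖ = ‖iteratedFDeriv ℝ 2 Φ z‖ := by
  rw [← norm_iteratedFDeriv_one, norm_iteratedFDeriv_fderiv]

variable {V : Type*} [NormedAddCommGroup V] [InnerProductSpace ℝ V] [CompleteSpace V]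
  {Φ : V → ℝ}

theorem hasFDerivAt_gradient (hΦ : ContDiff ℝ ∞ Φ) (z : V) :
    HasFDerivAt (gradient Φ) (fderiv ℝ (gradient Φ) z) z := by
  have h1 : Differentiable ℝ (fderiv ℝ Φ) :=
    (hΦ.fderiv_right (m := ∞) (by simp)).differentiable (by simp)
  have h2 : Differentiable ℝ (gradient Φ) :=
    ((InnerProductSpace.toDual ℝ V).symm.toContinuousLinearEquiv.differentiable).comp h1
  exact (h2 z).hasFDerivAt

theorem inner_fderiv_gradient (hΦ : ContDiff ℝ ∞ Φ) (z u v : V) :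
    inner ℝ (fderiv ℝ (gradient Φ) z u) v = fderiv ℝ (fderiv ℝ Φ) z u v := by
  have h1 : Differentiable ℝ (fderiv ℝ Φ) :=
    (hΦ.fderiv_right (m := ∞) (by simp)).differentiable (by simp)
  have h2 : ∀ w, inner ℝ (gradient Φ w) v = fderiv ℝ Φ w v := fun w => inner_gradient_left
  have h3 : HasFDerivAt (fun w => (inner ℝ (gradient Φ w) v : ℝ)) _ z :=
    ((hasFDerivAt_gradient hΦ z).inner ℝ (hasFDerivAt_const v z))
  have h4 : HasFDerivAt (fun w => fderiv ℝ Φ w v) _ z :=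
    (h1 z).hasFDerivAt.clm_apply (hasFDerivAt_const v z)
  simp only [h2] at h3
  have h5 := congrArg (fun A => A u) (h3.unique h4)
  simpa using h5

theorem inner_fderiv_gradient_comm (hΦ : ContDiff ℝ ∞ Φ) (z u v : V) :
    inner ℝ (fderiv ℝ (gradient Φ) z u) v = inner ℝ u (fderiv ℝ (gradient Φ) z v) := by
  rw [real_inner_comm _ u, inner_fderiv_gradient hΦ, inner_fderiv_gradient hΦ]
  exact (hΦ.contDiffAt.isSymmSndFDerivAt
    (by rw [minSmoothness_of_isRCLikeNormedField]; exact ENat.LEInfty.out)).eq u v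

theorem norm_fderiv_gradient_sub_le (hΦ : ContDiff ℝ ∞ Φ) {Ψ : V → ℝ} (hΨ : ContDiff ℝ ∞ Ψ)
    (z z' : V) : ‖fderiv ℝ (gradient Φ) z - fderiv ℝ (gradient Ψ) z'‖ ≤
      ‖fderiv ℝ (fderiv ℝ Φ) z - fderiv ℝ (fderiv ℝ Ψ) z'‖ := by
  refine ContinuousLinearMap.opNorm_le_bound _ (by positivity) fun u => ?_
  set A := fderiv ℝ (gradient Φ) z - fderiv ℝ (gradient Ψ) z' with hA
  set B := fderiv ℝ (fderiv ℝ Φ) z - fderiv ℝ (fderiv ℝ Ψ) z' with hB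
  have h : ∀ v, inner ℝ (A u) v = B u v := fun v => by
    simp only [hA, hB, sub_apply, inner_sub_left, inner_fderiv_gradient hΦ,
      inner_fderiv_gradient hΨ]
  have h1 : ‖A u‖ * ‖A u‖ ≤ ‖B‖ * ‖u‖ * ‖A u‖ := by
    rw [← real_inner_self_eq_norm_mul_norm, h]
    exact (le_abs_self _).trans (B.le_opNorm₂ u (A u))
  rcases (norm_nonneg (A u)).eq_or_lt with h0 | h0
  · rw [← h0]; positivity
  · exact le_of_mul_le_mul_right h1 h0

theorem norm_fderiv_gradient_le (hΦ : ContDiff ℝ ∞ Φ) (z : V) :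
    ‖fderiv ℝ (gradient Φ) z‖ ≤ ‖iteratedFDeriv ℝ 2 Φ z‖ := by
  rw [← norm_fderiv_fderiv_eq]
  have h0 : gradient (fun _ : V => (0 : ℝ)) = fun _ => 0 := by
    funext w; simp [gradient]
  simpa [h0] using norm_fderiv_gradient_sub_le hΦ (contDiff_const (c := (0 : ℝ))) z z

theorem norm_fderiv_gradient_sub_le_mul (hΦ : ContDiff ℝ ∞ Φ) {M : ℝ}
    (hM : ∀ z, ‖iteratedFDeriv ℝ 3 Φ z‖ ≤ M) (z z' : V) :
    ‖fderiv ℝ (gradient Φ) z - fderiv ℝ (gradient Φ) z'‖ ≤ M * ‖z - z'‖ := by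
  have h1 : Differentiable ℝ (fderiv ℝ (fderiv ℝ Φ)) :=
    ((hΦ.fderiv_right (m := ∞) (by simp)).fderiv_right (m := ∞) (by simp)).differentiable (by simp)
  refine (norm_fderiv_gradient_sub_le hΦ hΦ z z').trans ?_
  refine Convex.norm_image_sub_le_of_norm_fderiv_le (𝕜 := ℝ) (f := fderiv ℝ (fderiv ℝ Φ))
    (fun w _ => h1 w) (fun w _ => ?_) convex_univ (Set.mem_univ z') (Set.mem_univ z)
  rw [← norm_iteratedFDeriv_one, norm_iteratedFDeriv_fderiv, norm_iteratedFDeriv_fderiv]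
  exact hM w

theorem norm_gradient_sub_le (hΦ : ContDiff ℝ ∞ Φ) {M : ℝ}
    (hM : ∀ z, ‖iteratedFDeriv ℝ 2 Φ z‖ ≤ M) (z z' : V) :
    ‖gradient Φ z - gradient Φ z'‖ ≤ M * ‖z - z'‖ :=
  Convex.norm_image_sub_le_of_norm_hasFDerivWithin_le
    (fun w _ => (hasFDerivAt_gradient hΦ w).hasFDerivWithinAt)
    (fun w _ => (norm_fderiv_gradient_le hΦ w).trans (hM w))
    convex_univ (Set.mem_univ z') (Set.mem_univ z)

end Hessian

section MixedHessian

variable {d : ℕ} {Φ : Phase d → ℝ}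

/-- The embedding `x ↦ (x, 0)`. -/
def inlPhase (d : ℕ) : Space d →L[ℝ] Phase d :=
  (WithLp.prodContinuousLinearEquiv 2 ℝ (Space d) (Space d)).symm.toContinuousLinearMap.comp
    (ContinuousLinearMap.inl ℝ (Space d) (Space d))

/-- The embedding `η ↦ (0, η)`. -/
def inrPhase (d : ℕ) : Space d →L[ℝ] Phase d :=
  (WithLp.prodContinuousLinearEquiv 2 ℝ (Space d) (Space d)).symm.toContinuousLinearMap.comp
    (ContinuousLinearMap.inr ℝ (Space d) (Space d))

theorem inlPhase_apply (x : Space d) : inlPhase d x = pt x 0 := rfl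
theorem inrPhase_apply (x : Space d) : inrPhase d x = pt 0 x := rfl

theorem hasFDerivAt_pt_left (x η : Space d) : HasFDerivAt (fun x => pt x η) (inlPhase d) x := by
  have h : (fun x => pt x η) = fun x => inlPhase d x + pt 0 η := by
    funext x
    rw [inlPhase_apply, ← WithLp.toLp_add, Prod.mk_add_mk, add_zero, zero_add]
  rw [h]
  exact (inlPhase d).hasFDerivAt.add_const _

theorem hasFDerivAt_pt_right (x η : Space d) : HasFDerivAt (fun η => pt x η) (inrPhase d) η := by
  have h : (fun η => pt x η) = fun η => inrPhase d η + pt x 0 := by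
    funext x
    rw [inrPhase_apply, ← WithLp.toLp_add, Prod.mk_add_mk, add_zero, zero_add]
  rw [h]
  exact (inrPhase d).hasFDerivAt.add_const _

theorem gradX_eq (hΦ : ContDiff ℝ ∞ Φ) (x η : Space d) :
    gradX Φ x η = (gradient Φ (pt x η)).fst := by
  refine ext_inner_right ℝ fun v => ?_
  have h1 := ((hΦ.differentiable (by simp)) (pt x η)).hasFDerivAt.comp x (hasFDerivAt_pt_left x η)
  rw [gradX, inner_gradient_left]
  have h2 : fderiv ℝ (fun x' => Φ (pt x' η)) x v = fderiv ℝ Φ (pt x η) (pt v 0) :=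
    congrArg (fun A => A v) h1.fderiv
  rw [h2, ← inner_gradient_left, WithLp.prod_inner_apply]
  simp

theorem gradEta_eq (hΦ : ContDiff ℝ ∞ Φ) (x η : Space d) :
    gradEta Φ x η = (gradient Φ (pt x η)).snd := by
  refine ext_inner_right ℝ fun v => ?_
  have h1 := ((hΦ.differentiable (by simp)) (pt x η)).hasFDerivAt.comp η (hasFDerivAt_pt_right x η)
  rw [gradEta, inner_gradient_left]
  have h2 : fderiv ℝ (fun η' => Φ (pt x η')) η v = fderiv ℝ Φ (pt x η) (pt 0 v) :=
    congrArg (fun A => A v) h1.fderiv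
  rw [h2, ← inner_gradient_left, WithLp.prod_inner_apply]
  simp

/-- The mixed Hessian `∂²_{x,η} Φ`, as the derivative of `x ↦ ∇_η Φ (x, η)`. -/
def mixedHessian (Φ : Phase d → ℝ) (z : Phase d) : Space d →L[ℝ] Space d :=
  (WithLp.sndL 2 ℝ (Space d) (Space d)).comp ((fderiv ℝ (gradient Φ) z).comp (inlPhase d))

theorem hasFDerivAt_gradEta (hΦ : ContDiff ℝ ∞ Φ) (x η : Space d) :
    HasFDerivAt (fun x => gradEta Φ x η) (mixedHessian Φ (pt x η)) x := by
  simp only [gradEta_eq hΦ]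
  have h := (hasFDerivAt_gradient hΦ (pt x η)).comp x (hasFDerivAt_pt_left x η)
  exact (WithLp.sndL 2 ℝ (Space d) (Space d)).hasFDerivAt.comp x h

theorem norm_pt_zero (u : Space d) : ‖pt u 0‖ = ‖u‖ := by
  rw [WithLp.prod_norm_eq_of_L2]
  simp

theorem norm_pt_le (x η : Space d) : ‖pt x η‖ ≤ ‖x‖ + ‖η‖ := by
  refine (abs_le_of_sq_le_sq' ?_ (by positivity)).2
  rw [WithLp.prod_norm_sq_eq_of_L2]
  change ‖x‖ ^ 2 + ‖η‖ ^ 2 ≤ _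
  nlinarith [norm_nonneg x, norm_nonneg η]

theorem norm_snd_comp_comp_inl_le (A : Phase d →L[ℝ] Phase d) :
    ‖(WithLp.sndL 2 ℝ (Space d) (Space d)).comp (A.comp (inlPhase d))‖ ≤ ‖A‖ :=
  ContinuousLinearMap.opNorm_le_bound _ (norm_nonneg _) fun u =>
    (WithLp.norm_snd_le _ (A (pt u 0))).trans ((A.le_opNorm _).trans_eq (by rw [norm_pt_zero]))

theorem norm_mixedHessian_le (hΦ : ContDiff ℝ ∞ Φ) (z : Phase d) :
    ‖mixedHessian Φ z‖ ≤ ‖iteratedFDeriv ℝ 2 Φ z‖ :=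
  (norm_snd_comp_comp_inl_le _).trans (norm_fderiv_gradient_le hΦ z)

theorem norm_mixedHessian_sub_le (hΦ : ContDiff ℝ ∞ Φ) {M : ℝ}
    (hM : ∀ z, ‖iteratedFDeriv ℝ 3 Φ z‖ ≤ M) (z z' : Phase d) :
    ‖mixedHessian Φ z - mixedHessian Φ z'‖ ≤ M * ‖z - z'‖ := by
  refine le_trans ?_ (norm_fderiv_gradient_sub_le_mul hΦ hM z z')
  rw [mixedHessian, mixedHessian, ← ContinuousLinearMap.comp_sub, ← ContinuousLinearMap.sub_comp]
  exact norm_snd_comp_comp_inl_le _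

/-- The mixed Hessian depends on `Φ` in a Lipschitz way, for the supremum norm of the second
derivatives. -/
theorem norm_mixedHessian_sub_mixedHessian_le (hΦ : ContDiff ℝ ∞ Φ) {Ψ : Phase d → ℝ}
    (hΨ : ContDiff ℝ ∞ Ψ) (z : Phase d) :
    ‖mixedHessian Φ z - mixedHessian Ψ z‖ ≤ ‖iteratedFDeriv ℝ 2 (Φ - Ψ) z‖ := by
  have h1 : ∀ {f : Phase d → ℝ}, ContDiff ℝ ∞ f → Differentiable ℝ (fderiv ℝ f) := fun hf =>
    (hf.fderiv_right (m := ∞) (by simp)).differentiable (by simp)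
  have h2 : fderiv ℝ (fderiv ℝ (Φ - Ψ)) z = fderiv ℝ (fderiv ℝ Φ) z - fderiv ℝ (fderiv ℝ Ψ) z := by
    have : fderiv ℝ (Φ - Ψ) = fderiv ℝ Φ - fderiv ℝ Ψ := by
      funext w
      exact fderiv_sub (hΦ.differentiable (by simp) w) (hΨ.differentiable (by simp) w)
    rw [this, fderiv_sub (h1 hΦ z) (h1 hΨ z)]
  rw [← norm_fderiv_fderiv_eq, h2]
  refine le_trans ?_ (norm_fderiv_gradient_sub_le hΦ hΨ z z)
  rw [mixedHessian, mixedHessian, ← ContinuousLinearMap.comp_sub, ← ContinuousLinearMap.sub_comp]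
  exact norm_snd_comp_comp_inl_le _

theorem inner_mixedHessian (hΦ : ContDiff ℝ ∞ Φ) (z : Phase d) (u v : Space d) :
    inner ℝ (mixedHessian Φ z u) v = inner ℝ u (fderiv ℝ (gradient Φ) z (pt 0 v)).fst := by
  have h := inner_fderiv_gradient_comm hΦ z (pt u 0) (pt 0 v)
  rw [WithLp.prod_inner_apply, WithLp.prod_inner_apply] at h
  have h' : inner ℝ (fderiv ℝ (gradient Φ) z (pt u 0)).snd v =
      inner ℝ u (fderiv ℝ (gradient Φ) z (pt 0 v)).fst := by simpa using h
  exact h'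

/-- By the symmetry of second derivatives the two mixed Hessians are adjoint to each other, so
they have the same determinant. -/
theorem det_mixedHessian (hΦ : ContDiff ℝ ∞ Φ) (x η : Space d) :
    (mixedHessian Φ (pt x η)).det = mixedHessianDet Φ x η := by
  set B := mixedHessian Φ (pt x η) with hB
  set B' := fderiv ℝ (fun η' => gradX Φ x η') η with hB'
  have h1 : B' = (WithLp.fstL 2 ℝ (Space d) (Space d)).comp
      ((fderiv ℝ (gradient Φ) (pt x η)).comp (inrPhase d)) := by
    have : (fun η' => gradX Φ x η') = fun η' => (gradient Φ (pt x η')).fst := by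
      funext η'; exact gradX_eq hΦ x η'
    rw [hB', this]
    have h := (hasFDerivAt_gradient hΦ (pt x η)).comp η (hasFDerivAt_pt_right x η)
    exact ((WithLp.fstL 2 ℝ (Space d) (Space d)).hasFDerivAt.comp η h).fderiv
  have h2 : (B' : Space d →ₗ[ℝ] Space d) = LinearMap.adjoint (B : Space d →ₗ[ℝ] Space d) := by
    rw [LinearMap.eq_adjoint_iff]
    intro v u
    have h3 := inner_mixedHessian hΦ (pt x η) u v
    rw [real_inner_comm, real_inner_comm _ v]
    rw [h1]
    exact h3.symm
  have h3 : LinearMap.det (B' : Space d →ₗ[ℝ] Space d) =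
      LinearMap.det (B : Space d →ₗ[ℝ] Space d) := by
    let b := EuclideanSpace.basisFun (Fin d) ℝ
    rw [h2, ← LinearMap.det_toMatrix b.toBasis, ← LinearMap.det_toMatrix b.toBasis,
      LinearMap.toMatrix_adjoint, Matrix.det_conjTranspose]
    simp
  exact h3.symm

/-- A phase whose derivatives of orders `2, …, n` are bounded by `M` and whose mixed Hessian is
bounded from below by `κ`. All the constants in the estimates for a single phase depend only on
these quantities. -/
structure IsControlledPhase (n : ℕ) (M κ : ℝ) (Φ : Phase d → ℝ) : Prop where
  temperate : Φ.HasTemperateGrowth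
  bound : ∀ i, 2 ≤ i → i ≤ n → ∀ z, ‖iteratedFDeriv ℝ i Φ z‖ ≤ M
  lower : ∀ z u, κ * ‖u‖ ≤ ‖mixedHessian Φ z u‖

/-- The distance of `(x, ξ)` to `χ (y, η)` is comparable with the defect in the equations
`ξ = ∇_x Φ (x, η)`, `y = ∇_η Φ (x, η)` of the graph of `χ`. -/
theorem IsControlledPhase.norm_sub_comparable {n : ℕ} {M κ : ℝ} (h : IsControlledPhase n M κ Φ)
    (hn : 3 ≤ n) (hκ : 0 < κ) {χ : Phase d → Phase d} (hχ : IsCanonicalTransformationOf χ Φ)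
    (x ξ y η : Space d) :
    ‖pt x ξ - χ (pt y η)‖ ≤ (1 + (1 + M) * (2 / κ) + 2 * M) *
      ‖pt (-ξ) (-y) + gradient Φ (pt x η)‖ ∧
    ‖pt (-ξ) (-y) + gradient Φ (pt x η)‖ ≤ (1 + (1 + M) * (2 / κ) + 2 * M) *
      ‖pt x ξ - χ (pt y η)‖ := by
  have hΦ : ContDiff ℝ ∞ Φ := h.temperate.1
  have hM2 := h.bound 2 le_rfl (by omega)
  have hM3 := h.bound 3 (by norm_num) hn
  have hM : 0 ≤ M := (norm_nonneg _).trans (hM2 0)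
  have hpt : ∀ x x' : Space d, ‖pt x η - pt x' η‖ = ‖x - x'‖ := fun x x' => by
    rw [← WithLp.toLp_sub, Prod.mk_sub_mk, sub_self, norm_pt_zero]
  have hlip : ∀ x x', ‖mixedHessian Φ (pt x η) - mixedHessian Φ (pt x' η)‖ ≤ M * ‖x - x'‖ :=
    fun x x' => (norm_mixedHessian_sub_le hΦ hM3 _ _).trans_eq (by rw [hpt])
  -- `χ` recovers `x` from `∇_η Φ (x, η)` and `η`
  have hinj : Function.Injective (fun x => gradEta Φ x η) := fun x x' hxx => by
    have h1 := hχ x η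
    have h2 := hχ x' η
    simp only at hxx
    rw [hxx, h2] at h1
    exact (congrArg WithLp.fst h1).symm
  -- `x₀` is the first component of `χ (y, η)`
  obtain ⟨x₀, hx₀⟩ := surjective_of_lowerBound hκ hM (hasFDerivAt_gradEta hΦ · η)
    (fun x => h.lower (pt x η)) hlip y
  have hinv := norm_sub_le_of_lowerBound hκ hM (hasFDerivAt_gradEta hΦ · η)
    (fun x => h.lower (pt x η)) hlip hinj x x₀
  simp only at hx₀ hinv
  have hχ₀ : χ (pt y η) = pt x₀ (gradX Φ x₀ η) := by rw [← hx₀]; exact hχ x₀ η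
  have hgrad := norm_gradient_sub_le hΦ hM2 (pt x η) (pt x₀ η)
  rw [hpt] at hgrad
  set e := pt (-ξ) (-y) + gradient Φ (pt x η) with he
  set f := pt x ξ - χ (pt y η) with hf
  have he1 : e.fst = gradX Φ x η - ξ := by
    rw [gradX_eq hΦ, he, WithLp.add_fst]; exact neg_add_eq_sub _ _
  have he2 : e.snd = gradEta Φ x η - gradEta Φ x₀ η := by
    rw [hx₀, gradEta_eq hΦ x, he, WithLp.add_snd]; exact neg_add_eq_sub _ _
  have hf1 : f.fst = x - x₀ := by rw [hf, hχ₀]; rfl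
  have hf2 : f.snd = ξ - gradX Φ x₀ η := by rw [hf, hχ₀]; rfl
  have hgx : ‖gradX Φ x η - gradX Φ x₀ η‖ ≤ M * ‖x - x₀‖ := by
    rw [gradX_eq hΦ, gradX_eq hΦ, ← WithLp.sub_fst]
    exact (WithLp.norm_fst_le _ _).trans hgrad
  have hge : ‖gradEta Φ x η - gradEta Φ x₀ η‖ ≤ M * ‖x - x₀‖ := by
    rw [gradEta_eq hΦ, gradEta_eq hΦ, ← WithLp.sub_snd]
    exact (WithLp.norm_snd_le _ _).trans hgrad
  have hen : ‖e‖ ≤ ‖e.fst‖ + ‖e.snd‖ := norm_pt_le e.fst e.snd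
  have hfn : ‖f‖ ≤ ‖f.fst‖ + ‖f.snd‖ := norm_pt_le f.fst f.snd
  have e1 := WithLp.norm_fst_le _ e
  have e2 := WithLp.norm_snd_le _ e
  have f1 := WithLp.norm_fst_le _ f
  have f2 := WithLp.norm_snd_le _ f
  rw [he1] at e1 hen
  rw [he2] at e2 hen
  rw [hf1] at f1 hfn
  rw [hf2] at f2 hfn
  have hxe : ‖x - x₀‖ ≤ 2 / κ * ‖e‖ := hinv.trans (by gcongr)
  have hκ' : 0 < 2 / κ := by positivity
  have t1 : ‖ξ - gradX Φ x₀ η‖ ≤ ‖gradX Φ x η - ξ‖ + ‖gradX Φ x η - gradX Φ x₀ η‖ := by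
    have : ξ - gradX Φ x₀ η = -(gradX Φ x η - ξ) + (gradX Φ x η - gradX Φ x₀ η) := by abel
    rw [this, ← norm_neg (gradX Φ x η - ξ)]
    exact norm_add_le _ _
  have t2 : ‖gradX Φ x η - ξ‖ ≤ ‖gradX Φ x η - gradX Φ x₀ η‖ + ‖ξ - gradX Φ x₀ η‖ := by
    have : gradX Φ x η - ξ = (gradX Φ x η - gradX Φ x₀ η) + -(ξ - gradX Φ x₀ η) := by abel
    rw [this, ← norm_neg (ξ - gradX Φ x₀ η)]
    exact norm_add_le _ _
  have m1 : M * ‖x - x₀‖ ≤ M * (2 / κ * ‖e‖) := by gcongr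
  have m2 : M * ‖x - x₀‖ ≤ M * ‖f‖ := by gcongr
  have p1 : 0 ≤ M * ‖e‖ := by positivity
  have p2 : 0 ≤ (1 + M) * (2 / κ) * ‖f‖ := by positivity
  constructor
  · linarith
  · linarith

end MixedHessian

/-! ### The equivalence for a single phase -/

section SinglePhase

theorem one_le_japaneseWeight {V : Type*} [NormedAddCommGroup V] {s : ℝ} (hs : 0 ≤ s) (z : V) :
    1 ≤ japaneseWeight s z :=
  Real.one_le_rpow (by nlinarith [sq_nonneg ‖z‖]) (by positivity)

theorem japaneseWeight_le_one {V : Type*} [NormedAddCommGroup V] {s : ℝ} (hs : s ≤ 0) (z : V) :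
    japaneseWeight s z ≤ 1 :=
  Real.rpow_le_one_of_one_le_of_nonpos (by nlinarith [sq_nonneg ‖z‖]) (by linarith)

theorem stft_eq {V : Type} [NormedAddCommGroup V] [InnerProductSpace ℝ V] (ψ : 𝓢(V, ℂ))
    (u : 𝓢'(V, ℂ)) (x ξ : V) : stft ψ u x ξ = u (tfShift x (-ξ) (schwartzConj ψ)) := by
  rw [stft, bracket, schwartzConj_tfShift]

theorem MemModulation.norm_stft_le {V : Type} [NormedAddCommGroup V] [InnerProductSpace ℝ V]
    {ψ : 𝓢(V, ℂ)} {s : ℝ} {u : 𝓢'(V, ℂ)} (hu : MemModulation ψ s u) (x ξ : V) :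
    ‖u (tfShift x ξ (schwartzConj ψ))‖ ≤ modulationNorm ψ s u * japaneseWeight (-s) ξ := by
  have h1 : ENNReal.ofReal (‖stft ψ u x (-ξ)‖ * japaneseWeight s (-ξ)) ≤ modulationENorm ψ s u :=
    le_iSup₂ (f := fun x ξ => ENNReal.ofReal (‖stft ψ u x ξ‖ * japaneseWeight s ξ)) x (-ξ)
  have h2 := (ENNReal.ofReal_le_iff_le_toReal hu.ne).1 h1
  rw [stft_eq, neg_neg, japaneseWeight_neg_arg] at h2
  have h3 := mul_le_mul_of_nonneg_right h2 (japaneseWeight_pos (-s) ξ).le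
  rwa [mul_assoc, japaneseWeight_mul_neg, mul_one] at h3

theorem modulationENorm_le_of_norm_le {V : Type} [NormedAddCommGroup V] [InnerProductSpace ℝ V]
    {ψ : 𝓢(V, ℂ)} {s : ℝ} {u : 𝓢'(V, ℂ)} {B : ℝ}
    (h : ∀ x ξ, ‖u (tfShift x ξ (schwartzConj ψ))‖ ≤ B * japaneseWeight (-s) ξ) :
    modulationENorm ψ s u ≤ ENNReal.ofReal B := by
  refine iSup₂_le fun x ξ => ENNReal.ofReal_le_ofReal ?_
  rw [stft_eq]
  have h1 := mul_le_mul_of_nonneg_right (h x (-ξ)) (japaneseWeight_pos s ξ).le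
  rwa [japaneseWeight_neg_arg, mul_assoc, mul_comm (japaneseWeight (-s) ξ),
    japaneseWeight_mul_neg, mul_one] at h1

variable {d : ℕ}

/-- The test function in the definition of a type I operator is `exp (2 π i Φ) (φ ⊗ f̂)`. -/
theorem IsTypeOneFIO.apply_eq {σ : 𝓢'(Phase d, ℂ)} {Φ : Phase d → ℝ}
    {A : 𝓢(Space d, ℂ) →L[ℂ] 𝓢'(Space d, ℂ)} (h : IsTypeOneFIO σ Φ A)
    (hΦ : Φ.HasTemperateGrowth) (f φ : 𝓢(Space d, ℂ)) :
    A f φ = σ (expMul Φ (tensor φ (𝓕 f))) := by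
  obtain ⟨Θ, hΘ, h1⟩ := h f φ
  rw [h1]
  congr 1
  ext z
  have h2 := hΘ z.fst z.snd
  rw [expMul_apply hΦ, tensor_apply, mul_comm (φ z.fst), ← mul_assoc]
  exact h2

theorem isTypeOneFIO_of_apply_eq {σ : 𝓢'(Phase d, ℂ)} {Φ : Phase d → ℝ}
    {A : 𝓢(Space d, ℂ) →L[ℂ] 𝓢'(Space d, ℂ)} (hΦ : Φ.HasTemperateGrowth)
    (h : ∀ f φ, A f φ = σ (expMul Φ (tensor φ (𝓕 f)))) : IsTypeOneFIO σ Φ A := fun f φ =>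
  ⟨expMul Φ (tensor φ (𝓕 f)), fun x η => by
    rw [expMul_apply hΦ, tensor_apply, mul_comm (φ _), ← mul_assoc]
    rfl, h f φ⟩

theorem fourier_fourierInvMap (f : 𝓢(Space d, ℂ)) : 𝓕 (fourierInvMap d f) = f :=
  FourierTransform.fourier_fourierInv_eq (E := 𝓢(Space d, ℂ)) (F := 𝓢(Space d, ℂ)) f

/-- A type I operator with symbol in `M^∞_{1 ⊗ v_s}` has a Gabor matrix that decays away from the
graph of the canonical transformation, with uniform constants for controlled phases. -/
theorem exists_hasGaborDecay_of_isTypeOneFIO (g : 𝓢(Space d, ℂ)) {ψ : 𝓢(Phase d, ℂ)} (hψ : ψ ≠ 0)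
    {s : ℝ} (hs : 0 ≤ s) {M κ : ℝ} (hκ : 0 < κ) : ∃ C, 0 ≤ C ∧ ∀ (Φ : Phase d → ℝ)
      (χ : Phase d → Phase d) (σ : 𝓢'(Phase d, ℂ)) (A : 𝓢(Space d, ℂ) →L[ℂ] 𝓢'(Space d, ℂ)),
      IsControlledPhase (derivOrder (Phase d) s) M κ Φ → IsCanonicalTransformationOf χ Φ →
      IsTypeOneFIO σ Φ A → MemModulation ψ s σ →
      HasGaborDecay g χ s A (C * modulationNorm ψ s σ) := by
  obtain ⟨C, hC0, hC⟩ := exists_bound_apply_expMul (schwartzConj_ne_zero hψ)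
    (tensor (schwartzConj g) (𝓕 g)) hs M
  -- `M` is nonnegative as soon as there is a controlled phase; until then `|M|` stands for it
  set L := 1 + (1 + |M|) * (2 / κ) + 2 * |M| with hL
  have hL1 : 1 ≤ L := by
    have : 0 ≤ (1 + |M|) * (2 / κ) + 2 * |M| := by positivity
    linarith
  refine ⟨C * L ^ s, by positivity, fun Φ χ σ A hΦ hχ hA hσ w z => ?_⟩
  have h3 := three_le_derivOrder (V := Phase d) s
  have hM : 0 ≤ M := (norm_nonneg _).trans (hΦ.bound 2 le_rfl (by omega) 0)
  have hgeo := (hΦ.norm_sub_comparable h3 hκ hχ z.fst z.snd w.fst w.snd).1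
  rw [← abs_of_nonneg hM, ← hL] at hgeo
  have hH0 : 0 ≤ modulationNorm ψ s σ := ENNReal.toReal_nonneg
  have h1 := norm_apply_fourierInv_tfShift g A z.fst (-z.snd) w.snd (-w.fst)
  rw [neg_neg, neg_neg, hA.apply_eq hΦ.temperate, fourier_fourierInvMap, ← tfShift_tensor] at h1
  have h2 := hC Φ hΦ.temperate hΦ.bound σ (modulationNorm ψ s σ) hσ.norm_stft_le
    (pt z.fst w.snd) (pt (-z.snd) (-w.fst))
  have h4 := japaneseWeight_neg_le_of_norm_le hs hL1 hgeo
  calc ‖gaborMatrix g A w z‖ ≤ C * modulationNorm ψ s σ * japaneseWeight (-s)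
        (pt (-z.snd) (-w.fst) + gradient Φ (pt z.fst w.snd)) := h1.symm.le.trans h2
    _ ≤ C * modulationNorm ψ s σ * (L ^ s * japaneseWeight (-s) (z - χ w)) := by
      gcongr
      exact h4
    _ = C * L ^ s * modulationNorm ψ s σ * japaneseWeight (-s) (z - χ w) := by ring

/-- An operator whose Gabor matrix decays away from the graph of the canonical transformation is
a type I operator with symbol in `M^∞_{1 ⊗ v_s}`, with uniform constants for controlled phases:
the symbol is the kernel of the operator multiplied by `exp (-2 π i Φ)`. -/
theorem exists_isTypeOneFIO_of_hasGaborDecay {g : 𝓢(Space d, ℂ)} (hg : g ≠ 0) (ψ : 𝓢(Phase d, ℂ))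
    {s : ℝ} (hs : 0 ≤ s) {M κ : ℝ} (hκ : 0 < κ) : ∃ C, 0 ≤ C ∧ ∀ (Φ : Phase d → ℝ)
      (χ : Phase d → Phase d) (A : 𝓢(Space d, ℂ) →L[ℂ] 𝓢'(Space d, ℂ)) (B : ℝ),
      IsControlledPhase (derivOrder (Phase d) s) M κ Φ → IsCanonicalTransformationOf χ Φ →
      HasGaborDecay g χ s A B →
      ∃ σ : 𝓢'(Phase d, ℂ), IsTypeOneFIO σ Φ A ∧
        modulationENorm ψ s σ ≤ ENNReal.ofReal (C * B) := by
  obtain ⟨C, hC0, hC⟩ := exists_bound_apply_expMul_neg (schwartzConj ψ)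
    (tensor_ne_zero (schwartzConj_ne_zero hg) (fourier_ne_zero hg)) hs M
  -- `M` is nonnegative as soon as there is a controlled phase; until then `|M|` stands for it
  set L := 1 + (1 + |M|) * (2 / κ) + 2 * |M| with hL
  have hL1 : 1 ≤ L := by
    have : 0 ≤ (1 + |M|) * (2 / κ) + 2 * |M| := by positivity
    linarith
  refine ⟨C * L ^ s, by positivity, fun Φ χ A B hΦ hχ hA => ?_⟩
  have h3 := three_le_derivOrder (V := Phase d) s
  have hM : 0 ≤ M := (norm_nonneg _).trans (hΦ.bound 2 le_rfl (by omega) 0)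
  have hB0 : 0 ≤ B := nonneg_of_mul_nonneg_left ((norm_nonneg _).trans (hA 0 0))
    (japaneseWeight_pos _ _)
  obtain ⟨K, hK⟩ := exists_kernel hg A (B := B) fun w z =>
    (hA w z).trans (mul_le_of_le_one_right hB0 (japaneseWeight_le_one (by linarith) _))
  have hcancel : ∀ F : 𝓢(Phase d, ℂ), expMul (-Φ) (expMul Φ F) = F := fun F => by
    ext z
    rw [expMul_apply hΦ.temperate.neg, expMul_apply hΦ.temperate, ← mul_assoc, ← phaseExp_add,
      Pi.neg_apply, neg_add_cancel, phaseExp_zero, one_mul]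
  refine ⟨K.comp (expMul (-Φ)), isTypeOneFIO_of_apply_eq hΦ.temperate fun f φ => ?_,
    modulationENorm_le_of_norm_le fun x ξ => ?_⟩
  · change _ = K (expMul (-Φ) (expMul Φ (tensor φ (𝓕 f))))
    rw [hcancel, hK]
  have hKG : ∀ x ξ : Phase d, ‖K (tfShift x ξ (tensor (schwartzConj g) (𝓕 g)))‖ ≤
      L ^ s * B * japaneseWeight (-s) (ξ + gradient Φ x) := by
    intro x ξ
    have h1 := norm_apply_fourierInv_tfShift g A x.fst ξ.fst x.snd ξ.snd
    rw [hK, fourier_fourierInvMap, ← tfShift_tensor] at h1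
    have h2 := hA (pt (-ξ.snd) x.snd) (pt x.fst (-ξ.fst))
    have hgeo := (hΦ.norm_sub_comparable h3 hκ hχ x.fst (-ξ.fst) (-ξ.snd) x.snd).2
    rw [← abs_of_nonneg hM, ← hL, neg_neg, neg_neg] at hgeo
    have h4 := japaneseWeight_neg_le_of_norm_le hs hL1 hgeo
    calc _ ≤ B * japaneseWeight (-s) (pt x.fst (-ξ.fst) - χ (pt (-ξ.snd) x.snd)) :=
          h1.le.trans h2
      _ ≤ B * (L ^ s * japaneseWeight (-s) (ξ + gradient Φ x)) := by
        gcongr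
        exact h4
      _ = _ := by ring
  have h5 := hC Φ hΦ.temperate hΦ.bound K (L ^ s * B) hKG x ξ
  exact h5.trans_eq (by ring)

end SinglePhase

/-! ### Uniformity in the time parameter -/

section TimeDependence

/-- Symbols in the class `Γ²` have temperate growth. -/
theorem IsShubin.hasTemperateGrowth {V : Type*} [NormedAddCommGroup V] [NormedSpace ℝ V]
    {a : V → ℝ} (ha : IsShubin 2 a) : a.HasTemperateGrowth := by
  refine ⟨ha.1, fun n => ?_⟩
  obtain ⟨C, hC⟩ := ha.2 n
  refine ⟨2, |C|, fun z => (hC z).trans ?_⟩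
  have h1 : japaneseWeight (2 - n) z ≤ (1 + ‖z‖) ^ 2 := by
    have h2 : japaneseWeight (2 - n) z ≤ (1 + ‖z‖ ^ 2) ^ (1 : ℝ) := by
      refine Real.rpow_le_rpow_of_exponent_le (by nlinarith [sq_nonneg ‖z‖]) ?_
      have : (0 : ℝ) ≤ n := n.cast_nonneg
      linarith
    rw [Real.rpow_one] at h2
    nlinarith [norm_nonneg z]
  have h0 := (japaneseWeight_pos (2 - n) z).le
  exact mul_le_mul (le_abs_self C) h1 h0 (abs_nonneg C)

variable {V : Type*} [NormedAddCommGroup V] [NormedSpace ℝ V]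

/-- A differentiable curve in `Γ²` is Lipschitz at each point with respect to the supremum norms
of the derivatives of order at least two. -/
theorem IsSmoothShubinCurve.eventually_norm_iteratedFDeriv_sub_le {T : ℝ} {Φ : ℝ → V → ℝ}
    (hΦ : IsSmoothShubinCurve 2 T Φ) {n : ℕ} (hn : 2 ≤ n) {t : ℝ} (ht : t ∈ Set.Ioo (-T) T) :
    ∃ R, 0 ≤ R ∧ ∀ᶠ τ in 𝓝 t, ∀ z, ‖iteratedFDeriv ℝ n (Φ τ - Φ t) z‖ ≤ |τ - t| * R := by
  obtain ⟨Ψ, rfl, hS, hlim⟩ := hΦ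
  obtain ⟨C, hC⟩ := (hS 1 t ht).2 n
  have hn' : (0 : ℝ) ≤ n - 2 := by
    have : (2 : ℝ) ≤ n := by exact_mod_cast hn
    linarith
  -- the difference quotient is eventually within distance `1` of the derivative in `Γ²`, and the
  -- weight `⟨z⟩^(n - 2)` is at least `1`
  have h1 : ∀ᶠ h in 𝓝[≠] (0 : ℝ), shubinSeminorm 2 n
      (fun z => h⁻¹ • (Ψ 0 (t + h) z - Ψ 0 t z) - Ψ 1 t z) < 1 :=
    (hlim 0 n t ht).eventually_lt_const one_pos
  rw [eventually_nhdsWithin_iff] at h1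
  have hsub : Tendsto (fun τ => τ - t) (𝓝 t) (𝓝 0) := by
    have : Continuous fun τ : ℝ => τ - t := by fun_prop
    simpa using this.tendsto t
  refine ⟨1 + |C|, by positivity, ?_⟩
  filter_upwards [hsub.eventually h1, Ioo_mem_nhds ht.1 ht.2] with τ hτ hτS z
  rcases eq_or_ne τ t with rfl | hne
  · have : Ψ 0 τ - Ψ 0 τ = fun _ => (0 : ℝ) := by funext; simp
    rw [this, iteratedFDeriv_fun_zero]
    simp
  have hh : τ - t ≠ 0 := sub_ne_zero.2 hne
  have h2 := hτ hh
  rw [add_sub_cancel] at h2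
  set D : V → ℝ := fun z => (τ - t)⁻¹ • (Ψ 0 τ z - Ψ 0 t z) - Ψ 1 t z with hD
  have h3 : ENNReal.ofReal (‖iteratedFDeriv ℝ n D z‖ * japaneseWeight (n - 2) z) < 1 :=
    lt_of_le_of_lt (le_iSup (fun z => ENNReal.ofReal
      (‖iteratedFDeriv ℝ n D z‖ * japaneseWeight (n - 2) z)) z) h2
  have h4 : ‖iteratedFDeriv ℝ n D z‖ ≤ 1 := by
    have h5 := (ENNReal.ofReal_lt_one.1 h3).le
    exact (le_mul_of_one_le_right (norm_nonneg _) (one_le_japaneseWeight hn' z)).trans h5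
  have hc0 : ContDiff ℝ n (Ψ 0 τ) := (hS 0 τ hτS).1.of_le (by exact_mod_cast le_top)
  have hc1 : ContDiff ℝ n (Ψ 0 t) := (hS 0 t ht).1.of_le (by exact_mod_cast le_top)
  have hc2 : ContDiff ℝ n (Ψ 1 t) := (hS 1 t ht).1.of_le (by exact_mod_cast le_top)
  have hcD : ContDiff ℝ n D := ((hc0.sub hc1).const_smul _).sub hc2
  have h6 : Ψ 0 τ - Ψ 0 t = (τ - t) • (D + Ψ 1 t) := by
    funext z
    simp only [hD, Pi.sub_apply, Pi.smul_apply, Pi.add_apply, sub_add_cancel, smul_smul,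
      mul_inv_cancel₀ hh, one_smul]
  have h7 : ‖iteratedFDeriv ℝ n (Ψ 1 t) z‖ ≤ |C| := by
    refine (hC z).trans ((mul_le_mul_of_nonneg_right (le_abs_self C)
      (japaneseWeight_pos _ z).le).trans (mul_le_of_le_one_right (abs_nonneg C)
      (japaneseWeight_le_one (by linarith) z)))
  rw [h6, iteratedFDeriv_const_smul_apply (f := D + Ψ 1 t) (hcD.add hc2).contDiffAt, norm_smul,
    Real.norm_eq_abs, iteratedFDeriv_add_apply hcD.contDiffAt hc2.contDiffAt]
  gcongr
  exact (norm_add_le _ _).trans (add_le_add h4 h7)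

theorem IsSmoothShubinCurve.eventually_norm_iteratedFDeriv_le {T : ℝ} {Φ : ℝ → V → ℝ}
    (hΦ : IsSmoothShubinCurve 2 T Φ) {n : ℕ} (hn : 2 ≤ n) {t : ℝ} (ht : t ∈ Set.Ioo (-T) T)
    (hb : ∃ C, ∀ z, ‖iteratedFDeriv ℝ n (Φ t) z‖ ≤ C) :
    ∃ M, 0 ≤ M ∧ ∀ᶠ τ in 𝓝 t, ∀ z, ‖iteratedFDeriv ℝ n (Φ τ) z‖ ≤ M := by
  obtain ⟨R, hR0, hR⟩ := hΦ.eventually_norm_iteratedFDeriv_sub_le hn ht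
  obtain ⟨C, hC⟩ := hb
  obtain ⟨Ψ, rfl, hS, -⟩ := hΦ
  refine ⟨R + |C|, by positivity, ?_⟩
  filter_upwards [hR, Metric.ball_mem_nhds t one_pos, Ioo_mem_nhds ht.1 ht.2] with τ h hτ hτS z
  have hc0 : ContDiff ℝ n (Ψ 0 τ) := (hS 0 τ hτS).1.of_le (by exact_mod_cast le_top)
  have hc1 : ContDiff ℝ n (Ψ 0 t) := (hS 0 t ht).1.of_le (by exact_mod_cast le_top)
  have hτ' : |τ - t| ≤ 1 := by
    rw [← Real.norm_eq_abs]
    exact (mem_ball_iff_norm.1 hτ).le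
  have h1 := iteratedFDeriv_add_apply (x := z) (hc0.sub hc1).contDiffAt hc1.contDiffAt
  rw [show (fun x => Ψ 0 τ x - Ψ 0 t x) + Ψ 0 t = Ψ 0 τ from sub_add_cancel _ _] at h1
  rw [h1]
  refine (norm_add_le _ _).trans (add_le_add ((h z).trans ?_) ((hC z).trans (le_abs_self C)))
  exact mul_le_of_le_one_left hR0 hτ'

/-- The constants of a smooth family of tame phases are locally uniform in the parameter. -/
theorem IsSmoothShubinCurve.exists_eventually_isControlledPhase {d : ℕ} {T : ℝ}
    {Φ : ℝ → Phase d → ℝ} (hΦ : IsSmoothShubinCurve 2 T Φ) {t : ℝ} (ht : t ∈ Set.Ioo (-T) T)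
    (htame : IsTamePhase (Φ t)) (n : ℕ) :
    ∃ M κ : ℝ, 0 < κ ∧ ∀ᶠ τ in 𝓝 t, IsControlledPhase n M κ (Φ τ) := by
  choose M hM0 hM using fun j : ℕ => hΦ.eventually_norm_iteratedFDeriv_le
    (Nat.le_add_left 2 j) ht (htame.bounded _ (Nat.le_add_left 2 j))
  obtain ⟨R, hR0, hR⟩ := hΦ.eventually_norm_iteratedFDeriv_sub_le le_rfl ht
  obtain ⟨C, hC⟩ := htame.bounded 2 le_rfl
  obtain ⟨c, hc, hdet⟩ := htame.nondegenerate
  obtain ⟨κ, hκ, hlow⟩ := exists_lowerBound_of_det (E := Space d) (M := C) hc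
  have hlow' : ∀ z u, κ * ‖u‖ ≤ ‖mixedHessian (Φ t) z u‖ := fun z =>
    hlow _ ((norm_mixedHessian_le htame.smooth z).trans (hC z)) (by
      have h := det_mixedHessian htame.smooth z.fst z.snd
      have hz : pt z.fst z.snd = z := rfl
      rw [hz] at h
      rw [h]
      exact hdet _ _)
  obtain ⟨Ψ, hΨ0, hS, -⟩ := hΦ
  have hδ : 0 < κ / 2 / (R + 1) := by positivity
  refine ⟨∑ j ∈ Finset.range n, M j, κ / 2, by positivity, ?_⟩
  filter_upwards [(Finset.range n).eventually_all.2 fun j _ => hM j, hR,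
    Metric.ball_mem_nhds t hδ, Ioo_mem_nhds ht.1 ht.2] with τ hb hτR hτ hτS
  have hSτ : IsShubin 2 (Φ τ) := by rw [← hΨ0]; exact hS 0 τ hτS
  refine ⟨hSτ.hasTemperateGrowth, fun i hi hin z => ?_, fun z u => ?_⟩
  · obtain ⟨j, rfl⟩ : ∃ j, i = j + 2 := ⟨i - 2, by omega⟩
    have hj : j ∈ Finset.range n := Finset.mem_range.2 (by omega)
    exact (hb j hj z).trans (Finset.single_le_sum (fun k _ => hM0 k) hj)
  · have h1 := norm_mixedHessian_sub_mixedHessian_le hSτ.1 htame.smooth z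
    have h2 : |τ - t| * R ≤ κ / 2 := by
      have h3 : |τ - t| * (R + 1) ≤ κ / 2 := by
        rw [← le_div_iff₀ (by positivity), ← Real.norm_eq_abs]
        exact (mem_ball_iff_norm.1 hτ).le
      nlinarith [abs_nonneg (τ - t)]
    have h4 := (mixedHessian (Φ τ) z - mixedHessian (Φ t) z).le_of_opNorm_le
      (h1.trans ((hτR z).trans h2)) u
    have h5 := hlow' z u
    have h6 : ‖mixedHessian (Φ t) z u‖ ≤ ‖mixedHessian (Φ τ) z u‖ +
        ‖(mixedHessian (Φ τ) z - mixedHessian (Φ t) z) u‖ := by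
      have h7 : mixedHessian (Φ t) z u = mixedHessian (Φ τ) z u -
          (mixedHessian (Φ τ) z - mixedHessian (Φ t) z) u := by
        rw [sub_apply, sub_sub_cancel]
      rw [h7]
      exact norm_sub_le _ _
    linarith

/-- A property of constants that is stable under enlarging the constant and holds locally
uniformly on an interval holds with a constant depending continuously on the point. -/
theorem exists_continuousOn_forall_of_eventually {S : Set ℝ} {P : ℝ → ℝ → Prop}
    (hP : ∀ t ∈ S, ∀ C C', C ≤ C' → P t C → P t C')
    (h : ∀ t ∈ S, ∃ C, ∀ᶠ τ in 𝓝 t, τ ∈ S → P τ C) :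
    ∃ f : ℝ → ℝ, ContinuousOn f S ∧ ∀ t ∈ S, P t (f t) := by
  obtain ⟨f, hf⟩ := exists_continuous_forall_mem_convex_of_local_const (X := S) (E := ℝ)
    (t := fun τ => {C | P τ C})
    (fun τ => Set.OrdConnected.convex (𝕜 := ℝ) ⟨fun C hC C' _ D hD => hP τ τ.2 C D hD.1 hC⟩)
    (fun τ => by
      obtain ⟨C, hC⟩ := h τ τ.2
      refine ⟨C, ?_⟩
      filter_upwards [continuous_subtype_val.continuousAt.eventually hC] with x hx
      exact hx x.2)
  classical
  refine ⟨fun τ => if hτ : τ ∈ S then f ⟨τ, hτ⟩ else 0, ?_, fun t ht => ?_⟩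
  · rw [continuousOn_iff_continuous_domRestrict]
    convert f.continuous using 1
    funext τ
    simp
  · have h1 := hf ⟨t, ht⟩
    simpa [ht] using h1

end TimeDependence

end

end TypeOneFIO

theorem mainTheorem8 (d : ℕ)
    (g : 𝓢(Space d, ℂ)) (hg : g ≠ 0)
    (ψ : 𝓢(Phase d, ℂ)) (hψ : ψ ≠ 0)
    (s : ℝ) (hs : 0 ≤ s) (T : ℝ) (hT : 0 < T)
    (a : Phase d → ℂ) (a₂ : Phase d → ℝ)
    (ha : IsClassicalShubin 2 a (fun z => (a₂ z : ℂ)))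
    (Φ : ℝ → Phase d → ℝ)
    (hΦ : IsSmoothShubinCurve 2 T Φ)
    (hΦtame : ∀ t ∈ Set.Ioo (-T) T, IsTamePhase (Φ t))
    (hΦeik : SolvesEikonal a₂ T Φ)
    (χ : ℝ → Phase d → Phase d)
    (hχ : ∀ t ∈ Set.Ioo (-T) T, IsCanonicalTransformationOf (χ t) (Φ t))
    (I : ℝ → 𝓢(Space d, ℂ) →L[ℂ] 𝓢'(Space d, ℂ)) :
    (∃ (σ : ℝ → 𝓢'(Phase d, ℂ)) (H : ℝ → ℝ), ContinuousOn H (Set.Ioo (-T) T) ∧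
      ∀ t ∈ Set.Ioo (-T) T,
        IsTypeOneFIO (σ t) (Φ t) (I t) ∧
        MemModulation ψ s (σ t) ∧ modulationNorm ψ s (σ t) ≤ H t) ↔
    (∃ C : ℝ → ℝ, ContinuousOn C (Set.Ioo (-T) T) ∧
      ∀ t ∈ Set.Ioo (-T) T,
        MemFIO g (χ t) s (I t) ∧ HasGaborDecay g (χ t) s (I t) (C t)) := by
  -- a function that is continuous on the interval is bounded by a constant near each point
  have hbdd : ∀ {H : ℝ → ℝ}, ContinuousOn H (Set.Ioo (-T) T) → ∀ t ∈ Set.Ioo (-T) T,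
      ∀ᶠ τ in 𝓝 t, H τ ≤ H t + 1 := fun hH t ht =>
    ((hH.continuousAt (Ioo_mem_nhds ht.1 ht.2)).eventually_lt_const (lt_add_one _)).mono
      fun _ h => h.le
  constructor
  · rintro ⟨σ, H, hH, hσ⟩
    obtain ⟨C, hC, h⟩ := exists_continuousOn_forall_of_eventually (S := Set.Ioo (-T) T)
      (P := fun t C => HasGaborDecay g (χ t) s (I t) C)
      (fun t _ C C' hCC h w z => (h w z).trans
        (mul_le_mul_of_nonneg_right hCC (japaneseWeight_pos _ _).le)) (fun t ht => by
        obtain ⟨M, κ, hκ, hc⟩ := hΦ.exists_eventually_isControlledPhase ht (hΦtame t ht)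
          (derivOrder (Phase d) s)
        obtain ⟨C, hC0, hC⟩ := exists_hasGaborDecay_of_isTypeOneFIO g hψ hs (M := M) hκ
        refine ⟨C * (H t + 1), ?_⟩
        filter_upwards [hc, hbdd hH t ht] with τ hτ hHτ hτS w z
        obtain ⟨h1, h2, h3⟩ := hσ τ hτS
        refine (hC _ _ _ _ hτ (hχ τ hτS) h1 h2 w z).trans
          (mul_le_mul_of_nonneg_right ?_ (japaneseWeight_pos _ _).le)
        exact mul_le_mul_of_nonneg_left (h3.trans hHτ) hC0)
    exact ⟨C, hC, fun t ht => ⟨⟨C t, h t ht⟩, h t ht⟩⟩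
  · rintro ⟨B, hB, hI⟩
    obtain ⟨H, hH, h⟩ := exists_continuousOn_forall_of_eventually (S := Set.Ioo (-T) T)
      (P := fun t C => ∃ σ : 𝓢'(Phase d, ℂ), IsTypeOneFIO σ (Φ t) (I t) ∧
        MemModulation ψ s σ ∧ modulationNorm ψ s σ ≤ C)
      (fun t _ C C' hCC ⟨σ, h1, h2, h3⟩ => ⟨σ, h1, h2, h3.trans hCC⟩) (fun t ht => by
        obtain ⟨M, κ, hκ, hc⟩ := hΦ.exists_eventually_isControlledPhase ht (hΦtame t ht)
          (derivOrder (Phase d) s)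
        obtain ⟨C, hC0, hC⟩ := exists_isTypeOneFIO_of_hasGaborDecay hg ψ hs (M := M) hκ
        refine ⟨C * max (B t + 1) 0, ?_⟩
        filter_upwards [hc, hbdd hB t ht] with τ hτ hBτ hτS
        obtain ⟨σ, h1, h2⟩ := hC _ _ _ _ hτ (hχ τ hτS) (hI τ hτS).2
        have h3 : modulationENorm ψ s σ ≤ ENNReal.ofReal (C * max (B t + 1) 0) :=
          h2.trans (ENNReal.ofReal_le_ofReal
            (mul_le_mul_of_nonneg_left (hBτ.trans (le_max_left _ _)) hC0))
        exact ⟨σ, h1, h3.trans_lt ENNReal.ofReal_lt_top,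
          ENNReal.toReal_le_of_le_ofReal (mul_nonneg hC0 (le_max_right _ _)) h3⟩)
    choose! σ hσ using h
    exact ⟨σ, H, hH, hσ⟩
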